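/- Consider the one-dimensional screened Vlasov–Poisson system for $\mu:\mathbb R_x\times\mathbb R_v\times[0,T]\to\mathbb R$, $$\partial_t\mu+v\,\partial_x\mu-\partial_x\phi\,\partial_v\mu=0,\qquad (1-\partial_x^2)\phi(x,t)=\int_{\mathbb R}\mu^2(x,v,t)\,dv,$$ where $\phi(\cdot,t)$ is the bounded solution of the second equation. For $\lambda>0$ and $f:\mathbb R_x\times\mathbb R_v\to\mathbb R$ put $$\mathcal E_x^\lambda[f]:=\sum_{n=0}^\infty\frac{\lambda^n}{n!}\|\partial_x^nf\|_{L^2_{x,v}},\qquad \mathcal E_v^\lambda[f]:=\sum_{n=0}^\infty\frac{\lambda^n}{n!}\|\partial_v^nf\|_{L^2_{x,v}},\qquad \langle t\rangle:=(1+t^2)^{1/2}.$$ **Theorem (long-time stability in $d=1$).** There exist universal constants $C,c,K,\varepsilon_0>0$ such that the following holds. Let $R>0$, let $0<\varepsilon\le\varepsilon_0\min\{1,R^{1/2}\}$, and let $\mu_0:\mathbb R_x\times\mathbb R_v\to\mathbb R$ satisfy $$\sum_{a\in\{0,1\}}\left(\mathcal E_x^R[\partial_x^a\mu_0]+\mathcal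 E_v^R[\partial_v^a\mu_0]\right)\le\varepsilon .$$ Then there exist $T\ge c\,R^2\varepsilon^{-4}$ and a unique smooth solution $\mu\in C([0,T],\bigcap_{k\ge0}H^k_{x,v}(\mathbb R\times\mathbb R))$ of the system with $\mu(x,v,0)=\mu_0(x,v)$. Moreover, with $\lambda_t:=R-C\varepsilon^2\langle t\rangle^{1/2}$, the profile $\gamma(x,v,t):=\mu(x+tv,v,t)$ satisfies, for all $0\le t\le T$, $$\lambda_t>0\qquad\text{and}\qquad\sum_{a\in\{0,1\}}\left(\mathcal E_v^{\lambda_t}[\partial_v^a\gamma(t)]+\mathcal E_x^{\lambda_t}[\partial_x^a\gamma(t)]\right)\le K\varepsilon .$$ -/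

import Mathlib

open MeasureTheory Set Filter Topology
open scoped ENNReal ContDiff

noncomputable section

namespace ScreenedVP

/-- The partial derivative in the first (space) variable of a function of `(x, v)`. -/
def dx (f : ℝ × ℝ → ℝ) (p : ℝ × ℝ) : ℝ := deriv (fun y => f (y, p.2)) p.1

/-- The partial derivative in the second (velocity) variable of a function of `(x, v)`. -/
def dv (f : ℝ × ℝ → ℝ) (p : ℝ × ℝ) : ℝ := deriv (fun w => f (p.1, w)) p.2

/-- `g` is the weak derivative `∂_x^i ∂_v^j f` on `ℝ × ℝ`. -/
structure IsWeakDeriv (i j : ℕ) (f g : ℝ × ℝ → ℝ) : Prop where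
  locallyIntegrable : LocallyIntegrable f
  locallyIntegrable_deriv : LocallyIntegrable g
  integral_eq : ∀ ψ : ℝ × ℝ → ℝ, ContDiff ℝ ∞ ψ → HasCompactSupport ψ →
    ∫ p, f p * (dx^[i] (dv^[j] ψ)) p = (-1) ^ (i + j) * ∫ p, g p * ψ p

/-- `‖∂_x^i ∂_v^j f‖_{L²_{x,v}}` with weak derivatives. Weak derivatives are unique up to null sets,
so the infimum runs over one value; it is `∞` if the weak derivative does not exist. -/
def derivNorm (i j : ℕ) (f : ℝ × ℝ → ℝ) : ℝ≥0∞ :=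
  ⨅ (g : ℝ × ℝ → ℝ) (_ : IsWeakDeriv i j f g), eLpNorm g 2 volume

/-- The norm of `H^k_{x,v}(ℝ × ℝ)`, equal to `∞` off that space. -/
def sobolevNorm (k : ℕ) (f : ℝ × ℝ → ℝ) : ℝ≥0∞ :=
  ∑ i ∈ Finset.range (k + 1), ∑ j ∈ Finset.range (k + 1 - i), derivNorm i j f

/-- The analytic energy `E_x^lam[∂_x^a f] = ∑ₙ lamⁿ / n! ‖∂_x^(n+a) f‖_{L²_{x,v}}`
(for `0 ≤ lam`). -/
def energyX (lam : ℝ) (a : ℕ) (f : ℝ × ℝ → ℝ) : ℝ≥0∞ :=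
  ∑' n : ℕ, ENNReal.ofReal (lam ^ n / (n.factorial : ℝ)) * derivNorm (n + a) 0 f

/-- The analytic energy `E_v^lam[∂_v^a f] = ∑ₙ lamⁿ / n! ‖∂_v^(n+a) f‖_{L²_{x,v}}`
(for `0 ≤ lam`). -/
def energyV (lam : ℝ) (a : ℕ) (f : ℝ × ℝ → ℝ) : ℝ≥0∞ :=
  ∑' n : ℕ, ENNReal.ofReal (lam ^ n / (n.factorial : ℝ)) * derivNorm 0 (n + a) f

/-- The sum over `a ∈ {0, 1}` of `E_x^lam[∂_x^a f] + E_v^lam[∂_v^a f]`. -/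
def totalEnergy (lam : ℝ) (f : ℝ × ℝ → ℝ) : ℝ≥0∞ :=
  ∑ a ∈ Finset.range 2, (energyX lam a f + energyV lam a f)

/-- The Japanese bracket `⟨t⟩ = (1 + t²)^{1/2}`. -/
def bracket (t : ℝ) : ℝ := Real.sqrt (1 + t ^ 2)

/-- The profile `γ(x, v, t) = μ(x + t v, v, t)`. -/
def profile (μ : ℝ → ℝ × ℝ → ℝ) (t : ℝ) (p : ℝ × ℝ) : ℝ := μ t (p.1 + t * p.2, p.2)

/-- `(μ, φ)` is a smooth solution on `[0, T]` of the one-dimensional screened Vlasov-Poisson system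
`∂_t μ + v ∂_x μ - ∂_x φ ∂_v μ = 0`, `(1 - ∂_x²) φ = ρ = ∫ μ² dv`, with initial value `μ₀` and with
`μ ∈ C([0, T], ⋂ₖ H^k_{x,v})`. An element of `⋂ₖ H^k` is represented by its smooth representative.
The boundedness of `φ(t, ·)` singles out the solution `(1 - ∂_x²)⁻¹ ρ` of the second equation. -/
structure IsSolution (T : ℝ) (μ₀ : ℝ × ℝ → ℝ) (μ : ℝ → ℝ × ℝ → ℝ) (φ : ℝ → ℝ → ℝ) : Prop where
  initial : μ 0 =ᵐ[volume] μ₀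
  smooth : ∀ t ∈ Icc 0 T, ContDiff ℝ ∞ (μ t)
  mem_sobolev : ∀ t ∈ Icc 0 T, ∀ k : ℕ, sobolevNorm k (μ t) < ⊤
  continuous_sobolev : ∀ t ∈ Icc 0 T, ∀ k : ℕ,
    Tendsto (fun s => sobolevNorm k (fun p => μ s p - μ t p)) (𝓝[Icc 0 T] t) (𝓝 0)
  transport : ∀ t ∈ Icc 0 T, ∀ x v : ℝ,
    HasDerivWithinAt (fun s => μ s (x, v))
      (-(v * dx (μ t) (x, v)) + deriv (φ t) x * dv (μ t) (x, v)) (Icc 0 T) t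
  density_integrable : ∀ t ∈ Icc 0 T, ∀ x : ℝ, Integrable (fun v => μ t (x, v) ^ 2)
  potential_smooth : ∀ t ∈ Icc 0 T, ContDiff ℝ 2 (φ t)
  potential_bounded : ∀ t ∈ Icc 0 T, ∃ M : ℝ, ∀ x : ℝ, |φ t x| ≤ M
  poisson : ∀ t ∈ Icc 0 T, ∀ x : ℝ,
    φ t x - deriv (deriv (φ t)) x = ∫ v, μ t (x, v) ^ 2

end ScreenedVP

end

open MeasureTheory Set Filter Topology
open scoped ENNReal ContDiff

noncomputable section

namespace ScreenedVP

/-! The profile satisfies `∂_t γ = (∂_x φ)(x + t v, t) (∂_v - t ∂_x) γ`, so all evolution is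
nonlinear. In Fourier variables `f` this reads `∂_t f = nl t f`, with `nl` a cubic integral: a
correlation of `f` with itself along the line of direction `(1, t)` (the density), the multiplier of
`∂_x (1 - ∂_x²)⁻¹`, and the symbol of `∂_v - t ∂_x` on the third factor.

The quantitative core is `gen_en_nlMaj_le`. The operator `∂_v - t ∂_x` costs one derivative and a
factor `1 + t`. The factor is repaid by the field (`lintegral_fieldMult_le`): the numerator `k` of
the multiplier turns `t` into `t k`, which is at most the length of the frequency `(k, t k)` and
hence a derivative on one of the two factors of the density. Moreover the correlation is evaluated
at `t k`, and this dilation gives decay `t^(-1/2)` of its `L²` norm. In terms of the exponential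
generating function of the weighted norms, the nonlinearity is bounded by `(1 + t)^(-1/2)` times one
derivative in the radius of analyticity times the square of the energy.

This loss is absorbed as in the Cauchy–Kovalevskaya theorem. The radius shrinks at a speed
proportional to `ε² (1 + t)^(-1/2)`, so the lost derivative, weighted by this speed, is integrable
in time (`lintegral_radiusSpeed_mul_gen_le`), and the cubic term closes against data of size `ε`
(`EnergyBound.duhamelMaj`, `small_of_lossConst`). The radius has then shrunk by about `ε² √t`, which
stays below `R` up to times of order `R² / ε⁴`.

Existence needs no contraction argument. All estimates use absolute values only, so they hold for a
positive majorant equation, whose iterates increase to a limit `majLim`. The increments of the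
complex Picard iterates are dominated by the increments of the majorant iterates (`Dom`,
`dom_duhamel`), hence they converge wherever `majLim` is finite, and the limit solves the Duhamel
equation (`sol_eq_duhamel`). Its inverse Fourier transform, sheared back, is the solution
(`Flow.isSolution`). The data enters through the Fourier transform of its weak derivatives
(`exists_transform`).

Uniqueness holds in the whole solution class by an `L²` estimate and Gronwall. A bounded potential
and its derivative are controlled by the `L¹` norm of the density (`abs_le_of_screened`); since `v
∂_x μ` need not be square integrable, the energy carries a weight in `v` that is removed in the
limit. -/

/-! ### The `L²` norm of functions with values in `[0, ∞]` -/

section L2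

variable {α β : Type*} [MeasurableSpace α] [MeasurableSpace β]

/-- The `L²` norm of a function with values in `[0, ∞]`. -/
def l2 (μ : Measure α) (F : α → ℝ≥0∞) : ℝ≥0∞ := (∫⁻ a, F a ^ 2 ∂μ) ^ (1 / 2 : ℝ)

theorem l2_sq (μ : Measure α) (F : α → ℝ≥0∞) : l2 μ F ^ 2 = ∫⁻ a, F a ^ 2 ∂μ := by
  rw [l2, ← ENNReal.rpow_natCast, ← ENNReal.rpow_mul]
  norm_num

theorem le_of_sq_le_sq {a b : ℝ≥0∞} (h : a ^ 2 ≤ b ^ 2) : a ≤ b :=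
  (ENNReal.pow_le_pow_left_iff two_ne_zero).1 h

theorem eLpNorm_eq_l2 {E : Type*} [NormedAddCommGroup E] (μ : Measure α) (f : α → E) :
    eLpNorm f 2 μ = l2 μ (fun a => ‖f a‖ₑ) := by
  rw [eLpNorm_eq_lintegral_rpow_enorm_toReal two_ne_zero ENNReal.ofNat_ne_top, l2]
  simp

theorem l2_mono {μ : Measure α} {F G : α → ℝ≥0∞} (h : ∀ a, F a ≤ G a) : l2 μ F ≤ l2 μ G := by
  unfold l2
  gcongr with a
  exact h a

theorem l2_const_mul (μ : Measure α) (c : ℝ≥0∞) {F : α → ℝ≥0∞} (hF : Measurable F) :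
    l2 μ (fun a => c * F a) = c * l2 μ F := by
  apply le_antisymm <;> apply le_of_sq_le_sq <;>
    simp only [l2_sq, mul_pow] <;> rw [lintegral_const_mul _ (hF.pow_const 2)]

theorem lintegral_mul_le_l2 (μ : Measure α) {F G : α → ℝ≥0∞} (hF : Measurable F)
    (hG : Measurable G) : ∫⁻ a, F a * G a ∂μ ≤ l2 μ F * l2 μ G := by
  have := ENNReal.lintegral_mul_le_Lp_mul_Lq μ Real.HolderConjugate.two_two hF.aemeasurable
    hG.aemeasurable
  simpa [l2] using this

theorem l2_add_le (μ : Measure α) {F G : α → ℝ≥0∞} (hF : Measurable F) (hG : Measurable G) :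
    l2 μ (fun a => F a + G a) ≤ l2 μ F + l2 μ G := by
  have := ENNReal.lintegral_Lp_add_le (μ := μ) (p := 2) hF.aemeasurable hG.aemeasurable
    one_le_two
  simpa [l2] using this

theorem l2_sum_le {ι : Type*} (μ : Measure α) (s : Finset ι) {F : ι → α → ℝ≥0∞}
    (hF : ∀ i, Measurable (F i)) :
    l2 μ (fun a => ∑ i ∈ s, F i a) ≤ ∑ i ∈ s, l2 μ (F i) := by
  classical
  induction s using Finset.induction_on with
  | empty => simp [l2]
  | insert i s hi ih =>
    simp only [Finset.sum_insert hi]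
    exact (l2_add_le μ (hF i) (Finset.measurable_sum _ fun j _ => hF j)).trans (by gcongr)

/-- Minkowski's integral inequality in `L²`. -/
theorem l2_lintegral_le (μ : Measure α) (ν : Measure β) [SFinite μ] [SFinite ν]
    {F : β → α → ℝ≥0∞} (hF : Measurable (Function.uncurry F)) :
    l2 μ (fun a => ∫⁻ b, F b a ∂ν) ≤ ∫⁻ b, l2 μ (F b) ∂ν := by
  have hFb : ∀ b, Measurable (F b) := fun b => hF.comp measurable_prodMk_left
  have hFa : ∀ a, Measurable fun b => F b a := fun a => hF.comp measurable_prodMk_right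
  apply le_of_sq_le_sq
  rw [l2_sq]
  have hl : Measurable fun b => l2 μ (F b) := by
    unfold l2
    exact ((hF.pow_const 2).lintegral_prod_right' (f := fun x : β × α => F x.1 x.2 ^ 2)).pow_const _
  -- The square is a double integral over `(b, b')`; Tonelli moves the integral over `a` inside,
  -- where Cauchy–Schwarz applies for each pair.
  calc ∫⁻ a, (∫⁻ b, F b a ∂ν) ^ 2 ∂μ
      = ∫⁻ a, ∫⁻ b, ∫⁻ b', F b a * F b' a ∂ν ∂ν ∂μ := by
        refine lintegral_congr fun a => ?_
        rw [sq, ← lintegral_mul_const _ (hFa a)]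
        refine lintegral_congr fun b => ?_
        rw [lintegral_const_mul _ (hFa a)]
    _ = ∫⁻ b, ∫⁻ a, ∫⁻ b', F b a * F b' a ∂ν ∂μ ∂ν := by
        rw [lintegral_lintegral_swap]
        apply Measurable.aemeasurable
        apply Measurable.lintegral_prod_right' (f := fun x : (α × β) × β => F x.1.2 x.1.1 * F x.2 x.1.1)
        exact (hF.comp (by fun_prop : Measurable fun x : (α × β) × β => (x.1.2, x.1.1))).mul
          (hF.comp (by fun_prop : Measurable fun x : (α × β) × β => (x.2, x.1.1)))
    _ = ∫⁻ b, ∫⁻ b', ∫⁻ a, F b a * F b' a ∂μ ∂ν ∂ν := by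
        refine lintegral_congr fun b => ?_
        rw [lintegral_lintegral_swap]
        apply Measurable.aemeasurable
        exact ((hFb b).comp measurable_fst).mul
          (hF.comp (by fun_prop : Measurable fun x : α × β => (x.2, x.1)))
    _ ≤ ∫⁻ b, ∫⁻ b', l2 μ (F b) * l2 μ (F b') ∂ν ∂ν := by
        gcongr with b b'
        exact lintegral_mul_le_l2 μ (hFb b) (hFb b')
    _ = (∫⁻ b, l2 μ (F b) ∂ν) ^ 2 := by
        rw [sq, ← lintegral_mul_const _ hl]
        refine lintegral_congr fun b => ?_
        rw [lintegral_const_mul _ hl]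

theorem measurable_l2 {μ : Measure α} [SFinite μ] {F : β → α → ℝ≥0∞}
    (hF : Measurable (Function.uncurry F)) : Measurable fun b => l2 μ (F b) := by
  unfold l2
  exact ((hF.pow_const 2).lintegral_prod_right' (f := fun x : β × α => F x.1 x.2 ^ 2)).pow_const _

/-- Monotone convergence; squaring and taking the root are order isomorphisms of `[0, ∞]` and so
commute with suprema. -/
theorem l2_iSup (μ : Measure α) {F : ℕ → α → ℝ≥0∞} (hF : ∀ n, Measurable (F n))
    (hmono : Monotone F) : l2 μ (fun a => ⨆ n, F n a) = ⨆ n, l2 μ (F n) := by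
  have h1 : ∀ a, (⨆ n, F n a) ^ 2 = ⨆ n, F n a ^ 2 := fun a => by
    have := (ENNReal.orderIsoRpow (2 : ℝ) two_pos).map_iSup (fun n => F n a)
    simp only [ENNReal.orderIsoRpow_apply] at this
    exact_mod_cast this
  unfold l2
  simp only [h1]
  rw [lintegral_iSup (fun n => (hF n).pow_const 2)
    (fun m n hmn a => by dsimp only; gcongr; exact hmono hmn a)]
  exact (ENNReal.orderIsoRpow (1 / 2 : ℝ) (by norm_num)).map_iSup _

theorem l2_comp_measurePreserving {μ : Measure α} {ν : Measure β} {g : α → β}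
    (hg : MeasurePreserving g μ ν) {F : β → ℝ≥0∞} (hF : Measurable F) :
    l2 μ (fun a => F (g a)) = l2 ν F := by
  unfold l2
  rw [← hg.lintegral_comp (hF.pow_const 2)]

end L2

/-! ### Exponential generating functions of sequences of norms -/

/-- Exponential generating function with parameter `lam`. -/
def gen (lam : ℝ) (u : ℕ → ℝ≥0∞) : ℝ≥0∞ :=
  ∑' n : ℕ, ENNReal.ofReal (lam ^ n / (n.factorial : ℝ)) * u n

/-- Binomial convolution of sequences. -/
def bconv (u v : ℕ → ℝ≥0∞) (n : ℕ) : ℝ≥0∞ :=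
  ∑ ij ∈ Finset.HasAntidiagonal.antidiagonal n, (n.choose ij.1 : ℝ≥0∞) * (u ij.1 * v ij.2)

/-- The shift of a sequence, which is the derivative of its exponential generating function. -/
def shift (u : ℕ → ℝ≥0∞) (n : ℕ) : ℝ≥0∞ := u (n + 1)

theorem gen_mono {lam : ℝ} {u v : ℕ → ℝ≥0∞} (h : ∀ n, u n ≤ v n) : gen lam u ≤ gen lam v :=
  ENNReal.tsum_le_tsum fun n => mul_le_mul_right (h n) _

theorem gen_mono_left {a b : ℝ} (ha : 0 ≤ a) (hab : a ≤ b) (u : ℕ → ℝ≥0∞) :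
    gen a u ≤ gen b u := by
  refine ENNReal.tsum_le_tsum fun n => ?_
  gcongr

theorem gen_add (lam : ℝ) (u v : ℕ → ℝ≥0∞) :
    gen lam (fun n => u n + v n) = gen lam u + gen lam v := by
  simp only [gen, mul_add, ENNReal.tsum_add]

theorem gen_const_mul (lam : ℝ) (c : ℝ≥0∞) (u : ℕ → ℝ≥0∞) :
    gen lam (fun n => c * u n) = c * gen lam u := by
  simp only [gen, ← ENNReal.tsum_mul_left]
  congr 1; ext n; ring

/-- The binomial coefficient splits `lam ^ n / n!` into the weights of the two factors, so this is
the Cauchy product. It lets Leibniz expansions of all orders be summed at once. -/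
theorem gen_bconv {lam : ℝ} (hl : 0 ≤ lam) (u v : ℕ → ℝ≥0∞) :
    gen lam (bconv u v) = gen lam u * gen lam v := by
  unfold gen
  rw [← ENNReal.tsum_mul_right]
  simp only [← ENNReal.tsum_mul_left]
  rw [← ENNReal.tsum_prod (f := fun i j => ENNReal.ofReal (lam ^ i / (i.factorial : ℝ)) * u i *
    (ENNReal.ofReal (lam ^ j / (j.factorial : ℝ)) * v j)),
    ← Finset.HasAntidiagonal.sigmaAntidiagonalEquivProd.tsum_eq, ENNReal.tsum_sigma']
  refine tsum_congr fun n => ?_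
  rw [tsum_fintype, bconv, Finset.mul_sum, ← Finset.sum_coe_sort]
  refine Finset.sum_congr rfl fun ij _ => ?_
  obtain ⟨⟨i, j⟩, hij⟩ := ij
  have hn : i + j = n := by simpa using hij
  subst hn
  simp only [Finset.HasAntidiagonal.sigmaAntidiagonalEquivProd_apply]
  have : ENNReal.ofReal (lam ^ (i + j) / ((i + j).factorial : ℝ)) * ((i + j).choose i : ℝ≥0∞) =
      ENNReal.ofReal (lam ^ i / (i.factorial : ℝ)) * ENNReal.ofReal (lam ^ j / (j.factorial : ℝ)) := by
    rw [← ENNReal.ofReal_natCast, ← ENNReal.ofReal_mul (by positivity),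
      ← ENNReal.ofReal_mul (by positivity)]
    congr 1
    have h0 := Nat.choose_mul_factorial_mul_factorial (Nat.le_add_right i j)
    rw [Nat.add_sub_cancel_left] at h0
    rw [← h0]
    have h1 : (i.factorial : ℝ) ≠ 0 := by positivity
    have h2 : (j.factorial : ℝ) ≠ 0 := by positivity
    have h3 : ((i + j).choose i : ℝ) ≠ 0 := by
      exact_mod_cast (Nat.choose_pos (Nat.le_add_right i j)).ne'
    push_cast
    field_simp
    ring
  calc _ = (ENNReal.ofReal (lam ^ (i + j) / ((i + j).factorial : ℝ)) * ((i + j).choose i : ℝ≥0∞)) *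
        (u i * v j) := by ring
    _ = _ := by rw [this]; ring

/-- Pascal's rule, which is the product rule for the derivative in the radius. -/
theorem shift_bconv (u v : ℕ → ℝ≥0∞) (n : ℕ) :
    shift (bconv u v) n = bconv (shift u) v n + bconv u (shift v) n := by
  have := Finset.sum_antidiagonal_choose_succ_mul (fun i j => u i * v j) n
  simp only [shift, bconv]
  rw [this, add_comm]
  congr 1
  refine Finset.sum_congr rfl fun ij h => ?_
  rw [Nat.choose_symm_of_eq_add (Finset.HasAntidiagonal.mem_antidiagonal.1 h).symm]

theorem bconv_mono {u u' v v' : ℕ → ℝ≥0∞} (h : ∀ n, u n ≤ u' n) (h' : ∀ n, v n ≤ v' n) (n : ℕ) :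
    bconv u v n ≤ bconv u' v' n := by
  unfold bconv
  exact Finset.sum_le_sum fun ij _ => mul_le_mul_right (mul_le_mul' (h _) (h' _)) _

/-! ### Correlations along lines -/

/-- The length of a frequency, `2π` times the supremum norm. -/
def rad (p : ℝ × ℝ) : ℝ≥0∞ := ENNReal.ofReal (2 * Real.pi * ‖p‖)

theorem measurable_rad : Measurable rad := by
  unfold rad
  fun_prop

theorem rad_add_le (p q : ℝ × ℝ) : rad (p + q) ≤ rad p + rad q := by
  unfold rad
  rw [← ENNReal.ofReal_add (by positivity) (by positivity), ← mul_add]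
  gcongr
  exact norm_add_le p q

theorem rad_neg (p : ℝ × ℝ) : rad (-p) = rad p := by simp [rad]

theorem rad_sub_le (p q : ℝ × ℝ) : rad (p - q) ≤ rad p + rad q := by
  rw [sub_eq_add_neg, ← rad_neg q]
  exact rad_add_le _ _

/-- The `L²` norm of `1 / (1 + |x|)`, a finite constant. -/
def sobConst : ℝ≥0∞ := l2 volume (fun x : ℝ => (1 + ENNReal.ofReal (2 * Real.pi * |x|))⁻¹)

theorem sobConst_lt_top : sobConst < ⊤ := by
  unfold sobConst l2
  refine ENNReal.rpow_lt_top_of_nonneg (by norm_num) (ne_of_lt ?_)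
  have h := (integrable_inv_one_add_sq).2
  refine lt_of_le_of_lt (lintegral_mono fun x => ?_) h
  rw [← ENNReal.inv_pow, Real.enorm_eq_ofReal (by positivity), ← ENNReal.ofReal_one,
    ← ENNReal.ofReal_add zero_le_one (by positivity), ← ENNReal.ofReal_pow (by positivity),
    ← ENNReal.ofReal_inv_of_pos (by positivity)]
  apply ENNReal.ofReal_le_ofReal
  refine inv_anti₀ (by positivity) ?_
  have h1 : |x| ≤ 2 * Real.pi * |x| := by
    nlinarith [Real.pi_gt_three, abs_nonneg x]
  have h2 := sq_abs x
  nlinarith [abs_nonneg x]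

/-- Cauchy–Schwarz against `1 / (1 + 2π|x|)`, which is square integrable on the line. On the Fourier
side this is the one-dimensional Sobolev embedding at the price of one derivative. -/
theorem lintegral_le_sobConst {B : ℝ → ℝ≥0∞} (hB : Measurable B) :
    ∫⁻ x, B x ≤ sobConst * l2 volume (fun x => (1 + ENNReal.ofReal (2 * Real.pi * |x|)) * B x) := by
  have hm : Measurable fun x : ℝ => 1 + ENNReal.ofReal (2 * Real.pi * |x|) := by fun_prop
  refine le_trans (le_of_eq ?_) (lintegral_mul_le_l2 volume hm.inv (hm.mul hB))
  refine lintegral_congr fun x => ?_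
  change _ = (1 + ENNReal.ofReal (2 * Real.pi * |x|))⁻¹ * ((1 + ENNReal.ofReal (2 * Real.pi * |x|)) * B x)
  rw [← mul_assoc, ENNReal.inv_mul_cancel (by simp) (by simp), one_mul]

/-- Young's inequality: Minkowski in `x`, then translation invariance of the `L²` norm in `y`. -/
theorem l2_corr_le {A B : ℝ → ℝ≥0∞} (hA : Measurable A) (hB : Measurable B) :
    l2 volume (fun y => ∫⁻ x, A (x + y) * B x) ≤ l2 volume A * ∫⁻ x, B x := by
  refine (l2_lintegral_le volume volume (F := fun x y => A (x + y) * B x) ?_).trans ?_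
  · exact (hA.comp (by fun_prop)).mul (hB.comp measurable_fst)
  · rw [← lintegral_const_mul _ hB]
    refine lintegral_mono fun x => ?_
    simp only [mul_comm _ (B x)]
    rw [l2_const_mul _ _ (by fun_prop),
      l2_comp_measurePreserving (measurePreserving_add_left volume x) hA]

/-- The substitution `x ↦ x - y` moves the shift to the other factor, and Young's inequality applies
with the roles exchanged. -/
theorem l2_corr_le' {A B : ℝ → ℝ≥0∞} (hA : Measurable A) (hB : Measurable B) :
    l2 volume (fun y => ∫⁻ x, A (x + y) * B x) ≤ (∫⁻ x, A x) * l2 volume B := by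
  have h : ∀ y, ∫⁻ x, A (x + y) * B x = ∫⁻ x, A x * B (x - y) := fun y => by
    rw [← (measurePreserving_add_right volume y).lintegral_comp (f := fun x => A x * B (x - y))
      (by fun_prop)]
    simp
  simp only [h]
  refine (l2_lintegral_le volume volume (F := fun x y => A x * B (x - y)) ?_).trans ?_
  · exact (hA.comp measurable_fst).mul (hB.comp (by fun_prop))
  · rw [← lintegral_mul_const _ hA]
    refine lintegral_mono fun x => ?_
    simp only
    rw [l2_const_mul _ _ (by fun_prop),
      l2_comp_measurePreserving (Measure.measurePreserving_sub_left volume x) hB]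

/-- The source of time decay: dilation by `t` in one dimension scales the `L²` norm by `t^(-1/2)`.
-/
theorem l2_comp_mul_left {t : ℝ} (ht : 0 < t) {H : ℝ → ℝ≥0∞} (hH : Measurable H) :
    l2 volume (fun k => H (t * k)) = ENNReal.ofReal (t ^ (-(1 / 2) : ℝ)) * l2 volume H := by
  unfold l2
  have h1 : ∫⁻ k, H (t * k) ^ 2 = ENNReal.ofReal t⁻¹ * ∫⁻ k, H k ^ 2 := by
    have := Real.map_volume_mul_left ht.ne'
    have h2 := lintegral_map (μ := volume) (hH.pow_const 2) (measurable_const_mul t)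
    rw [this, lintegral_smul_measure, abs_of_pos (inv_pos.2 ht)] at h2
    exact h2.symm
  rw [h1, ENNReal.mul_rpow_of_nonneg _ _ (by norm_num),
    ENNReal.ofReal_rpow_of_pos (inv_pos.2 ht), Real.rpow_neg ht.le, Real.inv_rpow ht.le]

/-- The correlation of `F` and `G` along the line of direction `(1, t)`. -/
def lineCorr (F G : ℝ × ℝ → ℝ≥0∞) (t k : ℝ) : ℝ≥0∞ := ∫⁻ q : ℝ × ℝ, F (q + (k, t * k)) * G q

theorem measurable_lineCorr {α : Type*} [MeasurableSpace α] {F G : α → ℝ × ℝ → ℝ≥0∞}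
    (hF : Measurable (Function.uncurry F)) (hG : Measurable (Function.uncurry G))
    {t k : α → ℝ} (ht : Measurable t) (hk : Measurable k) :
    Measurable fun a => lineCorr (F a) (G a) (t a) (k a) := by
  unfold lineCorr
  apply Measurable.lintegral_prod_right' (f := fun x : α × ℝ × ℝ =>
    F x.1 (x.2 + (k x.1, t x.1 * k x.1)) * G x.1 x.2)
  exact (hF.comp (by fun_prop : Measurable fun x : α × ℝ × ℝ =>
    (x.1, x.2 + (k x.1, t x.1 * k x.1)))).mul hG

variable {F G : ℝ × ℝ → ℝ≥0∞}

theorem l2_fst_eq (hF : Measurable F) :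
    l2 volume (fun x => l2 volume fun y => F (x, y)) = l2 volume F := by
  rw [l2]
  simp only [l2_sq]
  rw [l2, Measure.volume_eq_prod, lintegral_prod _ (hF.pow_const 2).aemeasurable]

theorem l2_snd_eq (hF : Measurable F) :
    l2 volume (fun y => l2 volume fun x => F (x, y)) = l2 volume F := by
  rw [l2]
  simp only [l2_sq]
  rw [l2, Measure.volume_eq_prod, lintegral_prod_symm _ (hF.pow_const 2).aemeasurable]

theorem measurable_l2_fst (hF : Measurable F) : Measurable fun x => l2 volume fun y => F (x, y) :=
  measurable_l2 (F := fun x y => F (x, y)) hF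

theorem measurable_l2_snd (hF : Measurable F) : Measurable fun y => l2 volume fun x => F (x, y) :=
  measurable_l2 (F := fun y x => F (x, y)) (hF.comp measurable_swap)

theorem lintegral_l2_fst_le (hF : Measurable F) :
    ∫⁻ x, l2 volume (fun y => F (x, y)) ≤ sobConst * l2 volume (fun p => (1 + rad p) * F p) := by
  refine (lintegral_le_sobConst (measurable_l2_fst hF)).trans ?_
  gcongr
  rw [← l2_fst_eq (F := fun p => (1 + rad p) * F p) ((measurable_rad.const_add 1).mul hF)]
  refine l2_mono fun x => ?_
  rw [← l2_const_mul _ _ (by fun_prop)]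
  refine l2_mono fun y => ?_
  gcongr
  unfold rad
  gcongr
  exact le_max_left _ _

theorem lintegral_l2_snd_le (hF : Measurable F) :
    ∫⁻ y, l2 volume (fun x => F (x, y)) ≤ sobConst * l2 volume (fun p => (1 + rad p) * F p) := by
  refine (lintegral_le_sobConst (measurable_l2_snd hF)).trans ?_
  gcongr
  rw [← l2_snd_eq (F := fun p => (1 + rad p) * F p) ((measurable_rad.const_add 1).mul hF)]
  refine l2_mono fun x => ?_
  rw [← l2_const_mul _ _ (by fun_prop)]
  refine l2_mono fun y => ?_
  gcongr
  unfold rad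
  gcongr
  exact le_max_right _ _

/-- Cauchy–Schwarz in the second coordinate only: translation invariance removes the shift by `t *
k`, and a correlation independent of `t` remains. This serves for small times. -/
theorem lineCorr_le_fst (hF : Measurable F) (hG : Measurable G) (t k : ℝ) :
    lineCorr F G t k ≤
      ∫⁻ x, l2 volume (fun y => F (x + k, y)) * l2 volume (fun y => G (x, y)) := by
  unfold lineCorr
  rw [Measure.volume_eq_prod, lintegral_prod _ (by fun_prop)]
  refine lintegral_mono fun x => ?_
  refine (lintegral_mul_le_l2 volume (by fun_prop) (by fun_prop)).trans ?_
  gcongr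
  exact (l2_comp_measurePreserving (measurePreserving_add_right volume (t * k))
    (F := fun y => F (x + k, y)) (by fun_prop)).le

/-- Cauchy–Schwarz in the first coordinate instead: the shift by `k` disappears, and what remains
depends on `k` only through `t * k`. This serves for large times. -/
theorem lineCorr_le_snd (hF : Measurable F) (hG : Measurable G) (t k : ℝ) :
    lineCorr F G t k ≤
      ∫⁻ y, l2 volume (fun x => F (x, y + t * k)) * l2 volume (fun x => G (x, y)) := by
  unfold lineCorr
  rw [Measure.volume_eq_prod, lintegral_prod_symm _ (by fun_prop)]
  refine lintegral_mono fun x => ?_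
  refine (lintegral_mul_le_l2 volume (by fun_prop) (by fun_prop)).trans ?_
  gcongr
  exact (l2_comp_measurePreserving (measurePreserving_add_right volume k)
    (F := fun y => F (y, x + t * k)) (by fun_prop)).le

theorem l2_lineCorr_le (hF : Measurable F) (hG : Measurable G) (t : ℝ) :
    l2 volume (lineCorr F G t) ≤
      sobConst * (l2 volume F * l2 volume (fun p => (1 + rad p) * G p)) := by
  refine (l2_mono fun k => lineCorr_le_fst hF hG t k).trans ?_
  refine (l2_corr_le (measurable_l2_fst hF) (measurable_l2_fst hG)).trans ?_
  rw [l2_fst_eq hF, mul_left_comm]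
  gcongr
  exact lintegral_l2_fst_le hG

/-- The bound of `lineCorr_le_snd` is a function of `t * k`, so the dilation yields the decay. The
Sobolev weight is put on the second factor here and on the first in `l2_lineCorr_le_rpow'`; both are
needed, since a factor that already carries a derivative must not receive the weight as well. -/
theorem l2_lineCorr_le_rpow (hF : Measurable F) (hG : Measurable G) {t : ℝ} (ht : 0 < t) :
    l2 volume (lineCorr F G t) ≤ ENNReal.ofReal (t ^ (-(1 / 2) : ℝ)) *
      (sobConst * (l2 volume F * l2 volume (fun p => (1 + rad p) * G p))) := by
  have hm : Measurable fun z => ∫⁻ y, l2 volume (fun x => F (x, y + z)) *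
      l2 volume (fun x => G (x, y)) := by
    apply Measurable.lintegral_prod_right' (f := fun x : ℝ × ℝ =>
      l2 volume (fun u => F (u, x.2 + x.1)) * l2 volume (fun u => G (u, x.2)))
    exact ((measurable_l2_snd hF).comp (by fun_prop)).mul
      ((measurable_l2_snd hG).comp measurable_snd)
  refine (l2_mono fun k => lineCorr_le_snd hF hG t k).trans ?_
  rw [l2_comp_mul_left ht (H := fun z => ∫⁻ y, l2 volume (fun x => F (x, y + z)) *
      l2 volume (fun x => G (x, y))) hm]
  gcongr
  refine (l2_corr_le (measurable_l2_snd hF) (measurable_l2_snd hG)).trans ?_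
  rw [l2_snd_eq hF, mul_left_comm]
  gcongr
  exact lintegral_l2_snd_le hG

theorem l2_lineCorr_le_rpow' (hF : Measurable F) (hG : Measurable G) {t : ℝ} (ht : 0 < t) :
    l2 volume (lineCorr F G t) ≤ ENNReal.ofReal (t ^ (-(1 / 2) : ℝ)) *
      (sobConst * (l2 volume (fun p => (1 + rad p) * F p) * l2 volume G)) := by
  have hm : Measurable fun z => ∫⁻ y, l2 volume (fun x => F (x, y + z)) *
      l2 volume (fun x => G (x, y)) := by
    apply Measurable.lintegral_prod_right' (f := fun x : ℝ × ℝ =>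
      l2 volume (fun u => F (u, x.2 + x.1)) * l2 volume (fun u => G (u, x.2)))
    exact ((measurable_l2_snd hF).comp (by fun_prop)).mul
      ((measurable_l2_snd hG).comp measurable_snd)
  refine (l2_mono fun k => lineCorr_le_snd hF hG t k).trans ?_
  rw [l2_comp_mul_left ht (H := fun z => ∫⁻ y, l2 volume (fun x => F (x, y + z)) *
      l2 volume (fun x => G (x, y))) hm]
  gcongr
  refine (l2_corr_le' (measurable_l2_snd hF) (measurable_l2_snd hG)).trans ?_
  rw [l2_snd_eq hG, ← mul_assoc]
  gcongr
  exact lintegral_l2_snd_le hF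

/-! ### The trilinear estimate -/

/-- The Fourier multiplier of `∂_x (1 - ∂_x²)⁻¹`. -/
def fieldMult (k : ℝ) : ℂ := 2 * Real.pi * Complex.I * k / (1 + (2 * Real.pi * k) ^ 2)

theorem enorm_fieldMult (k : ℝ) :
    ‖fieldMult k‖ₑ = ENNReal.ofReal (2 * Real.pi * |k| / (1 + (2 * Real.pi * |k|) ^ 2)) := by
  rw [← ofReal_norm, fieldMult, norm_div]
  congr 2
  · simp [abs_of_pos Real.pi_pos]
  · rw [mul_pow _ |k|, sq_abs, ← mul_pow]
    rw [show (1 + (2 * (Real.pi : ℂ) * k) ^ 2) = ((1 + (2 * Real.pi * k) ^ 2 : ℝ) : ℂ) by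
      push_cast; ring, Complex.norm_real, Real.norm_of_nonneg (by positivity)]

theorem measurable_fieldMult : Measurable fieldMult := by
  unfold fieldMult
  fun_prop

/-- The constant of the trilinear estimate. -/
def triConst : ℝ≥0∞ := 16 * sobConst ^ 2

theorem triConst_lt_top : triConst < ⊤ :=
  ENNReal.mul_lt_top (by simp) (ENNReal.pow_lt_top sobConst_lt_top)

variable {F G : ℝ × ℝ → ℝ≥0∞}

theorem lintegral_inv_mul_le {L : ℝ → ℝ≥0∞} (hL : Measurable L) :
    ∫⁻ k, (1 + ENNReal.ofReal (2 * Real.pi * |k|))⁻¹ * L k ≤ sobConst * l2 volume L :=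
  lintegral_mul_le_l2 volume (by fun_prop) hL

theorem ofReal_le_mul_inv {a y c : ℝ} (hy : 0 ≤ y) (hc : 0 ≤ c) (h : a * (1 + y) ≤ c) :
    ENNReal.ofReal a ≤ ENNReal.ofReal c * (1 + ENNReal.ofReal y)⁻¹ := by
  rw [← ENNReal.ofReal_one, ← ENNReal.ofReal_add zero_le_one hy,
    ← ENNReal.ofReal_inv_of_pos (by positivity), ← ENNReal.ofReal_mul hc]
  apply ENNReal.ofReal_le_ofReal
  rw [← div_eq_mul_inv, le_div_iff₀ (by positivity)]
  exact h

theorem rad_line_le (t k : ℝ) (q : ℝ × ℝ) : rad (k, t * k) ≤ rad (q + (k, t * k)) + rad q := by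
  have := rad_sub_le (q + (k, t * k)) q
  rwa [add_sub_cancel_left] at this

/-- The frequency `(k, t * k)` is the difference of the frequencies of the two factors, so by the
triangle inequality a derivative of the density falls on one of them. -/
theorem rad_mul_lineCorr_le (hF : Measurable F) (hG : Measurable G) (t k : ℝ) :
    rad (k, t * k) * lineCorr F G t k ≤
      lineCorr (fun p => rad p * F p) G t k + lineCorr F (fun p => rad p * G p) t k := by
  have hr := measurable_rad
  unfold lineCorr
  rw [← lintegral_const_mul _ (by fun_prop), ← lintegral_add_left (by fun_prop)]
  refine lintegral_mono fun q => ?_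
  calc _ ≤ (rad (q + (k, t * k)) + rad q) * (F (q + (k, t * k)) * G q) := by
        gcongr; exact rad_line_le t k q
    _ = _ := by ring

theorem l2_rad_mul_le (F : ℝ × ℝ → ℝ≥0∞) :
    l2 volume (fun p => rad p * F p) ≤ l2 volume (fun p => (1 + rad p) * F p) := by
  refine l2_mono fun p => ?_
  gcongr
  exact le_add_self

theorem l2_le_one_add_rad_mul (F : ℝ × ℝ → ℝ≥0∞) :
    l2 volume F ≤ l2 volume (fun p => (1 + rad p) * F p) := by
  refine l2_mono fun p => ?_
  exact le_mul_of_one_le_left (by positivity) le_self_add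

/-- The factor `1 + t` on the left is what `∂_v - t ∂_x` will cost. For `t ≥ 1` it is paid by `t |k|
≤ |(k, t k)|`, a derivative distributed over `F` and `G`; the rest of the multiplier still decays
like `1 / (1 + |k|)`, which allows Cauchy–Schwarz in `k`, and the `L²` norm of the correlation
decays like `t^(-1/2)`. -/
theorem lintegral_fieldMult_le (hF : Measurable F) (hG : Measurable G) {t : ℝ} (ht : 0 ≤ t) :
    ENNReal.ofReal (1 + t) * ∫⁻ k, ‖fieldMult k‖ₑ * lineCorr F G t k ≤
      triConst * ENNReal.ofReal ((1 + t) ^ (-(1 / 2) : ℝ)) *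
        (l2 volume (fun p => (1 + rad p) * F p) * l2 volume (fun p => (1 + rad p) * G p)) := by
  have hmL : ∀ {F G : ℝ × ℝ → ℝ≥0∞}, Measurable F → Measurable G → Measurable (lineCorr F G t) :=
    fun {F G} hF hG => measurable_lineCorr (α := ℝ) (F := fun _ => F) (G := fun _ => G)
      (t := fun _ => t) (k := fun k => k) (hF.comp measurable_snd) (hG.comp measurable_snd)
      measurable_const measurable_id
  have hL := hmL hF hG
  have hpi := Real.pi_pos
  have hm := measurable_fieldMult
  rw [← lintegral_const_mul _ (f := fun k => ‖fieldMult k‖ₑ * lineCorr F G t k) (by fun_prop)]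
  set A := l2 volume (fun p => (1 + rad p) * F p)
  set B := l2 volume (fun p => (1 + rad p) * G p)
  have h1t : (0 : ℝ) < 1 + t := by linarith
  -- For `t ≤ 1` no decay is needed: `(1 + t)^(-1/2) ≥ 1/2`, and the field multiplier itself is
  -- bounded by a multiple of `1 / (1 + 2π|k|)`.
  rcases le_total t 1 with h | h
  · have h2 : ∀ k, ENNReal.ofReal (1 + t) * (‖fieldMult k‖ₑ * lineCorr F G t k) ≤
        (16 * ENNReal.ofReal ((1 + t) ^ (-(1 / 2) : ℝ))) *
          ((1 + ENNReal.ofReal (2 * Real.pi * |k|))⁻¹ * lineCorr F G t k) := fun k => by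
      rw [enorm_fieldMult, ← mul_assoc, ← mul_assoc]
      refine mul_le_mul_left ?_ _
      rw [← ENNReal.ofReal_mul h1t.le, show (16 : ℝ≥0∞) = ENNReal.ofReal 16 by simp,
        ← ENNReal.ofReal_mul (by norm_num)]
      apply ofReal_le_mul_inv (by positivity) (by positivity)
      set y := 2 * Real.pi * |k| with hy
      have hy0 : 0 ≤ y := by positivity
      have h3 : (1 : ℝ) / 2 ≤ (1 + t) ^ (-(1 / 2) : ℝ) := by
        have h3 : (1 + t) ^ (1 / 2 : ℝ) ≤ 2 := by
          rw [← Real.sqrt_eq_rpow]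
          exact Real.sqrt_le_iff.2 ⟨by norm_num, by linarith⟩
        rw [Real.rpow_neg h1t.le]
        exact (inv_eq_one_div (2 : ℝ)).symm.le.trans (inv_anti₀ (by positivity) h3)
      have h4 : y / (1 + y ^ 2) * (1 + y) ≤ 2 := by
        rw [div_mul_eq_mul_div, div_le_iff₀ (by positivity)]
        nlinarith [sq_nonneg (y - 1)]
      have h5 : 0 ≤ y / (1 + y ^ 2) * (1 + y) := by positivity
      calc (1 + t) * (y / (1 + y ^ 2)) * (1 + y) = (1 + t) * (y / (1 + y ^ 2) * (1 + y)) := by ring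
        _ ≤ 2 * 2 := by gcongr; linarith
        _ ≤ _ := by linarith
    refine (lintegral_mono h2).trans ?_
    rw [lintegral_const_mul _ (by fun_prop)]
    calc _ ≤ (16 * ENNReal.ofReal ((1 + t) ^ (-(1 / 2) : ℝ))) *
          (sobConst * (sobConst * (A * B))) := by
          gcongr
          refine (lintegral_inv_mul_le hL).trans ?_
          gcongr
          refine (l2_lineCorr_le hF hG t).trans ?_
          gcongr
          exact l2_le_one_add_rad_mul F
      _ = _ := by rw [triConst]; ring
  · have ht0 : 0 < t := by linarith
    set L1 := lineCorr (fun p => rad p * F p) G t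
    set L2 := lineCorr F (fun p => rad p * G p) t
    have hL1 : Measurable L1 := hmL (measurable_rad.mul hF) hG
    have hL2 : Measurable L2 := hmL hF (measurable_rad.mul hG)
    -- With `y = 2π|k|`: `1 + t ≤ 2 t` and `y (1 + y) / (1 + y²) ≤ 2 y`, so `1 + t` times the
    -- multiplier is at most `4 t y / (1 + y)`, and `t y` is at most the length of `(k, t k)`.
    have h2 : ∀ k, ENNReal.ofReal (1 + t) * (‖fieldMult k‖ₑ * lineCorr F G t k) ≤
        4 * ((1 + ENNReal.ofReal (2 * Real.pi * |k|))⁻¹ * (L1 k + L2 k)) := fun k => by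
      calc ENNReal.ofReal (1 + t) * (‖fieldMult k‖ₑ * lineCorr F G t k)
          ≤ (4 * (1 + ENNReal.ofReal (2 * Real.pi * |k|))⁻¹ * rad (k, t * k)) *
            lineCorr F G t k := by
            rw [enorm_fieldMult, ← mul_assoc]
            refine mul_le_mul_left ?_ _
            set y := 2 * Real.pi * |k| with hy
            have hy0 : 0 ≤ y := by positivity
            have h3 : ENNReal.ofReal (t * y) ≤ rad (k, t * k) := by
              unfold rad
              apply ENNReal.ofReal_le_ofReal
              have : |t * k| ≤ ‖(k, t * k)‖ := le_max_right _ _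
              rw [abs_mul, abs_of_pos ht0] at this
              calc t * y = 2 * Real.pi * (t * |k|) := by rw [hy]; ring
                _ ≤ _ := by gcongr
            calc ENNReal.ofReal (1 + t) * ENNReal.ofReal (y / (1 + y ^ 2))
                ≤ ENNReal.ofReal (4 * (t * y)) * (1 + ENNReal.ofReal y)⁻¹ := by
                  rw [← ENNReal.ofReal_mul h1t.le]
                  apply ofReal_le_mul_inv hy0 (by positivity)
                  have h4 : y / (1 + y ^ 2) * (1 + y) ≤ 2 * y := by
                    rw [div_mul_eq_mul_div, div_le_iff₀ (by positivity)]
                    nlinarith [mul_nonneg hy0 (sq_nonneg (y - 1)), mul_nonneg hy0 (sq_nonneg y)]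
                  calc (1 + t) * (y / (1 + y ^ 2)) * (1 + y)
                      = (1 + t) * (y / (1 + y ^ 2) * (1 + y)) := by ring
                    _ ≤ (2 * t) * (2 * y) := by gcongr; linarith
                    _ = _ := by ring
              _ = 4 * (1 + ENNReal.ofReal y)⁻¹ * ENNReal.ofReal (t * y) := by
                  rw [ENNReal.ofReal_mul (by norm_num)]; simp; ring
              _ ≤ _ := by gcongr
        _ = 4 * ((1 + ENNReal.ofReal (2 * Real.pi * |k|))⁻¹ *
            (rad (k, t * k) * lineCorr F G t k)) := by ring
        _ ≤ _ := by
            gcongr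
            exact rad_mul_lineCorr_le hF hG t k
    refine (lintegral_mono h2).trans ?_
    rw [lintegral_const_mul _ (by fun_prop)]
    have h6 : ENNReal.ofReal (t ^ (-(1 / 2) : ℝ)) ≤
        2 * ENNReal.ofReal ((1 + t) ^ (-(1 / 2) : ℝ)) := by
      rw [show (2 : ℝ≥0∞) = ENNReal.ofReal 2 by simp, ← ENNReal.ofReal_mul (by norm_num)]
      apply ENNReal.ofReal_le_ofReal
      rw [Real.rpow_neg ht0.le, Real.rpow_neg h1t.le, ← Real.sqrt_eq_rpow, ← Real.sqrt_eq_rpow,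
        ← div_eq_mul_inv, inv_eq_one_div, div_le_div_iff₀ (by positivity) (by positivity), one_mul]
      have : √(1 + t) ≤ √(2 ^ 2 * t) := Real.sqrt_le_sqrt (by linarith)
      rwa [Real.sqrt_mul (by norm_num), Real.sqrt_sq (by norm_num)] at this
    have h7 : l2 volume L1 ≤ 2 * ENNReal.ofReal ((1 + t) ^ (-(1 / 2) : ℝ)) *
        (sobConst * (A * B)) := by
      refine (l2_lineCorr_le_rpow (measurable_rad.mul hF) hG ht0).trans ?_
      gcongr
      exact l2_rad_mul_le F
    have h8 : l2 volume L2 ≤ 2 * ENNReal.ofReal ((1 + t) ^ (-(1 / 2) : ℝ)) *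
        (sobConst * (A * B)) := by
      refine (l2_lineCorr_le_rpow' hF (measurable_rad.mul hG) ht0).trans ?_
      gcongr
      exact l2_rad_mul_le G
    calc _ ≤ 4 * (sobConst * (l2 volume L1 + l2 volume L2)) := by
          gcongr
          refine (lintegral_inv_mul_le (hL1.add hL2)).trans ?_
          gcongr
          exact l2_add_le _ hL1 hL2
      _ ≤ 4 * (sobConst * (2 * ENNReal.ofReal ((1 + t) ^ (-(1 / 2) : ℝ)) * (sobConst * (A * B)) +
          2 * ENNReal.ofReal ((1 + t) ^ (-(1 / 2) : ℝ)) * (sobConst * (A * B)))) := by gcongr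
      _ = _ := by rw [triConst]; ring

/-- The symbol of `∂_v - t ∂_x` applied to `F`, in absolute value. -/
def linMaj (t : ℝ) (F : ℝ × ℝ → ℝ≥0∞) (q : ℝ × ℝ) : ℝ≥0∞ :=
  ENNReal.ofReal (2 * Real.pi * |q.2 - t * q.1|) * F q

/-- The positive majorant of the nonlinearity. -/
def nlMaj (t : ℝ) (F : ℝ × ℝ → ℝ≥0∞) (p : ℝ × ℝ) : ℝ≥0∞ :=
  ∫⁻ k, ‖fieldMult k‖ₑ * lineCorr F F t k * linMaj t F (p - (k, t * k))

/-- The weighted norm `‖r^n (1 + r) F‖`. -/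
def en (F : ℝ × ℝ → ℝ≥0∞) (n : ℕ) : ℝ≥0∞ := l2 volume fun p => rad p ^ n * ((1 + rad p) * F p)

/-- The weighted norm `‖r^n F‖`. -/
def sn (F : ℝ × ℝ → ℝ≥0∞) (n : ℕ) : ℝ≥0∞ := l2 volume fun p => rad p ^ n * F p

theorem en_le (hF : Measurable F) (n : ℕ) : en F n ≤ sn F n + sn F (n + 1) := by
  have hr := measurable_rad
  refine le_trans (le_of_eq ?_) (l2_add_le volume (by fun_prop) (by fun_prop))
  unfold en
  congr 1
  ext p
  ring

theorem sn_le_en (F : ℝ × ℝ → ℝ≥0∞) (n : ℕ) : sn F n ≤ en F n := by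
  refine l2_mono fun p => ?_
  gcongr
  exact le_mul_of_one_le_left (by positivity) le_self_add

theorem sn_succ_le_en (F : ℝ × ℝ → ℝ≥0∞) (n : ℕ) : sn F (n + 1) ≤ en F n := by
  refine l2_mono fun p => ?_
  rw [pow_succ, mul_assoc]
  gcongr
  exact le_add_self

/-- From `|η - t ξ| ≤ (1 + t) ‖(ξ, η)‖`: one derivative and a factor `1 + t` are lost. -/
theorem sn_linMaj_le (hF : Measurable F) {t : ℝ} (ht : 0 ≤ t) (n : ℕ) :
    sn (linMaj t F) n ≤ ENNReal.ofReal (1 + t) * sn F (n + 1) := by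
  have hr := measurable_rad
  unfold sn
  rw [← l2_const_mul _ _ (by fun_prop)]
  refine l2_mono fun p => ?_
  have : ENNReal.ofReal (2 * Real.pi * |p.2 - t * p.1|) ≤ ENNReal.ofReal (1 + t) * rad p := by
    unfold rad
    rw [← ENNReal.ofReal_mul (by linarith)]
    apply ENNReal.ofReal_le_ofReal
    have h1 : |p.2 - t * p.1| ≤ (1 + t) * ‖p‖ := by
      have h2 : |p.1| ≤ ‖p‖ := le_max_left _ _
      have h3 : |p.2| ≤ ‖p‖ := le_max_right _ _
      calc |p.2 - t * p.1| ≤ |p.2| + |t * p.1| := abs_sub _ _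
        _ = |p.2| + t * |p.1| := by rw [abs_mul, abs_of_nonneg ht]
        _ ≤ ‖p‖ + t * ‖p‖ := by gcongr
        _ = _ := by ring
    calc _ ≤ 2 * Real.pi * ((1 + t) * ‖p‖) := by gcongr
      _ = _ := by ring
  unfold linMaj
  calc _ ≤ rad p ^ n * (ENNReal.ofReal (1 + t) * rad p * F p) := by gcongr
    _ = _ := by ring

theorem rad_add_pow_le (p q : ℝ × ℝ) (n : ℕ) : rad (p + q) ^ n ≤
    ∑ ij ∈ Finset.HasAntidiagonal.antidiagonal n,
      (n.choose ij.1 : ℝ≥0∞) * (rad p ^ ij.1 * rad q ^ ij.2) := by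
  refine (pow_le_pow_left' (rad_add_le p q) n).trans (le_of_eq ?_)
  rw [(Commute.all (rad p) (rad q)).add_pow']
  simp [nsmul_eq_mul]

/-- Binomial expansion of the length of `(q + (k, t k)) + (-q)`: the Leibniz rule for the
derivatives of the density, in absolute values. -/
theorem rad_pow_mul_lineCorr_le (hF : Measurable F) (hG : Measurable G) (t k : ℝ) (n : ℕ) :
    rad (k, t * k) ^ n * lineCorr F G t k ≤ ∑ ij ∈ Finset.HasAntidiagonal.antidiagonal n,
      (n.choose ij.1 : ℝ≥0∞) *
        lineCorr (fun p => rad p ^ ij.1 * F p) (fun p => rad p ^ ij.2 * G p) t k := by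
  have hr := measurable_rad
  unfold lineCorr
  simp only [← fun i j => lintegral_const_mul (μ := volume) (n.choose i : ℝ≥0∞)
    (f := fun q : ℝ × ℝ => rad (q + (k, t * k)) ^ i * F (q + (k, t * k)) * (rad q ^ j * G q))
    (by fun_prop)]
  rw [← lintegral_const_mul _ (by fun_prop), ← lintegral_finsetSum _ fun _ _ => by fun_prop]
  refine lintegral_mono fun q => ?_
  have := rad_add_pow_le (q + (k, t * k)) (-q) n
  rw [add_neg_cancel_comm, rad_neg] at this
  calc _ ≤ (∑ ij ∈ Finset.HasAntidiagonal.antidiagonal n,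
      (n.choose ij.1 : ℝ≥0∞) * (rad (q + (k, t * k)) ^ ij.1 * rad q ^ ij.2)) *
        (F (q + (k, t * k)) * G q) := by gcongr
    _ = _ := by
      rw [Finset.sum_mul]
      exact Finset.sum_congr rfl fun ij _ => by ring

theorem lintegral_rad_pow_fieldMult_le (hF : Measurable F) {t : ℝ} (ht : 0 ≤ t) (n : ℕ) :
    ENNReal.ofReal (1 + t) * ∫⁻ k, ‖fieldMult k‖ₑ * (rad (k, t * k) ^ n * lineCorr F F t k) ≤
      triConst * ENNReal.ofReal ((1 + t) ^ (-(1 / 2) : ℝ)) * bconv (en F) (en F) n := by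
  have hr := measurable_rad
  have hm := measurable_fieldMult
  have hmL : ∀ i j, Measurable
      (lineCorr (fun p => rad p ^ i * F p) (fun p => rad p ^ j * F p) t) :=
    fun i j => measurable_lineCorr (α := ℝ) (F := fun _ p => rad p ^ i * F p)
      (G := fun _ p => rad p ^ j * F p) (t := fun _ => t) (k := fun k => k)
      (by unfold Function.uncurry; fun_prop) (by unfold Function.uncurry; fun_prop)
      measurable_const measurable_id
  calc _ ≤ ENNReal.ofReal (1 + t) * ∫⁻ k, ∑ ij ∈ Finset.HasAntidiagonal.antidiagonal n,
      (n.choose ij.1 : ℝ≥0∞) * (‖fieldMult k‖ₑ *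
        lineCorr (fun p => rad p ^ ij.1 * F p) (fun p => rad p ^ ij.2 * F p) t k) := by
        gcongr with k
        refine (mul_le_mul_right (rad_pow_mul_lineCorr_le hF hF t k n) _).trans (le_of_eq ?_)
        rw [Finset.mul_sum]
        exact Finset.sum_congr rfl fun ij _ => by ring
    _ = ∑ ij ∈ Finset.HasAntidiagonal.antidiagonal n, (n.choose ij.1 : ℝ≥0∞) *
        (ENNReal.ofReal (1 + t) * ∫⁻ k, ‖fieldMult k‖ₑ *
        lineCorr (fun p => rad p ^ ij.1 * F p) (fun p => rad p ^ ij.2 * F p) t k) := by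
        rw [lintegral_finsetSum _ fun ij _ => by have := hmL ij.1 ij.2; fun_prop, Finset.mul_sum]
        refine Finset.sum_congr rfl fun ij _ => ?_
        have := hmL ij.1 ij.2
        rw [lintegral_const_mul _ (by fun_prop)]
        ring
    _ ≤ ∑ ij ∈ Finset.HasAntidiagonal.antidiagonal n, (n.choose ij.1 : ℝ≥0∞) *
        (triConst * ENNReal.ofReal ((1 + t) ^ (-(1 / 2) : ℝ)) * (en F ij.1 * en F ij.2)) := by
        refine Finset.sum_le_sum fun ij _ => mul_le_mul_right ?_ _
        refine (lintegral_fieldMult_le (F := fun p => rad p ^ ij.1 * F p)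
          (G := fun p => rad p ^ ij.2 * F p) (by fun_prop) (by fun_prop) ht).trans (le_of_eq ?_)
        unfold en
        simp only [mul_left_comm]
    _ = _ := by
        rw [bconv, Finset.mul_sum]
        exact Finset.sum_congr rfl fun ij _ => by ring

theorem measurable_linMaj {α : Type*} [MeasurableSpace α] {F : α → ℝ × ℝ → ℝ≥0∞}
    (hF : Measurable (Function.uncurry F)) {t : α → ℝ} {q : α → ℝ × ℝ} (ht : Measurable t)
    (hq : Measurable q) : Measurable fun a => linMaj (t a) (F a) (q a) := by
  unfold linMaj
  exact Measurable.mul (by fun_prop) (hF.comp (measurable_id.prodMk hq))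

/-- The frequency is split as `(k, t k) + (p - (k, t k))` and expanded binomially. Minkowski in `k`
takes the `L²` norm of the linear factor, which does not see the translation, and leaves an `L¹`
norm of the field. The factor `1 + t` lost by `sn_linMaj_le` is handed over to
`lintegral_rad_pow_fieldMult_le`. -/
theorem sn_nlMaj_le (hF : Measurable F) {t : ℝ} (ht : 0 ≤ t) (n : ℕ) :
    sn (nlMaj t F) n ≤ triConst * ENNReal.ofReal ((1 + t) ^ (-(1 / 2) : ℝ)) *
      bconv (bconv (en F) (en F)) (shift (sn F)) n := by
  have hr := measurable_rad
  have hm := measurable_fieldMult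
  have hL : Measurable (lineCorr F F t) := measurable_lineCorr (α := ℝ) (F := fun _ => F)
    (G := fun _ => F) (t := fun _ => t) (k := fun k => k) (hF.comp measurable_snd)
    (hF.comp measurable_snd) measurable_const measurable_id
  have hlin : Measurable (linMaj t F) := measurable_linMaj (F := fun _ => F)
    (hF.comp measurable_snd) measurable_const measurable_id
  have hlin2 : ∀ k : ℝ, Measurable fun p : ℝ × ℝ => linMaj t F (p - (k, t * k)) := fun k =>
    hlin.comp (by fun_prop)
  have h1 : ∀ k p, rad p ^ n * (‖fieldMult k‖ₑ * lineCorr F F t k * linMaj t F (p - (k, t * k))) ≤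
      ∑ ij ∈ Finset.HasAntidiagonal.antidiagonal n, (n.choose ij.1 : ℝ≥0∞) *
        ((‖fieldMult k‖ₑ * (rad (k, t * k) ^ ij.1 * lineCorr F F t k)) *
        (rad (p - (k, t * k)) ^ ij.2 * linMaj t F (p - (k, t * k)))) := fun k p => by
    have := rad_add_pow_le (k, t * k) (p - (k, t * k)) n
    rw [add_sub_cancel] at this
    refine (mul_le_mul_left this _).trans (le_of_eq ?_)
    rw [Finset.sum_mul]
    exact Finset.sum_congr rfl fun ij _ => by ring
  have hpm : ∀ p, Measurable fun k : ℝ =>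
      ‖fieldMult k‖ₑ * lineCorr F F t k * linMaj t F (p - (k, t * k)) := fun p =>
    Measurable.mul (by fun_prop) (hlin.comp (by fun_prop))
  have hterm : ∀ k (ij : ℕ × ℕ), Measurable fun p : ℝ × ℝ => (n.choose ij.1 : ℝ≥0∞) *
      ((‖fieldMult k‖ₑ * (rad (k, t * k) ^ ij.1 * lineCorr F F t k)) *
        (rad (p - (k, t * k)) ^ ij.2 * linMaj t F (p - (k, t * k)))) := fun k ij => by
    have := hlin2 k
    fun_prop
  calc sn (nlMaj t F) n
      = l2 volume (fun p => ∫⁻ k, rad p ^ n *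
        (‖fieldMult k‖ₑ * lineCorr F F t k * linMaj t F (p - (k, t * k)))) := by
        unfold sn nlMaj
        congr 1
        ext p
        rw [lintegral_const_mul _ (hpm p)]
    _ ≤ ∫⁻ k, l2 volume (fun p => rad p ^ n *
        (‖fieldMult k‖ₑ * lineCorr F F t k * linMaj t F (p - (k, t * k)))) := by
        refine l2_lintegral_le _ _ (F := fun k p => rad p ^ n *
          (‖fieldMult k‖ₑ * lineCorr F F t k * linMaj t F (p - (k, t * k)))) ?_
        unfold Function.uncurry
        exact Measurable.mul (by fun_prop) (Measurable.mul (by fun_prop) (hlin.comp (by fun_prop)))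
    _ ≤ ∫⁻ k, ∑ ij ∈ Finset.HasAntidiagonal.antidiagonal n, (n.choose ij.1 : ℝ≥0∞) *
        ((‖fieldMult k‖ₑ * (rad (k, t * k) ^ ij.1 * lineCorr F F t k)) *
        sn (linMaj t F) ij.2) := by
        refine lintegral_mono fun k => ?_
        refine (l2_mono (h1 k)).trans ((l2_sum_le _ _ (hterm k)).trans ?_)
        refine Finset.sum_le_sum fun ij _ => ?_
        have := hlin2 k
        rw [l2_const_mul _ _ (by fun_prop), l2_const_mul _ _ (by fun_prop)]
        gcongr
        exact (l2_comp_measurePreserving (measurePreserving_sub_right volume (k, t * k))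
          (F := fun p => rad p ^ ij.2 * linMaj t F p) (by fun_prop)).le
    _ = ∑ ij ∈ Finset.HasAntidiagonal.antidiagonal n, (n.choose ij.1 : ℝ≥0∞) *
        ((∫⁻ k, ‖fieldMult k‖ₑ * (rad (k, t * k) ^ ij.1 * lineCorr F F t k)) *
        sn (linMaj t F) ij.2) := by
        rw [lintegral_finsetSum _ fun ij _ => by fun_prop]
        refine Finset.sum_congr rfl fun ij _ => ?_
        rw [lintegral_const_mul _ (by fun_prop), lintegral_mul_const _ (by fun_prop)]
    _ ≤ ∑ ij ∈ Finset.HasAntidiagonal.antidiagonal n, (n.choose ij.1 : ℝ≥0∞) *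
        ((triConst * ENNReal.ofReal ((1 + t) ^ (-(1 / 2) : ℝ)) * bconv (en F) (en F) ij.1) *
        sn F (ij.2 + 1)) := by
        refine Finset.sum_le_sum fun ij _ => mul_le_mul_right ?_ _
        calc _ ≤ (∫⁻ k, ‖fieldMult k‖ₑ * (rad (k, t * k) ^ ij.1 * lineCorr F F t k)) *
              (ENNReal.ofReal (1 + t) * sn F (ij.2 + 1)) := by
              gcongr; exact sn_linMaj_le hF ht ij.2
          _ = (ENNReal.ofReal (1 + t) *
              ∫⁻ k, ‖fieldMult k‖ₑ * (rad (k, t * k) ^ ij.1 * lineCorr F F t k)) *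
              sn F (ij.2 + 1) := by ring
          _ ≤ _ := mul_le_mul_left (lintegral_rad_pow_fieldMult_le hF ht ij.1) _
    _ = _ := by
        conv_rhs => rw [bconv, Finset.mul_sum]
        refine Finset.sum_congr rfl fun ij _ => ?_
        simp only [shift]
        ring

theorem measurable_nlMaj {α : Type*} [MeasurableSpace α] {F : α → ℝ × ℝ → ℝ≥0∞}
    (hF : Measurable (Function.uncurry F)) {t : α → ℝ} {p : α → ℝ × ℝ} (ht : Measurable t)
    (hp : Measurable p) : Measurable fun a => nlMaj (t a) (F a) (p a) := by
  unfold nlMaj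
  have hF' : Measurable (Function.uncurry fun x : α × ℝ => F x.1) :=
    hF.comp (by fun_prop : Measurable fun y : (α × ℝ) × ℝ × ℝ => (y.1.1, y.2))
  have hm := measurable_fieldMult
  apply Measurable.lintegral_prod_right' (f := fun x : α × ℝ =>
    ‖fieldMult x.2‖ₑ * lineCorr (F x.1) (F x.1) (t x.1) x.2 *
      linMaj (t x.1) (F x.1) (p x.1 - (x.2, t x.1 * x.2)))
  refine Measurable.mul (Measurable.mul (by fun_prop) ?_) ?_
  · exact measurable_lineCorr hF' hF' (ht.comp measurable_fst) measurable_snd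
  · exact measurable_linMaj hF' (ht.comp measurable_fst) (by fun_prop)

/-- The analytic trilinear estimate with a loss of one derivative. -/
theorem gen_en_nlMaj_le (hF : Measurable F) {t lam : ℝ} (ht : 0 ≤ t) (hlam : 0 ≤ lam) :
    gen lam (en (nlMaj t F)) ≤ 4 * triConst * ENNReal.ofReal ((1 + t) ^ (-(1 / 2) : ℝ)) *
      (gen lam (shift (en F)) * gen lam (en F) ^ 2) := by
  set X := triConst * ENNReal.ofReal ((1 + t) ^ (-(1 / 2) : ℝ)) with hX
  have hN : Measurable (nlMaj t F) := measurable_nlMaj (F := fun _ => F) (hF.comp measurable_snd)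
    measurable_const measurable_id
  -- The norm `en` at `n` is bounded by `sn` at `n` and at `n + 1`. At `n` the lost derivative stays
  -- on the third factor. At `n + 1` the bound `sn F (j + 1) ≤ en F j` absorbs it, and the extra
  -- order is a shift of the whole triple convolution, spread by the product rule over three terms.
  -- So each of the four resulting terms carries exactly one shift; this is the factor 4.
  have h1 : ∀ n, en (nlMaj t F) n ≤ X * bconv (bconv (en F) (en F)) (shift (en F)) n +
      X * shift (bconv (bconv (en F) (en F)) (en F)) n := fun n => by
    refine (en_le hN n).trans (add_le_add ?_ ?_)
    · refine (sn_nlMaj_le hF ht n).trans ?_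
      gcongr
      exact bconv_mono (fun _ => le_rfl) (fun n => sn_le_en F (n + 1)) n
    · refine (sn_nlMaj_le hF ht (n + 1)).trans ?_
      unfold shift
      gcongr
      exact bconv_mono (fun _ => le_rfl) (fun n => sn_succ_le_en F n) (n + 1)
  have h2 : ∀ n, shift (bconv (bconv (en F) (en F)) (en F)) n =
      (bconv (fun m => bconv (shift (en F)) (en F) m + bconv (en F) (shift (en F)) m) (en F) n +
      bconv (bconv (en F) (en F)) (shift (en F)) n) := fun n => by
    rw [shift_bconv, funext (shift_bconv (en F) (en F))]
  refine (gen_mono h1).trans ?_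
  simp only [h2]
  rw [gen_add, gen_const_mul, gen_const_mul, gen_add, gen_bconv hlam, gen_bconv hlam,
    gen_bconv hlam, gen_add, gen_bconv hlam, gen_bconv hlam]
  rw [mul_assoc 4, ← hX]
  apply le_of_eq
  ring

/-! ### The majorant iteration -/

/-- The shrinking radius of analyticity. -/
def radius (a R t : ℝ) : ℝ := R - a * (√(1 + t) - 1)

/-- The speed at which the radius shrinks. -/
def radiusSpeed (a t : ℝ) : ℝ := a / 2 * (1 + t) ^ (-(1 / 2) : ℝ)

theorem hasDerivAt_radius (a R : ℝ) {t : ℝ} (ht : 0 ≤ t) :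
    HasDerivAt (radius a R) (-radiusSpeed a t) t := by
  have h1 : (0 : ℝ) < 1 + t := by linarith
  have h2 := (((((hasDerivAt_id t).const_add 1).sqrt h1.ne').sub_const 1).const_mul a).const_sub R
  refine h2.congr_deriv ?_
  rw [radiusSpeed, Real.rpow_neg h1.le, ← Real.sqrt_eq_rpow]
  have : √(1 + t) ≠ 0 := by positivity
  simp only [id]
  field_simp

theorem continuous_radius (a R : ℝ) : Continuous (radius a R) := by
  unfold radius
  fun_prop

theorem radiusSpeed_nonneg {a t : ℝ} (ha : 0 ≤ a) (ht : 0 ≤ t) : 0 ≤ radiusSpeed a t := by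
  have h1 : (0 : ℝ) < 1 + t := by linarith
  unfold radiusSpeed
  positivity

theorem radius_antitone {a : ℝ} (ha : 0 ≤ a) (R : ℝ) {s t : ℝ} (hst : s ≤ t) :
    radius a R t ≤ radius a R s := by
  unfold radius
  gcongr

/-- The integrand is the derivative of `-(radius a R t)^(n + 1) / (n + 1)!`; the contribution of the
endpoint `T` has a favourable sign and is dropped. -/
theorem lintegral_radiusSpeed_mul_pow_le {a R s T : ℝ} (ha : 0 ≤ a) (hs : 0 ≤ s) (hsT : s ≤ T)
    (hT : 0 ≤ radius a R T) (n : ℕ) :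
    ∫⁻ t in Icc s T, ENNReal.ofReal (radiusSpeed a t) *
      ENNReal.ofReal (radius a R t ^ n / (n.factorial : ℝ)) ≤
    ENNReal.ofReal (radius a R s ^ (n + 1) / ((n + 1).factorial : ℝ)) := by
  have hpos : ∀ t ∈ Icc s T, 0 ≤ radius a R t := fun t ht => hT.trans (radius_antitone ha R ht.2)
  have hcont : ContinuousOn (fun t => radiusSpeed a t * (radius a R t ^ n / (n.factorial : ℝ)))
      (Icc s T) := by
    have := continuous_radius a R
    unfold radiusSpeed
    refine ContinuousOn.mul (ContinuousOn.mul continuousOn_const ?_) (by fun_prop)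
    refine ContinuousOn.rpow_const (by fun_prop) fun t ht => Or.inl ?_
    have : (0 : ℝ) < 1 + t := by linarith [ht.1]
    exact this.ne'
  have hint : IntervalIntegrable
      (fun t => radiusSpeed a t * (radius a R t ^ n / (n.factorial : ℝ))) volume s T :=
    ContinuousOn.intervalIntegrable (by rwa [uIcc_of_le hsT])
  have hF : ∀ t ∈ uIcc s T, HasDerivAt
      (fun t => -(radius a R t ^ (n + 1) / ((n + 1).factorial : ℝ)))
      (radiusSpeed a t * (radius a R t ^ n / (n.factorial : ℝ))) t := fun t ht => by
    rw [uIcc_of_le hsT] at ht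
    have h1 := (((hasDerivAt_radius a R (hs.trans ht.1)).pow (n + 1)).div_const
      ((n + 1).factorial : ℝ)).neg
    refine h1.congr_deriv ?_
    rw [Nat.factorial_succ]
    have : (n.factorial : ℝ) ≠ 0 := by positivity
    have : (n + 1 : ℝ) ≠ 0 := by positivity
    push_cast
    field_simp
  have hFTC := intervalIntegral.integral_eq_sub_of_hasDerivAt hF hint
  calc _ = ∫⁻ t in Icc s T,
        ENNReal.ofReal (radiusSpeed a t * (radius a R t ^ n / (n.factorial : ℝ))) := by
        refine setLIntegral_congr_fun measurableSet_Icc fun t ht => ?_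
        rw [ENNReal.ofReal_mul (radiusSpeed_nonneg ha (hs.trans ht.1))]
    _ = ENNReal.ofReal (∫ t in Icc s T,
          radiusSpeed a t * (radius a R t ^ n / (n.factorial : ℝ))) := by
        rw [ofReal_integral_eq_lintegral_ofReal (hcont.integrableOn_Icc)]
        filter_upwards [ae_restrict_mem measurableSet_Icc] with t ht
        have := hpos t ht
        have := radiusSpeed_nonneg ha (hs.trans ht.1)
        positivity
    _ ≤ _ := by
        rw [integral_Icc_eq_integral_Ioc, ← intervalIntegral.integral_of_le hsT, hFTC]
        apply ENNReal.ofReal_le_ofReal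
        have : 0 ≤ radius a R T ^ (n + 1) / ((n + 1).factorial : ℝ) := by positivity
        linarith

theorem measurable_radius (a R : ℝ) : Measurable (radius a R) := (continuous_radius a R).measurable

theorem measurable_radiusSpeed (a : ℝ) : Measurable (radiusSpeed a) := by
  unfold radiusSpeed
  fun_prop

/-- The shift is the derivative of `gen` in the radius, so for a fixed sequence the integrand is the
rate at which `gen` decreases along the shrinking radius. This is how a lost derivative becomes
integrable in time. -/
theorem lintegral_radiusSpeed_mul_gen_le {a R s T : ℝ} (ha : 0 ≤ a) (hs : 0 ≤ s) (hsT : s ≤ T)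
    (hT : 0 ≤ radius a R T) (u : ℕ → ℝ≥0∞) :
    ∫⁻ t in Icc s T, ENNReal.ofReal (radiusSpeed a t) * gen (radius a R t) (shift u) ≤
      gen (radius a R s) u := by
  have hr := measurable_radius a R
  have hw := measurable_radiusSpeed a
  simp only [gen, ← ENNReal.tsum_mul_left]
  rw [lintegral_tsum fun n => by fun_prop]
  calc _ = ∑' n, (∫⁻ t in Icc s T, ENNReal.ofReal (radiusSpeed a t) *
        ENNReal.ofReal (radius a R t ^ n / (n.factorial : ℝ))) * u (n + 1) := by
        refine tsum_congr fun n => ?_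
        rw [← lintegral_mul_const _ (by fun_prop)]
        simp only [shift, mul_assoc]
    _ ≤ ∑' n : ℕ, ENNReal.ofReal (radius a R s ^ (n + 1) / ((n + 1).factorial : ℝ)) *
        u (n + 1) := by
        gcongr with n
        exact lintegral_radiusSpeed_mul_pow_le ha hs hsT hT n
    _ ≤ _ := ENNReal.tsum_comp_le_tsum_of_injective (Nat.succ_injective)
        (fun n : ℕ => ENNReal.ofReal (radius a R s ^ n / (n.factorial : ℝ)) * u n)

/-- The majorant Duhamel map. -/
def duhamelMaj (G : ℝ × ℝ → ℝ≥0∞) (M : ℝ → ℝ × ℝ → ℝ≥0∞) (t : ℝ) (p : ℝ × ℝ) : ℝ≥0∞ :=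
  G p + ∫⁻ s in Ioc 0 t, nlMaj s (M s) p

variable {G : ℝ × ℝ → ℝ≥0∞} {M : ℝ → ℝ × ℝ → ℝ≥0∞}

theorem measurable_uncurry_nlMaj (hM : Measurable (Function.uncurry M)) :
    Measurable (Function.uncurry fun s p => nlMaj s (M s) p) :=
  measurable_nlMaj (α := ℝ × ℝ × ℝ) (F := fun x => M x.1)
    (hM.comp (by fun_prop : Measurable fun y : (ℝ × ℝ × ℝ) × ℝ × ℝ => (y.1.1, y.2)))
    measurable_fst measurable_snd

theorem measurable_duhamelMaj (hG : Measurable G) (hM : Measurable (Function.uncurry M)) :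
    Measurable (Function.uncurry (duhamelMaj G M)) := by
  unfold Function.uncurry duhamelMaj
  refine Measurable.add (by fun_prop) ?_
  simp only [← lintegral_indicator measurableSet_Ioc]
  apply Measurable.lintegral_prod_right' (f := fun x : (ℝ × ℝ × ℝ) × ℝ =>
    (Ioc 0 x.1.1).indicator (fun s => nlMaj s (M s) x.1.2) x.2)
  have : (fun x : (ℝ × ℝ × ℝ) × ℝ => (Ioc 0 x.1.1).indicator (fun s => nlMaj s (M s) x.1.2) x.2) =
      {x : (ℝ × ℝ × ℝ) × ℝ | 0 < x.2 ∧ x.2 ≤ x.1.1}.indicator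
        (fun x => nlMaj x.2 (M x.2) x.1.2) := by
    ext x
    simp [indicator, Set.mem_Ioc]
  rw [this]
  refine Measurable.indicator ?_ ?_
  · exact (measurable_uncurry_nlMaj hM).comp
      (by fun_prop : Measurable fun x : (ℝ × ℝ × ℝ) × ℝ => (x.2, x.1.2))
  · have h1 : MeasurableSet {x : (ℝ × ℝ × ℝ) × ℝ | 0 < x.2} :=
      measurableSet_lt measurable_const measurable_snd
    have h2 : MeasurableSet {x : (ℝ × ℝ × ℝ) × ℝ | x.2 ≤ x.1.1} :=
      measurableSet_le measurable_snd (by fun_prop)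
    exact h1.inter h2

theorem measurable_en {α : Type*} [MeasurableSpace α] {F : α → ℝ × ℝ → ℝ≥0∞}
    (hF : Measurable (Function.uncurry F)) (n : ℕ) : Measurable fun a => en (F a) n := by
  have hr := measurable_rad
  refine measurable_l2 (F := fun a p => rad p ^ n * ((1 + rad p) * F a p)) ?_
  unfold Function.uncurry at *
  fun_prop

theorem en_duhamelMaj_le (hG : Measurable G) (hM : Measurable (Function.uncurry M)) (t : ℝ)
    (n : ℕ) : en (duhamelMaj G M t) n ≤
      en G n + ∫⁻ s in Ioc 0 t, en (fun p => nlMaj s (M s) p) n := by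
  have hr := measurable_rad
  have hN := measurable_uncurry_nlMaj hM
  have hNp : ∀ p, Measurable fun s => nlMaj s (M s) p := fun p =>
    hN.comp (by fun_prop : Measurable fun s : ℝ => (s, p))
  have hN2 : Measurable fun x : ℝ × ℝ × ℝ => nlMaj x.1 (M x.1) x.2 := hN
  have hI : Measurable fun p => ∫⁻ s in Ioc 0 t, nlMaj s (M s) p :=
    Measurable.lintegral_prod_right' (f := fun x : (ℝ × ℝ) × ℝ => nlMaj x.2 (M x.2) x.1)
      (hN.comp measurable_swap)
  unfold en
  calc _ ≤ l2 volume (fun p => rad p ^ n * ((1 + rad p) * G p)) +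
        l2 volume (fun p => rad p ^ n * ((1 + rad p) * ∫⁻ s in Ioc 0 t, nlMaj s (M s) p)) := by
        refine le_trans (le_of_eq ?_) (l2_add_le volume (by fun_prop) (by fun_prop))
        congr 1
        ext p
        rw [duhamelMaj]
        ring
    _ = l2 volume (fun p => rad p ^ n * ((1 + rad p) * G p)) +
        l2 volume (fun p => ∫⁻ s in Ioc 0 t, rad p ^ n * ((1 + rad p) * nlMaj s (M s) p)) := by
        congr 2
        ext p
        rw [lintegral_const_mul _ ((hNp p).const_mul _), lintegral_const_mul _ (hNp p)]
    _ ≤ _ := by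
        gcongr
        refine l2_lintegral_le _ _ (F := fun s p => rad p ^ n * ((1 + rad p) * nlMaj s (M s) p)) ?_
        unfold Function.uncurry
        fun_prop

theorem gen_lintegral {α : Type*} [MeasurableSpace α] (μ : Measure α) (lam : ℝ)
    {u : α → ℕ → ℝ≥0∞} (hu : ∀ n, Measurable fun a => u a n) :
    gen lam (fun n => ∫⁻ a, u a n ∂μ) = ∫⁻ a, gen lam (u a) ∂μ := by
  unfold gen
  rw [lintegral_tsum fun n => ((hu n).const_mul _).aemeasurable]
  refine tsum_congr fun n => ?_
  rw [lintegral_const_mul _ (hu n)]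

theorem measurable_gen {α : Type*} [MeasurableSpace α] {lam : α → ℝ} (hl : Measurable lam)
    {u : α → ℕ → ℝ≥0∞} (hu : ∀ n, Measurable fun a => u a n) :
    Measurable fun a => gen (lam a) (u a) := by
  unfold gen
  exact Measurable.tsum fun n => by have := hu n; fun_prop

/-- Tonelli on the triangle `0 < s ≤ t ≤ T`. It lets the dissipation of a Duhamel term be integrated
over the times after its source time `s`. -/
theorem lintegral_triangle_swap {T : ℝ} {f : ℝ → ℝ → ℝ≥0∞}
    (hf : Measurable (Function.uncurry f)) :
    ∫⁻ t in Ioc 0 T, ∫⁻ s in Ioc 0 t, f t s = ∫⁻ s in Ioc 0 T, ∫⁻ t in Icc s T, f t s := by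
  simp only [← lintegral_indicator measurableSet_Ioc, ← lintegral_indicator measurableSet_Icc]
  have h1 : ∀ t, (Ioc 0 T).indicator
      (fun t => ∫⁻ s, (Ioc 0 t).indicator (fun s => f t s) s) t =
      ∫⁻ s, {x : ℝ × ℝ | 0 < x.2 ∧ x.2 ≤ x.1 ∧ x.1 ≤ T}.indicator (Function.uncurry f) (t, s) := by
    intro t
    by_cases ht : t ∈ Ioc 0 T
    · rw [indicator_of_mem ht]
      refine lintegral_congr fun s => ?_
      simp only [indicator, mem_Ioc, mem_ofPred_eq, ht.2, and_true, Function.uncurry]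
    · rw [indicator_of_notMem ht]
      symm
      rw [lintegral_eq_zero_of_ae_eq_zero]
      refine Eventually.of_forall fun s => ?_
      apply indicator_of_notMem
      rintro ⟨h1, h2, h3⟩
      exact ht ⟨lt_of_lt_of_le h1 h2, h3⟩
  have h2 : ∀ s, (Ioc 0 T).indicator
      (fun s => ∫⁻ t, (Icc s T).indicator (fun t => f t s) t) s =
      ∫⁻ t, {x : ℝ × ℝ | 0 < x.2 ∧ x.2 ≤ x.1 ∧ x.1 ≤ T}.indicator (Function.uncurry f) (t, s) := by
    intro s
    by_cases hs : s ∈ Ioc 0 T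
    · rw [indicator_of_mem hs]
      refine lintegral_congr fun t => ?_
      simp only [indicator, mem_Icc, mem_ofPred_eq, hs.1, true_and, Function.uncurry]
    · rw [indicator_of_notMem hs]
      symm
      rw [lintegral_eq_zero_of_ae_eq_zero]
      refine Eventually.of_forall fun t => ?_
      apply indicator_of_notMem
      rintro ⟨h1, h2, h3⟩
      exact hs ⟨h1, h2.trans h3⟩
  simp only [h1, h2]
  rw [lintegral_lintegral_swap]
  apply Measurable.aemeasurable
  have h1 : MeasurableSet {x : ℝ × ℝ | 0 < x.2} := measurableSet_lt measurable_const measurable_snd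
  have h2 : MeasurableSet {x : ℝ × ℝ | x.2 ≤ x.1} := measurableSet_le measurable_snd measurable_fst
  have h3 : MeasurableSet {x : ℝ × ℝ | x.1 ≤ T} := measurableSet_le measurable_fst measurable_const
  exact hf.indicator (h1.inter (h2.inter h3))

/-- The bounds that are propagated by the majorant iteration: the energy along the shrinking radius
and the dissipation. -/
structure EnergyBound (a R T : ℝ) (B : ℝ≥0∞) (M : ℝ → ℝ × ℝ → ℝ≥0∞) : Prop where
  energy : ∀ t ∈ Icc 0 T, gen (radius a R t) (en (M t)) ≤ B
  dissipation : ∫⁻ t in Ioc 0 T, ENNReal.ofReal (radiusSpeed a t) *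
    gen (radius a R t) (shift (en (M t))) ≤ B

/-- The trilinear estimate, the energy bound on two factors and the dissipation bound on the third
give a cubic bound of the time integral of the nonlinearity, at most `e` by the smallness condition.
The data contributes the other `e`. For the energy at time `t`, the radius at `t` is below the
radius at each source time `s`. -/
theorem EnergyBound.duhamelMaj {a R T : ℝ} (ha : 0 < a) (hT : 0 ≤ T) (hRT : 0 ≤ radius a R T)
    {e : ℝ≥0∞} (he : 4 * triConst * ENNReal.ofReal (2 / a) * (2 * e) ^ 3 ≤ e)
    (hG : Measurable G) (hGe : gen R (en G) ≤ e) (hM : Measurable (Function.uncurry M))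
    (h : EnergyBound a R T (2 * e) M) : EnergyBound a R T (2 * e) (duhamelMaj G M) := by
  have hrad := measurable_radius a R
  have hw := measurable_radiusSpeed a
  have hpos : ∀ t ∈ Icc 0 T, 0 ≤ radius a R t := fun t ht =>
    hRT.trans (radius_antitone ha.le R ht.2)
  have hR0 : radius a R 0 = R := by simp [radius]
  have hN := measurable_uncurry_nlMaj hM
  have hMs : ∀ s, Measurable (M s) := fun s => hM.comp measurable_prodMk_left
  have hen : ∀ n, Measurable fun s => en (fun p => nlMaj s (M s) p) n := measurable_en hN
  have hI : ∫⁻ s in Ioc 0 T, gen (radius a R s) (en fun p => nlMaj s (M s) p) ≤ e := by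
    refine le_trans ?_ he
    calc _ ≤ ∫⁻ s in Ioc 0 T, 4 * triConst * ENNReal.ofReal (2 / a) * (2 * e) ^ 2 *
          (ENNReal.ofReal (radiusSpeed a s) * gen (radius a R s) (shift (en (M s)))) := by
          refine setLIntegral_mono' measurableSet_Ioc fun s hs => ?_
          have hs' : s ∈ Icc 0 T := ⟨hs.1.le, hs.2⟩
          refine (gen_en_nlMaj_le (hMs s) hs.1.le (hpos s hs')).trans ?_
          -- The decay of the trilinear estimate is, up to the constant `2 / a`, the speed of the
          -- radius; `radius` is chosen for this.
          have h1 : ENNReal.ofReal ((1 + s) ^ (-(1 / 2) : ℝ)) =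
              ENNReal.ofReal (2 / a) * ENNReal.ofReal (radiusSpeed a s) := by
            rw [← ENNReal.ofReal_mul (by positivity), radiusSpeed]
            congr 1
            field_simp
          rw [h1]
          calc _ ≤ 4 * triConst * (ENNReal.ofReal (2 / a) * ENNReal.ofReal (radiusSpeed a s)) *
              (gen (radius a R s) (shift (en (M s))) * (2 * e) ^ 2) := by
                gcongr; exact h.energy s hs'
            _ = _ := by ring
      _ = 4 * triConst * ENNReal.ofReal (2 / a) * (2 * e) ^ 2 *
          ∫⁻ s in Ioc 0 T, ENNReal.ofReal (radiusSpeed a s) *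
            gen (radius a R s) (shift (en (M s))) := by
          rw [lintegral_const_mul]
          exact Measurable.mul (by fun_prop)
            (measurable_gen hrad fun n => measurable_en hM (n + 1))
      _ ≤ 4 * triConst * ENNReal.ofReal (2 / a) * (2 * e) ^ 2 * (2 * e) := by
          gcongr; exact h.dissipation
      _ = _ := by ring
  constructor
  · intro t ht
    refine (gen_mono (en_duhamelMaj_le hG hM t)).trans ?_
    rw [gen_add, gen_lintegral _ _ hen, two_mul]
    refine add_le_add ?_ ?_
    · refine le_trans (gen_mono_left (hpos t ht) ?_ _) hGe
      exact (radius_antitone ha.le R ht.1).trans hR0.le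
    · refine le_trans ?_ hI
      calc _ ≤ ∫⁻ s in Ioc 0 t, gen (radius a R s) (en fun p => nlMaj s (M s) p) := by
            refine setLIntegral_mono' measurableSet_Ioc fun s hs => ?_
            exact gen_mono_left (hpos t ht) (radius_antitone ha.le R hs.2) _
        _ ≤ _ := lintegral_mono_set (Ioc_subset_Ioc_right ht.2)
  · have h1 : ∀ t, gen (radius a R t) (shift (en (ScreenedVP.duhamelMaj G M t))) ≤
        gen (radius a R t) (shift (en G)) +
          ∫⁻ s in Ioc 0 t, gen (radius a R t) (shift (en fun p => nlMaj s (M s) p)) := fun t => by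
      refine (gen_mono fun n => en_duhamelMaj_le hG hM t (n + 1)).trans ?_
      rw [gen_add, gen_lintegral _ _ fun n => hen (n + 1)]
      rfl
    have hjoint : Measurable (Function.uncurry fun t s : ℝ => ENNReal.ofReal (radiusSpeed a t) *
        gen (radius a R t) (shift (en fun p => nlMaj s (M s) p))) := by
      unfold Function.uncurry
      refine Measurable.mul (by fun_prop) (measurable_gen (by fun_prop) fun n => ?_)
      exact (hen (n + 1)).comp measurable_snd
    calc _ ≤ ∫⁻ t in Ioc 0 T, (ENNReal.ofReal (radiusSpeed a t) *
            gen (radius a R t) (shift (en G)) +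
          ∫⁻ s in Ioc 0 t, ENNReal.ofReal (radiusSpeed a t) *
            gen (radius a R t) (shift (en fun p => nlMaj s (M s) p))) := by
          refine lintegral_mono fun t => ?_
          have h2 : Measurable fun s =>
              gen (radius a R t) (shift (en fun p => nlMaj s (M s) p)) :=
            measurable_gen measurable_const fun n => hen (n + 1)
          rw [lintegral_const_mul _ h2, ← mul_add]
          exact mul_le_mul_right (h1 t) _
      _ = (∫⁻ t in Ioc 0 T, ENNReal.ofReal (radiusSpeed a t) * gen (radius a R t) (shift (en G))) +
          ∫⁻ t in Ioc 0 T, ∫⁻ s in Ioc 0 t, ENNReal.ofReal (radiusSpeed a t) *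
            gen (radius a R t) (shift (en fun p => nlMaj s (M s) p)) := by
          refine lintegral_add_left ?_ _
          exact Measurable.mul (by fun_prop) (measurable_gen hrad fun n => measurable_const)
      _ ≤ e + e := by
          refine add_le_add ?_ ?_
          · refine (lintegral_mono_set Ioc_subset_Icc_self).trans ?_
            refine (lintegral_radiusSpeed_mul_gen_le ha.le le_rfl hT hRT _).trans ?_
            rwa [hR0]
          -- After the exchange the source at time `s` is a fixed sequence, whose dissipation over
          -- `[s, T]` is at most its energy at the radius of time `s`.
          · rw [lintegral_triangle_swap hjoint]
            refine le_trans (setLIntegral_mono' measurableSet_Ioc fun s hs => ?_) hI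
            exact lintegral_radiusSpeed_mul_gen_le ha.le hs.1.le hs.2 hRT _
      _ = 2 * e := (two_mul e).symm

/-- The majorant iterates. -/
def majIter (G : ℝ × ℝ → ℝ≥0∞) : ℕ → ℝ → ℝ × ℝ → ℝ≥0∞
  | 0 => fun _ _ => 0
  | n + 1 => duhamelMaj G (majIter G n)

theorem measurable_majIter (hG : Measurable G) (n : ℕ) :
    Measurable (Function.uncurry (majIter G n)) := by
  induction n with
  | zero => exact measurable_const
  | succ n ih => exact measurable_duhamelMaj hG ih

theorem lineCorr_mono {F F' G G' : ℝ × ℝ → ℝ≥0∞} (h : ∀ p, F p ≤ F' p) (h' : ∀ p, G p ≤ G' p)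
    (t k : ℝ) : lineCorr F G t k ≤ lineCorr F' G' t k :=
  lintegral_mono fun _ => mul_le_mul' (h _) (h' _)

theorem nlMaj_mono {F F' : ℝ × ℝ → ℝ≥0∞} (h : ∀ p, F p ≤ F' p) (t : ℝ) (p : ℝ × ℝ) :
    nlMaj t F p ≤ nlMaj t F' p :=
  lintegral_mono fun _ => mul_le_mul' (mul_le_mul_right (lineCorr_mono h h _ _) _)
    (mul_le_mul_right (h _) _)

theorem duhamelMaj_mono {M M' : ℝ → ℝ × ℝ → ℝ≥0∞} (h : ∀ t p, M t p ≤ M' t p) (t : ℝ)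
    (p : ℝ × ℝ) : duhamelMaj G M t p ≤ duhamelMaj G M' t p :=
  add_le_add le_rfl (lintegral_mono fun s => nlMaj_mono (h s) s p)

theorem majIter_mono (G : ℝ × ℝ → ℝ≥0∞) : Monotone (majIter G) := by
  refine monotone_nat_of_le_succ fun n => ?_
  induction n with
  | zero => exact fun t p => zero_le
  | succ n ih => exact fun t p => duhamelMaj_mono ih t p

/-- The limit of the majorant iterates. -/
def majLim (G : ℝ × ℝ → ℝ≥0∞) (t : ℝ) (p : ℝ × ℝ) : ℝ≥0∞ := ⨆ n, majIter G n t p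

theorem measurable_majLim (hG : Measurable G) : Measurable (Function.uncurry (majLim G)) := by
  unfold majLim Function.uncurry
  exact Measurable.iSup fun n => measurable_majIter hG n

theorem majIter_mono_time (G : ℝ × ℝ → ℝ≥0∞) (n : ℕ) {s t : ℝ} (hst : s ≤ t) (p : ℝ × ℝ) :
    majIter G n s p ≤ majIter G n t p := by
  cases n with
  | zero => exact le_rfl
  | succ n => exact add_le_add le_rfl (lintegral_mono_set (Ioc_subset_Ioc_right hst))

theorem majLim_mono_time (G : ℝ × ℝ → ℝ≥0∞) {s t : ℝ} (hst : s ≤ t) (p : ℝ × ℝ) :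
    majLim G s p ≤ majLim G t p :=
  iSup_mono fun n => majIter_mono_time G n hst p

theorem energyBound_majIter {a R T : ℝ} (ha : 0 < a) (hT : 0 ≤ T) (hRT : 0 ≤ radius a R T)
    {e : ℝ≥0∞} (he : 4 * triConst * ENNReal.ofReal (2 / a) * (2 * e) ^ 3 ≤ e)
    (hG : Measurable G) (hGe : gen R (en G) ≤ e) (n : ℕ) :
    EnergyBound a R T (2 * e) (majIter G n) := by
  induction n with
  | zero =>
    have h0 : ∀ t, en (majIter G 0 t) = 0 := fun t => by
      ext n
      simp [en, majIter, l2]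
    constructor
    · intro t _
      simp [h0, gen]
    · simp [h0, gen, shift]
  | succ n ih => exact ih.duhamelMaj ha hT hRT he hG hGe (measurable_majIter hG n)

/-- The series is the supremum of its finite partial sums, and in a finite sum the supremum of
increasing sequences may be taken termwise. -/
theorem gen_iSup_le {lam : ℝ} {u : ℕ → ℕ → ℝ≥0∞} (hu : ∀ k, Monotone fun n => u n k) {B : ℝ≥0∞}
    (h : ∀ n, gen lam (u n) ≤ B) : gen lam (fun k => ⨆ n, u n k) ≤ B := by
  unfold gen
  rw [ENNReal.tsum_eq_iSup_sum]
  refine iSup_le fun s => ?_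
  simp only [ENNReal.mul_iSup]
  rw [ENNReal.finsetSum_iSup_of_monotone
    (f := fun k n => ENNReal.ofReal (lam ^ k / (k.factorial : ℝ)) * u n k)
    fun k m n hmn => mul_le_mul_right (hu k hmn) _]
  exact iSup_le fun n => (ENNReal.sum_le_tsum s).trans (h n)

/-- The bounds on the iterates are uniform in `n` and the iterates increase, so monotone convergence
carries the bound to the limit. In particular the limit is finite almost everywhere. -/
theorem gen_en_majLim_le {a R T : ℝ} (ha : 0 < a) (hT : 0 ≤ T) (hRT : 0 ≤ radius a R T)
    {e : ℝ≥0∞} (he : 4 * triConst * ENNReal.ofReal (2 / a) * (2 * e) ^ 3 ≤ e)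
    (hG : Measurable G) (hGe : gen R (en G) ≤ e) {t : ℝ} (ht : t ∈ Icc 0 T) :
    gen (radius a R t) (en (majLim G t)) ≤ 2 * e := by
  have hr := measurable_rad
  have hm : ∀ n, Measurable (majIter G n t) := fun n =>
    (measurable_majIter hG n).comp measurable_prodMk_left
  have h1 : en (majLim G t) = fun k => ⨆ n, en (majIter G n t) k := by
    ext k
    unfold en majLim
    simp only [ENNReal.mul_iSup]
    rw [l2_iSup]
    · exact fun n => by have := hm n; fun_prop
    · intro m n hmn p
      dsimp only
      gcongr
      exact majIter_mono G hmn t p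
  rw [h1]
  refine gen_iSup_le (fun k m n hmn => l2_mono fun p => ?_)
    fun n => (energyBound_majIter ha hT hRT he hG hGe n).energy t ht
  gcongr
  exact majIter_mono G hmn t p

theorem iSup_mul_iSup_of_directed {f g : ℕ → ℝ≥0∞} (h : ∀ i j, ∃ k, f i * g j ≤ f k * g k) :
    (⨆ n, f n) * ⨆ n, g n = ⨆ n, f n * g n := by
  apply le_antisymm
  · rw [ENNReal.iSup_mul]
    refine iSup_le fun i => ?_
    rw [ENNReal.mul_iSup]
    refine iSup_le fun j => ?_
    obtain ⟨k, hk⟩ := h i j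
    exact hk.trans (le_iSup (fun n => f n * g n) k)
  · exact iSup_le fun n => mul_le_mul' (le_iSup f n) (le_iSup g n)

theorem lineCorr_iSup {F : ℕ → ℝ × ℝ → ℝ≥0∞} (hF : ∀ n, Measurable (F n)) (hmono : Monotone F)
    (t k : ℝ) : lineCorr (fun p => ⨆ n, F n p) (fun p => ⨆ n, F n p) t k =
      ⨆ n, lineCorr (F n) (F n) t k := by
  unfold lineCorr
  rw [← lintegral_iSup]
  · refine lintegral_congr fun q => ?_
    rw [iSup_mul_iSup_of_directed fun i j => ?_]
    exact ⟨max i j, mul_le_mul' (hmono (le_max_left i j) _) (hmono (le_max_right i j) _)⟩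
  · exact fun n => by have := hF n; fun_prop
  · exact fun m n hmn q => mul_le_mul' (hmono hmn _) (hmono hmn _)

theorem nlMaj_iSup {F : ℕ → ℝ × ℝ → ℝ≥0∞} (hF : ∀ n, Measurable (F n)) (hmono : Monotone F)
    (t : ℝ) (p : ℝ × ℝ) : nlMaj t (fun p => ⨆ n, F n p) p = ⨆ n, nlMaj t (F n) p := by
  unfold nlMaj
  have hm := measurable_fieldMult
  rw [← lintegral_iSup]
  · refine lintegral_congr fun k => ?_
    rw [lineCorr_iSup hF hmono, linMaj, ENNReal.mul_iSup, ENNReal.mul_iSup,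
      iSup_mul_iSup_of_directed fun i j => ?_]
    · rfl
    · exact ⟨max i j, mul_le_mul' (mul_le_mul_right (lineCorr_mono (hmono (le_max_left i j))
        (hmono (le_max_left i j)) _ _) _) (mul_le_mul_right (hmono (le_max_right i j) _) _)⟩
  · intro n
    have hFn : Measurable (Function.uncurry fun _ : ℝ => F n) := (hF n).comp measurable_snd
    exact Measurable.mul (Measurable.mul (by fun_prop)
      (measurable_lineCorr hFn hFn measurable_const measurable_id))
      (measurable_linMaj hFn measurable_const (by fun_prop))
  · exact fun m n hmn k => mul_le_mul' (mul_le_mul_right (lineCorr_mono (hmono hmn) (hmono hmn) _ _)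
      _) (mul_le_mul_right (hmono hmn _) _)

/-- Monotone convergence passes through every integral of the majorant map, so its value at the
limit is the supremum of the later iterates. Only this inequality is needed in the complex problem.
-/
theorem duhamelMaj_majLim_le (hG : Measurable G) (t : ℝ) (p : ℝ × ℝ) :
    duhamelMaj G (majLim G) t p ≤ majLim G t p := by
  have hm : ∀ n s, Measurable (majIter G n s) := fun n s =>
    (measurable_majIter hG n).comp measurable_prodMk_left
  have h1 : ∀ s, nlMaj s (majLim G s) p = ⨆ n, nlMaj s (majIter G n s) p := fun s =>
    nlMaj_iSup (fun n => hm n s) (fun m n hmn => majIter_mono G hmn s) s p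
  unfold duhamelMaj
  simp only [h1]
  rw [lintegral_iSup, ENNReal.add_iSup]
  · exact iSup_le fun n => le_iSup (fun n => majIter G n t p) (n + 1)
  · exact fun n => (measurable_uncurry_nlMaj (measurable_majIter hG n)).comp
      (by fun_prop : Measurable fun s : ℝ => (s, p))
  · exact fun m n hmn s => nlMaj_mono (majIter_mono G hmn s) s p

/-! ### The complex iteration -/

/-- `A` and `B` bound `a` and `b`, and the increment of the bounds bounds the distance. -/
structure Dom (a b : ℂ) (A B : ℝ≥0∞) : Prop where
  left : ‖a‖ₑ ≤ A
  right : ‖b‖ₑ ≤ B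
  sub : ‖b - a‖ₑ + A ≤ B

namespace Dom

theorem le {a b : ℂ} {A B : ℝ≥0∞} (h : Dom a b A B) : A ≤ B := le_add_self.trans h.sub

theorem refl {a : ℂ} {A : ℝ≥0∞} (h : ‖a‖ₑ ≤ A) : Dom a a A A := ⟨h, h, by simp⟩

theorem trans {a b c : ℂ} {A B C : ℝ≥0∞} (h : Dom a b A B) (h' : Dom b c B C) : Dom a c A C := by
  refine ⟨h.left, h'.right, ?_⟩
  calc ‖c - a‖ₑ + A ≤ (‖c - b‖ₑ + ‖b - a‖ₑ) + A := by
        gcongr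
        rw [← sub_add_sub_cancel c b a]
        exact enorm_add_le _ _
    _ = ‖c - b‖ₑ + (‖b - a‖ₑ + A) := by rw [add_assoc]
    _ ≤ ‖c - b‖ₑ + B := by gcongr; exact h.sub
    _ ≤ C := h'.sub

/-- The splitting `b d - a c = (b - a) d + a (d - c)` has the same form for the bounds. The
increment is kept as a sum in `Dom` rather than as a difference, so infinite bounds do no harm. -/
theorem mul {a b c d : ℂ} {A B C D : ℝ≥0∞} (h : Dom a b A B) (h' : Dom c d C D) :
    Dom (a * c) (b * d) (A * C) (B * D) := by
  refine ⟨?_, ?_, ?_⟩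
  · rw [enorm_mul]
    exact mul_le_mul' h.left h'.left
  · rw [enorm_mul]
    exact mul_le_mul' h.right h'.right
  · calc ‖b * d - a * c‖ₑ + A * C ≤ (‖b - a‖ₑ * ‖d‖ₑ + ‖a‖ₑ * ‖d - c‖ₑ) + A * C := by
          gcongr
          rw [← enorm_mul, ← enorm_mul, show b * d - a * c = (b - a) * d + a * (d - c) by ring]
          exact enorm_add_le _ _
      _ ≤ (‖b - a‖ₑ * D + A * ‖d - c‖ₑ) + A * C := by
          gcongr
          · exact h'.right
          · exact h.left
      _ = ‖b - a‖ₑ * D + A * (‖d - c‖ₑ + C) := by ring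
      _ ≤ ‖b - a‖ₑ * D + A * D := by gcongr; exact h'.sub
      _ = (‖b - a‖ₑ + A) * D := by ring
      _ ≤ B * D := by gcongr; exact h.sub

theorem add {a b c d : ℂ} {A B C D : ℝ≥0∞} (h : Dom a b A B) (h' : Dom c d C D) :
    Dom (a + c) (b + d) (A + C) (B + D) := by
  refine ⟨(enorm_add_le _ _).trans (add_le_add h.left h'.left),
    (enorm_add_le _ _).trans (add_le_add h.right h'.right), ?_⟩
  calc _ ≤ (‖b - a‖ₑ + ‖d - c‖ₑ) + (A + C) := by
        gcongr
        rw [add_sub_add_comm]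
        exact enorm_add_le _ _
    _ = (‖b - a‖ₑ + A) + (‖d - c‖ₑ + C) := by ring
    _ ≤ _ := add_le_add h.sub h'.sub

theorem conj {a b : ℂ} {A B : ℝ≥0∞} (h : Dom a b A B) :
    Dom (starRingEnd ℂ a) (starRingEnd ℂ b) A B := by
  have hc : ∀ z : ℂ, ‖starRingEnd ℂ z‖ₑ = ‖z‖ₑ := fun z => by
    rw [← ofReal_norm, ← ofReal_norm, RCLike.norm_conj]
  exact ⟨by rw [hc]; exact h.left, by rw [hc]; exact h.right,
    by rw [← map_sub, hc]; exact h.sub⟩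

/-- If the larger bound has infinite integral there is nothing to prove; otherwise both functions
are integrable and the difference of the integrals is the integral of the difference. This dichotomy
spares all integrability hypotheses. -/
theorem integral {α : Type*} [MeasurableSpace α] {μ : Measure α} {f g : α → ℂ} {F G : α → ℝ≥0∞}
    (hf : Measurable f) (hg : Measurable g) (h : ∀ x, Dom (f x) (g x) (F x) (G x)) :
    Dom (∫ x, f x ∂μ) (∫ x, g x ∂μ) (∫⁻ x, F x ∂μ) (∫⁻ x, G x ∂μ) := by
  have hl : ‖∫ x, f x ∂μ‖ₑ ≤ ∫⁻ x, F x ∂μ :=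
    (enorm_integral_le_lintegral_enorm _).trans (lintegral_mono fun x => (h x).left)
  have hr : ‖∫ x, g x ∂μ‖ₑ ≤ ∫⁻ x, G x ∂μ :=
    (enorm_integral_le_lintegral_enorm _).trans (lintegral_mono fun x => (h x).right)
  refine ⟨hl, hr, ?_⟩
  rcases eq_top_or_lt_top (∫⁻ x, G x ∂μ) with htop | hlt
  · rw [htop]; exact le_top
  have hgi : Integrable g μ :=
    ⟨hg.aestronglyMeasurable, (lintegral_mono fun x => (h x).right).trans_lt hlt⟩
  have hfi : Integrable f μ :=
    ⟨hf.aestronglyMeasurable, (lintegral_mono fun x => (h x).left.trans (h x).le).trans_lt hlt⟩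
  rw [← integral_sub hgi hfi]
  calc _ ≤ ∫⁻ x, ‖g x - f x‖ₑ ∂μ + ∫⁻ x, F x ∂μ := by
        gcongr
        exact enorm_integral_le_lintegral_enorm _
    _ = ∫⁻ x, (‖g x - f x‖ₑ + F x) ∂μ := (lintegral_add_left (by fun_prop) _).symm
    _ ≤ _ := lintegral_mono fun x => (h x).sub

end Dom

/-! ### The complex nonlinearity and its Duhamel map -/

/-- The Fourier transform in `x` of the density of the profile with Fourier transform `f`. -/
def rhoHat (t : ℝ) (f : ℝ × ℝ → ℂ) (k : ℝ) : ℂ :=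
  ∫ q : ℝ × ℝ, f (q + (k, t * k)) * starRingEnd ℂ (f q)

/-- The symbol of `∂_v - t ∂_x`. -/
def linSym (t : ℝ) (f : ℝ × ℝ → ℂ) (q : ℝ × ℝ) : ℂ :=
  2 * Real.pi * Complex.I * (q.2 - t * q.1 : ℝ) * f q

/-- The nonlinearity of the profile equation in Fourier variables. -/
def nl (t : ℝ) (f : ℝ × ℝ → ℂ) (p : ℝ × ℝ) : ℂ :=
  ∫ k : ℝ, fieldMult k * rhoHat t f k * linSym t f (p - (k, t * k))

theorem enorm_symbol (t : ℝ) (q : ℝ × ℝ) : ‖2 * Real.pi * Complex.I * (q.2 - t * q.1 : ℝ)‖ₑ =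
    ENNReal.ofReal (2 * Real.pi * |q.2 - t * q.1|) := by
  rw [← ofReal_norm]
  congr 1
  rw [norm_mul, Complex.norm_real]
  simp [abs_of_pos Real.pi_pos]

section Measurability

variable {α : Type*} [MeasurableSpace α] {f : α → ℝ × ℝ → ℂ}

theorem measurable_integral_right {β : Type*} [MeasurableSpace β] (ν : Measure β) [SFinite ν]
    {g : α × β → ℂ} (hg : Measurable g) : Measurable fun a => ∫ b, g (a, b) ∂ν :=
  (hg.stronglyMeasurable.integral_prod_right' (ν := ν)).measurable

theorem measurable_rhoHat (hf : Measurable (Function.uncurry f)) {t k : α → ℝ} (ht : Measurable t)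
    (hk : Measurable k) : Measurable fun a => rhoHat (t a) (f a) (k a) := by
  unfold rhoHat
  refine measurable_integral_right volume (g := fun x : α × ℝ × ℝ =>
    f x.1 (x.2 + (k x.1, t x.1 * k x.1)) * starRingEnd ℂ (f x.1 x.2)) ?_
  refine Measurable.mul ?_ (Complex.continuous_conj.measurable.comp hf)
  exact hf.comp (by fun_prop : Measurable fun x : α × ℝ × ℝ =>
    (x.1, x.2 + (k x.1, t x.1 * k x.1)))

theorem measurable_linSym (hf : Measurable (Function.uncurry f)) {t : α → ℝ} {q : α → ℝ × ℝ}
    (ht : Measurable t) (hq : Measurable q) : Measurable fun a => linSym (t a) (f a) (q a) := by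
  unfold linSym
  exact Measurable.mul (by fun_prop) (hf.comp (measurable_id.prodMk hq))

theorem measurable_nl (hf : Measurable (Function.uncurry f)) {t : α → ℝ} {p : α → ℝ × ℝ}
    (ht : Measurable t) (hp : Measurable p) : Measurable fun a => nl (t a) (f a) (p a) := by
  unfold nl
  have hf' : Measurable (Function.uncurry fun x : α × ℝ => f x.1) :=
    hf.comp (by fun_prop : Measurable fun y : (α × ℝ) × ℝ × ℝ => (y.1.1, y.2))
  have hm := measurable_fieldMult
  refine measurable_integral_right volume (g := fun x : α × ℝ =>
    fieldMult x.2 * rhoHat (t x.1) (f x.1) x.2 * linSym (t x.1) (f x.1) (p x.1 - (x.2, t x.1 * x.2))) ?_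
  refine Measurable.mul (Measurable.mul (by fun_prop) ?_) ?_
  · exact measurable_rhoHat hf' (ht.comp measurable_fst) measurable_snd
  · exact measurable_linSym hf' (ht.comp measurable_fst) (by fun_prop)

end Measurability

/-- The Duhamel map in Fourier variables. -/
def duhamel (g : ℝ × ℝ → ℂ) (f : ℝ → ℝ × ℝ → ℂ) (t : ℝ) (p : ℝ × ℝ) : ℂ :=
  g p + ∫ s in Ioc 0 t, nl s (f s) p

variable {g : ℝ × ℝ → ℂ} {f : ℝ → ℝ × ℝ → ℂ}

theorem measurable_nl_comp {α : Type*} [MeasurableSpace α] (hf : Measurable (Function.uncurry f))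
    {s : α → ℝ} {p : α → ℝ × ℝ} (hs : Measurable s) (hp : Measurable p) :
    Measurable fun a => nl (s a) (f (s a)) (p a) :=
  measurable_nl (f := fun a => f (s a))
    (hf.comp (by fun_prop : Measurable fun y : α × ℝ × ℝ => (s y.1, y.2))) hs hp

theorem measurable_duhamel (hg : Measurable g) (hf : Measurable (Function.uncurry f)) :
    Measurable (Function.uncurry (duhamel g f)) := by
  unfold Function.uncurry duhamel
  refine Measurable.add (by fun_prop) ?_
  simp only [← integral_indicator measurableSet_Ioc]
  refine measurable_integral_right volume (g := fun x : (ℝ × ℝ × ℝ) × ℝ =>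
    (Ioc 0 x.1.1).indicator (fun s => nl s (f s) x.1.2) x.2) ?_
  have : (fun x : (ℝ × ℝ × ℝ) × ℝ => (Ioc 0 x.1.1).indicator (fun s => nl s (f s) x.1.2) x.2) =
      {x : (ℝ × ℝ × ℝ) × ℝ | 0 < x.2 ∧ x.2 ≤ x.1.1}.indicator
        (fun x => nl x.2 (f x.2) x.1.2) := by
    ext x
    simp [indicator, Set.mem_Ioc]
  rw [this]
  refine Measurable.indicator ?_ ?_
  · exact measurable_nl_comp hf measurable_snd (by fun_prop)
  · have h1 : MeasurableSet {x : (ℝ × ℝ × ℝ) × ℝ | 0 < x.2} :=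
      measurableSet_lt measurable_const measurable_snd
    have h2 : MeasurableSet {x : (ℝ × ℝ × ℝ) × ℝ | x.2 ≤ x.1.1} :=
      measurableSet_le measurable_snd (by fun_prop)
    exact h1.inter h2

section DomNl

variable {f₁ f₂ : ℝ × ℝ → ℂ} {F₁ F₂ : ℝ × ℝ → ℝ≥0∞}

theorem dom_rhoHat (h₁ : Measurable f₁) (h₂ : Measurable f₂)
    (h : ∀ p, Dom (f₁ p) (f₂ p) (F₁ p) (F₂ p)) (t k : ℝ) :
    Dom (rhoHat t f₁ k) (rhoHat t f₂ k) (lineCorr F₁ F₁ t k) (lineCorr F₂ F₂ t k) := by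
  have hc := Complex.continuous_conj.measurable
  exact Dom.integral (by fun_prop) (by fun_prop) fun q => (h _).mul (h q).conj

theorem dom_linSym (h : ∀ p, Dom (f₁ p) (f₂ p) (F₁ p) (F₂ p)) (t : ℝ) (q : ℝ × ℝ) :
    Dom (linSym t f₁ q) (linSym t f₂ q) (linMaj t F₁ q) (linMaj t F₂ q) :=
  (Dom.refl (enorm_symbol t q).le).mul (h q)

theorem dom_nl (h₁ : Measurable f₁) (h₂ : Measurable f₂)
    (h : ∀ p, Dom (f₁ p) (f₂ p) (F₁ p) (F₂ p)) (t : ℝ) (p : ℝ × ℝ) :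
    Dom (nl t f₁ p) (nl t f₂ p) (nlMaj t F₁ p) (nlMaj t F₂ p) := by
  have hm := measurable_fieldMult
  have key : ∀ f : ℝ × ℝ → ℂ, Measurable f → Measurable fun k : ℝ =>
      fieldMult k * rhoHat t f k * linSym t f (p - (k, t * k)) := fun f hf => by
    have hf' : Measurable (Function.uncurry fun _ : ℝ => f) := hf.comp measurable_snd
    exact Measurable.mul (Measurable.mul (by fun_prop)
      (measurable_rhoHat hf' measurable_const measurable_id))
      (measurable_linSym hf' measurable_const (by fun_prop))
  exact Dom.integral (key f₁ h₁) (key f₂ h₂) fun k =>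
    ((Dom.refl le_rfl).mul (dom_rhoHat h₁ h₂ h t k)).mul (dom_linSym h t _)

end DomNl

/-- The map is composed of products, conjugates, sums and integrals, each of which preserves `Dom`,
and its majorant is composed in the same way. -/
theorem dom_duhamel {f₁ f₂ : ℝ → ℝ × ℝ → ℂ} {M₁ M₂ : ℝ → ℝ × ℝ → ℝ≥0∞}
    (h₁ : Measurable (Function.uncurry f₁)) (h₂ : Measurable (Function.uncurry f₂))
    (h : ∀ t p, Dom (f₁ t p) (f₂ t p) (M₁ t p) (M₂ t p)) (g : ℝ × ℝ → ℂ) (t : ℝ) (p : ℝ × ℝ) :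
    Dom (duhamel g f₁ t p) (duhamel g f₂ t p) (duhamelMaj (fun p => ‖g p‖ₑ) M₁ t p)
      (duhamelMaj (fun p => ‖g p‖ₑ) M₂ t p) := by
  have h3 : Measurable fun s => nl s (f₁ s) p := measurable_nl_comp h₁ measurable_id measurable_const
  have h4 : Measurable fun s => nl s (f₂ s) p := measurable_nl_comp h₂ measurable_id measurable_const
  have h5 : ∀ s, Dom (nl s (f₁ s) p) (nl s (f₂ s) p) (nlMaj s (M₁ s) p) (nlMaj s (M₂ s) p) :=
    fun s => dom_nl (h₁.comp measurable_prodMk_left) (h₂.comp measurable_prodMk_left) (h s) s p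
  have h6 : Dom (g p) (g p) ‖g p‖ₑ ‖g p‖ₑ := Dom.refl le_rfl
  exact h6.add (Dom.integral (μ := volume.restrict (Ioc 0 t)) h3 h4 h5)

/-- The Picard iterates in Fourier variables. -/
def iter (g : ℝ × ℝ → ℂ) : ℕ → ℝ → ℝ × ℝ → ℂ
  | 0 => fun _ _ => 0
  | n + 1 => duhamel g (iter g n)

theorem measurable_iter (hg : Measurable g) (n : ℕ) : Measurable (Function.uncurry (iter g n)) := by
  induction n with
  | zero => exact measurable_const
  | succ n ih => exact measurable_duhamel hg ih

theorem dom_iter_succ (hg : Measurable g) (n : ℕ) (t : ℝ) (p : ℝ × ℝ) :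
    Dom (iter g n t p) (iter g (n + 1) t p) (majIter (fun p => ‖g p‖ₑ) n t p)
      (majIter (fun p => ‖g p‖ₑ) (n + 1) t p) := by
  induction n generalizing t p with
  | zero =>
    have h0 : Dom (0 : ℂ) 0 0 0 := Dom.refl (by simp)
    have h1 := (dom_duhamel (f₁ := fun _ _ => 0) (f₂ := fun _ _ => 0) measurable_const
      measurable_const (fun _ _ => h0) g t p).left
    refine ⟨by simp [iter, majIter], h1, ?_⟩
    simpa [iter, majIter] using h1
  | succ n ih => exact dom_duhamel (measurable_iter hg n) (measurable_iter hg (n + 1)) ih g t p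

theorem dom_iter (hg : Measurable g) {m n : ℕ} (hmn : m ≤ n) (t : ℝ) (p : ℝ × ℝ) :
    Dom (iter g m t p) (iter g n t p) (majIter (fun p => ‖g p‖ₑ) m t p)
      (majIter (fun p => ‖g p‖ₑ) n t p) := by
  induction n, hmn using Nat.le_induction with
  | base => exact Dom.refl (dom_iter_succ hg m t p).left
  | succ n _ ih => exact ih.trans (dom_iter_succ hg n t p)

theorem enorm_iter_sub_le (hg : Measurable g) {m n : ℕ} (hmn : m ≤ n) (t : ℝ) (p : ℝ × ℝ) :
    ‖iter g n t p - iter g m t p‖ₑ + majIter (fun p => ‖g p‖ₑ) m t p ≤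
      majLim (fun p => ‖g p‖ₑ) t p :=
  (dom_iter hg hmn t p).sub.trans (le_iSup (fun n => majIter (fun p => ‖g p‖ₑ) n t p) n)

theorem tendsto_majIter (G : ℝ × ℝ → ℝ≥0∞) (t : ℝ) (p : ℝ × ℝ) :
    Tendsto (fun n => majIter G n t p) atTop (𝓝 (majLim G t p)) :=
  tendsto_atTop_iSup fun _ _ hmn => majIter_mono G hmn t p

theorem tendsto_majLim_sub {G : ℝ × ℝ → ℝ≥0∞} {t : ℝ} {p : ℝ × ℝ} (h : majLim G t p < ⊤) :
    Tendsto (fun n => majLim G t p - majIter G n t p) atTop (𝓝 0) := by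
  have := ENNReal.Tendsto.sub (tendsto_const_nhds (x := majLim G t p)) (tendsto_majIter G t p)
    (Or.inl h.ne)
  rwa [tsub_self] at this

/-- Telescoping bounds the distance of later iterates from the `m`-th by the tail `majLim - majIter
m` of a convergent increasing sequence. Neither contraction nor smallness enters. -/
theorem cauchySeq_iter (hg : Measurable g) {t : ℝ} {p : ℝ × ℝ}
    (h : majLim (fun p => ‖g p‖ₑ) t p < ⊤) : CauchySeq fun n => iter g n t p := by
  have hle : ∀ {m n : ℕ}, m ≤ n → edist (iter g m t p) (iter g n t p) ≤
      majLim (fun p => ‖g p‖ₑ) t p - majIter (fun p => ‖g p‖ₑ) m t p := fun {m n} hmn => by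
    rw [edist_comm, edist_eq_enorm_sub]
    exact ENNReal.le_sub_of_add_le_right
      ((le_iSup (fun n => majIter (fun p => ‖g p‖ₑ) n t p) m).trans_lt h).ne
      (enorm_iter_sub_le hg hmn t p)
  refine EMetric.cauchySeq_iff_le_tendsto_0.2 ⟨_, fun n m N hn hm => ?_, tendsto_majLim_sub h⟩
  rcases le_total n m with h1 | h1
  · exact (hle h1).trans (tsub_le_tsub_left (majIter_mono _ hn t p) _)
  · rw [edist_comm]
    exact (hle h1).trans (tsub_le_tsub_left (majIter_mono _ hm t p) _)

open Classical in
/-- The Fourier transform of the profile of the solution. -/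
def sol (g : ℝ × ℝ → ℂ) (t : ℝ) (p : ℝ × ℝ) : ℂ :=
  -- Where the majorant is infinite every bound by `majLim` is void, so any value would do there;
  -- `0` keeps measurability and Hermitian symmetry.
  if majLim (fun p => ‖g p‖ₑ) t p < ⊤ then limUnder atTop (fun n => iter g n t p) else 0

theorem tendsto_iter (hg : Measurable g) {t : ℝ} {p : ℝ × ℝ}
    (h : majLim (fun p => ‖g p‖ₑ) t p < ⊤) :
    Tendsto (fun n => iter g n t p) atTop (𝓝 (sol g t p)) := by
  rw [sol, if_pos h]
  exact (cauchySeq_iter hg h).tendsto_limUnder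

theorem measurable_sol (hg : Measurable g) : Measurable (Function.uncurry (sol g)) := by
  classical
  refine measurable_of_tendsto_metrizable (f := fun n (x : ℝ × ℝ × ℝ) =>
    if majLim (fun p => ‖g p‖ₑ) x.1 x.2 < ⊤ then iter g n x.1 x.2 else 0) (fun n => ?_) ?_
  · refine Measurable.ite ?_ (measurable_iter hg n) measurable_const
    exact measurableSet_lt (measurable_majLim hg.enorm) measurable_const
  · rw [tendsto_pi_nhds]
    rintro ⟨t, p⟩
    by_cases h : majLim (fun p => ‖g p‖ₑ) t p < ⊤
    · simpa [h, Function.uncurry] using tendsto_iter hg h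
    · simp [h, Function.uncurry, sol]

theorem dom_sol (hg : Measurable g) (n : ℕ) (t : ℝ) (p : ℝ × ℝ) :
    Dom (iter g n t p) (sol g t p) (majIter (fun p => ‖g p‖ₑ) n t p)
      (majLim (fun p => ‖g p‖ₑ) t p) := by
  refine ⟨(dom_iter hg le_rfl t p).left, ?_, ?_⟩ <;>
    rcases lt_or_eq_of_le (le_top : majLim (fun p => ‖g p‖ₑ) t p ≤ ⊤) with h | h
  · refine le_of_tendsto (tendsto_iter hg h).enorm (Eventually.of_forall fun m => ?_)
    exact (dom_iter hg (le_refl m) t p).left.trans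
      (le_iSup (fun n => majIter (fun p => ‖g p‖ₑ) n t p) m)
  · rw [h]; exact le_top
  · refine le_of_tendsto (((tendsto_iter hg h).sub_const _).enorm.add_const _)
      (eventually_atTop.2 ⟨n, fun m hm => enorm_iter_sub_le hg hm t p⟩)
  · rw [h]; exact le_top

theorem enorm_sol_le (hg : Measurable g) (t : ℝ) (p : ℝ × ℝ) :
    ‖sol g t p‖ₑ ≤ majLim (fun p => ‖g p‖ₑ) t p := (dom_sol hg 0 t p).right

/-- The domination is applied to the pair formed by the `n`-th iterate and the limit: the distance
of their images is at most `majLim - majIter (n + 1)`, by `duhamelMaj_majLim_le`, and this tends to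
zero. -/
theorem sol_eq_duhamel (hg : Measurable g) {t : ℝ} {p : ℝ × ℝ}
    (h : majLim (fun p => ‖g p‖ₑ) t p < ⊤) : sol g t p = duhamel g (sol g) t p := by
  have h1 := (tendsto_iter hg h).comp (tendsto_add_atTop_nat 1)
  refine tendsto_nhds_unique h1 ?_
  rw [tendsto_iff_edist_tendsto_0]
  refine tendsto_of_tendsto_of_tendsto_of_le_of_le tendsto_const_nhds
    ((tendsto_majLim_sub h).comp (tendsto_add_atTop_nat 1)) (fun _ => zero_le) fun n => ?_
  have hd := (dom_duhamel (measurable_iter hg n) (measurable_sol hg)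
    (dom_sol hg n) g t p).sub.trans (duhamelMaj_majLim_le hg.enorm t p)
  simp only [Function.comp]
  rw [edist_comm, edist_eq_enorm_sub]
  exact ENNReal.le_sub_of_add_le_right
    ((le_iSup (fun n => majIter (fun p => ‖g p‖ₑ) n t p) (n + 1)).trans_lt h).ne hd

/-! ### Hermitian symmetry, which makes the solution real -/

section Symmetry

/-- The symmetry of Fourier transforms of real functions. -/
def Hermitian (f : ℝ × ℝ → ℂ) : Prop := ∀ p, f (-p) = starRingEnd ℂ (f p)

theorem Hermitian.rhoHat_neg {f : ℝ × ℝ → ℂ} (hf : Hermitian f) (t k : ℝ) :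
    rhoHat t f (-k) = starRingEnd ℂ (rhoHat t f k) := by
  unfold rhoHat
  rw [← integral_conj, ← integral_neg_eq_self]
  refine integral_congr_ae (Eventually.of_forall fun q => ?_)
  have : -q + (-k, t * -k) = -(q + (k, t * k)) := by
    ext <;> simp <;> ring
  have hf' : ∀ p, f (-p) = starRingEnd ℂ (f p) := hf
  simp only [this, hf', map_mul]

theorem fieldMult_neg (k : ℝ) : fieldMult (-k) = starRingEnd ℂ (fieldMult k) := by
  simp [fieldMult, map_ofNat]

theorem Hermitian.linSym {f : ℝ × ℝ → ℂ} (hf : Hermitian f) (t : ℝ) :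
    Hermitian (linSym t f) := fun q => by
  have h : (-q).2 - t * (-q).1 = -(q.2 - t * q.1) := by simp; ring
  unfold ScreenedVP.linSym
  rw [h, hf q]
  simp only [map_mul, Complex.conj_ofReal, Complex.conj_I, map_ofNat]
  push_cast
  ring

theorem Hermitian.nl {f : ℝ × ℝ → ℂ} (hf : Hermitian f) (t : ℝ) : Hermitian (nl t f) := fun p => by
  unfold ScreenedVP.nl
  rw [← integral_conj, ← integral_neg_eq_self]
  refine integral_congr_ae (Eventually.of_forall fun k => ?_)
  have : -p - (-k, t * -k) = -(p - (k, t * k)) := by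
    ext <;> simp <;> ring
  simp only [this, hf.linSym t _, hf.rhoHat_neg, fieldMult_neg, map_mul]

theorem hermitian_iter (hg : Hermitian g) (n : ℕ) (t : ℝ) : Hermitian (iter g n t) := by
  induction n generalizing t with
  | zero => intro p; simp [iter]
  | succ n ih =>
    intro p
    simp only [iter, duhamel, map_add, hg p, ← integral_conj, (ih _).nl _ p]

theorem Hermitian.enorm_neg {f : ℝ × ℝ → ℂ} (hf : Hermitian f) (p : ℝ × ℝ) : ‖f (-p)‖ₑ = ‖f p‖ₑ := by
  rw [hf p, ← ofReal_norm, ← ofReal_norm, RCLike.norm_conj]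

theorem nlMaj_neg {F : ℝ × ℝ → ℝ≥0∞} (hF : ∀ p, F (-p) = F p) (t : ℝ) (p : ℝ × ℝ) :
    nlMaj t F (-p) = nlMaj t F p := by
  have h1 : ∀ k, lineCorr F F t (-k) = lineCorr F F t k := fun k => by
    unfold lineCorr
    rw [← lintegral_neg_eq_self]
    refine lintegral_congr fun q => ?_
    have : -q + (-k, t * -k) = -(q + (k, t * k)) := by
      ext <;> simp <;> ring
    rw [this, hF, hF]
  have h2 : ∀ q, linMaj t F (-q) = linMaj t F q := fun q => by
    have : (-q).2 - t * (-q).1 = -(q.2 - t * q.1) := by simp; ring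
    simp only [linMaj, hF, this, abs_neg]
  unfold nlMaj
  rw [← lintegral_neg_eq_self]
  refine lintegral_congr fun k => ?_
  have h3 : -p - (-k, t * -k) = -(p - (k, t * k)) := by
    ext <;> simp <;> ring
  have h4 : ‖fieldMult (-k)‖ₑ = ‖fieldMult k‖ₑ := by simp [enorm_fieldMult]
  rw [h3, h2, h1, h4]

theorem majIter_neg {G : ℝ × ℝ → ℝ≥0∞} (hG : ∀ p, G (-p) = G p) (n : ℕ) (t : ℝ) (p : ℝ × ℝ) :
    majIter G n t (-p) = majIter G n t p := by
  induction n generalizing t p with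
  | zero => rfl
  | succ n ih => simp only [majIter, duhamelMaj, hG, fun s => nlMaj_neg (ih s) s p]

/-- The symmetry passes to the limit from the iterates; since the majorant limit is even, `p` and
`-p` fall into the same case of the definition of `sol`. -/
theorem hermitian_sol (hm : Measurable g) (hg : Hermitian g) (t : ℝ) : Hermitian (sol g t) := by
  intro p
  have h1 : majLim (fun p => ‖g p‖ₑ) t (-p) = majLim (fun p => ‖g p‖ₑ) t p := by
    unfold majLim
    simp only [majIter_neg (G := fun p => ‖g p‖ₑ) hg.enorm_neg]
  by_cases h : majLim (fun p => ‖g p‖ₑ) t p < ⊤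
  · have h2 := tendsto_iter hm (h1 ▸ h : majLim (fun p => ‖g p‖ₑ) t (-p) < ⊤)
    have h3 := (Complex.continuous_conj.tendsto _).comp (tendsto_iter hm h)
    refine tendsto_nhds_unique h2 (h3.congr fun n => ?_)
    exact (hermitian_iter hg n t p).symm
  · simp [sol, h1, h]

end Symmetry

/-! ### Plancherel's theorem for integrable square integrable functions -/

section Plancherel

open FourierTransform SchwartzMap

variable {E : Type*} [NormedAddCommGroup E] [InnerProductSpace ℝ E] [FiniteDimensional ℝ E]
  [MeasurableSpace E] [BorelSpace E]

theorem continuous_fourierInv {f : E → ℂ} (hf : Integrable f) : Continuous (𝓕⁻ f) := by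
  have h : 𝓕⁻ f = fun w => 𝓕 f (-w) := funext fun w => Real.fourierInv_eq_fourier_neg f w
  rw [h]
  exact (VectorFourier.fourierIntegral_continuous Real.continuous_fourierChar
    (L := innerₗ E) continuous_inner hf).comp continuous_neg

theorem integral_fourierInv_mul {f g : E → ℂ} (hf : Integrable f) (hg : Integrable g) :
    ∫ x, 𝓕⁻ f x * g x = ∫ x, f x * 𝓕⁻ g x := by
  have h := VectorFourier.integral_fourierIntegral_smul_eq_flip (μ := (volume : Measure E))
    (ν := (volume : Measure E)) (e := Real.fourierChar) (L := -innerₗ E)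
    Real.continuous_fourierChar (by simpa using! continuous_inner.neg) hf hg
  have e1 : ∀ u : E → ℂ, VectorFourier.fourierIntegral Real.fourierChar volume (-innerₗ E) u =
      𝓕⁻ u := fun u => by
    ext w
    simp [VectorFourier.fourierIntegral, Real.fourierInv_eq]
  have e2 : ∀ u : E → ℂ, VectorFourier.fourierIntegral Real.fourierChar volume
      (-innerₗ E).flip u = 𝓕⁻ u := fun u => by
    ext w
    simp [VectorFourier.fourierIntegral, Real.fourierInv_eq, real_inner_comm]
  simpa only [e1, e2, smul_eq_mul] using h

/-- The inverse transform on `L²` is not given by an integral, so it is compared with the integral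
by duality: both give the same pairing with every test function, the transform being moved onto the
test function on each side. -/
theorem fourierInv_toLp_ae_eq {f : E → ℂ} (hf : Integrable f) (hf2 : MemLp f 2) :
    (𝓕⁻ (hf2.toLp f) : Lp (α := E) ℂ 2) =ᵐ[volume] 𝓕⁻ f := by
  apply ae_eq_of_integral_contDiff_smul_eq
  · exact (Lp.memLp _).locallyIntegrable one_le_two
  · exact (continuous_fourierInv hf).locallyIntegrable
  · intro g g_smooth g_cpt
    have hg₁ : HasCompactSupport (Complex.ofRealCLM ∘ g) := g_cpt.comp_left rfl
    have hg₂ : ContDiff ℝ ∞ (Complex.ofRealCLM ∘ g) := by fun_prop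
    set ψ : 𝓢(E, ℂ) := hg₁.toSchwartzMap hg₂
    have hψ : ∀ x, ψ x = (g x : ℂ) := fun x => rfl
    have h1 := congrArg (fun T => T ψ)
      (Lp.fourierInv_toTemperedDistribution_eq (E := E) (F := ℂ) (hf2.toLp f))
    simp only [TemperedDistribution.fourierInv_apply, Lp.toTemperedDistribution_apply,
      smul_eq_mul] at h1
    calc ∫ x, g x • (𝓕⁻ (hf2.toLp f) : Lp ℂ 2 (volume : Measure E)) x
        = ∫ x, ψ x * (𝓕⁻ (hf2.toLp f) : Lp ℂ 2 (volume : Measure E)) x := by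
          simp only [hψ, Complex.real_smul]
      _ = ∫ x, (𝓕⁻ ψ) x * (hf2.toLp f) x := h1.symm
      _ = ∫ x, 𝓕⁻ (ψ : E → ℂ) x * f x := by
          refine integral_congr_ae ?_
          filter_upwards [hf2.coeFn_toLp] with x hx
          rw [hx, SchwartzMap.fourierInv_coe]
      _ = ∫ x, ψ x * 𝓕⁻ f x := integral_fourierInv_mul ψ.integrable hf
      _ = _ := by simp only [hψ, Complex.real_smul]

theorem eLpNorm_fourierInv_eq {f : E → ℂ} (hf : Integrable f) (hf2 : MemLp f 2) :
    eLpNorm (𝓕⁻ f) 2 = eLpNorm f 2 := by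
  rw [← eLpNorm_congr_ae (fourierInv_toLp_ae_eq hf hf2), ← Lp.enorm_def]
  have h := (Lp.fourierTransformₗᵢ E ℂ).symm.enorm_map (hf2.toLp f)
  rw [Lp.enorm_toLp] at h
  exact h

end Plancherel

/-! ### Functions with rapidly decaying Fourier transform -/

/-- The character `exp (2 π i θ)`. -/
def ech (θ : ℝ) : ℂ := Complex.exp ((2 * Real.pi * θ : ℝ) * Complex.I)

theorem norm_ech (θ : ℝ) : ‖ech θ‖ = 1 := Complex.norm_exp_ofReal_mul_I _

theorem continuous_ech : Continuous ech := by
  unfold ech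
  fun_prop

theorem measurable_ech : Measurable ech := continuous_ech.measurable

theorem ech_add (a b : ℝ) : ech (a + b) = ech a * ech b := by
  rw [ech, ech, ech, ← Complex.exp_add]
  congr 1
  push_cast
  ring

theorem conj_ech (a : ℝ) : starRingEnd ℂ (ech a) = ech (-a) := by
  rw [ech, ech, ← Complex.exp_conj]
  congr 1
  simp only [map_mul, Complex.conj_ofReal, Complex.conj_I]
  push_cast
  ring

theorem hasDerivAt_ech (θ : ℝ) : HasDerivAt ech (2 * Real.pi * Complex.I * ech θ) θ := by
  have h1 : HasDerivAt (fun θ : ℝ => ((2 * Real.pi * θ : ℝ) : ℂ) * Complex.I)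
      (2 * Real.pi * Complex.I) θ := by
    have := (((hasDerivAt_id θ).const_mul (2 * Real.pi)).ofReal_comp).mul_const Complex.I
    simpa using this
  have := h1.cexp
  unfold ech
  refine this.congr_deriv ?_
  ring

/-- The inverse Fourier transform on `ℝ × ℝ`. -/
def syn (b : ℝ × ℝ → ℂ) (z : ℝ × ℝ) : ℂ := ∫ p : ℝ × ℝ, ech (p.1 * z.1 + p.2 * z.2) * b p

section Syn

open FourierTransform

/-- The product `ℝ × ℝ` carries the supremum norm and is not an inner product space, so the Fourier
theory is applied on `WithLp 2` and transported back along the volume preserving identification. -/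
theorem fourierInv_prod_eq (b : ℝ × ℝ → ℂ) (z : ℝ × ℝ) :
    𝓕⁻ (fun w : WithLp 2 (ℝ × ℝ) => b w.ofLp) (WithLp.toLp 2 z) = syn b z := by
  rw [Real.fourierInv_eq', syn, ← (WithLp.volume_preserving_ofLp ℝ ℝ).integral_comp
    (MeasurableEquiv.toLp 2 (ℝ × ℝ)).symm.measurableEmbedding]
  refine integral_congr_ae (Eventually.of_forall fun w => ?_)
  simp only [smul_eq_mul, ech]
  congr 4
  simp [WithLp.prod_inner_apply]
  ring

theorem eLpNorm_comp_ofLp (f : ℝ × ℝ → ℂ) :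
    eLpNorm (fun w : WithLp 2 (ℝ × ℝ) => f w.ofLp) 2 volume = eLpNorm f 2 volume := by
  rw [eLpNorm_eq_l2, eLpNorm_eq_l2, l2, l2, ← (WithLp.volume_preserving_ofLp ℝ ℝ).lintegral_comp_emb
    (MeasurableEquiv.toLp 2 (ℝ × ℝ)).symm.measurableEmbedding]

theorem eLpNorm_syn_eq {b : ℝ × ℝ → ℂ} (hb : Integrable b) (hb2 : MemLp b 2) :
    eLpNorm (syn b) 2 volume = eLpNorm b 2 volume := by
  have hp := WithLp.volume_preserving_ofLp ℝ ℝ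
  have h1 : Integrable (fun w : WithLp 2 (ℝ × ℝ) => b w.ofLp) :=
    (hp.integrable_comp_emb (MeasurableEquiv.toLp 2 (ℝ × ℝ)).symm.measurableEmbedding).2 hb
  have h2 : MemLp (fun w : WithLp 2 (ℝ × ℝ) => b w.ofLp) 2 := hb2.comp_measurePreserving hp
  rw [← eLpNorm_comp_ofLp b, ← eLpNorm_fourierInv_eq h1 h2, ← eLpNorm_comp_ofLp (syn b)]
  congr 1
  ext w
  exact (fourierInv_prod_eq b w.ofLp).symm

end Syn

/-- Measurable functions all of whose moments are square integrable. -/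
structure Rapid (b : ℝ × ℝ → ℂ) : Prop where
  measurable : Measurable b
  sn_lt_top : ∀ n, sn (fun p => ‖b p‖ₑ) n < ⊤

/-- One weight per dimension: `lintegral_le_sobConst` in the second variable and then in the first.
-/
theorem lintegral_le_l2_weight {F : ℝ × ℝ → ℝ≥0∞} (hF : Measurable F) :
    ∫⁻ p, F p ≤ sobConst ^ 2 * l2 volume (fun p => (1 + rad p) * ((1 + rad p) * F p)) := by
  have hr := measurable_rad
  have hm : Measurable fun p => (1 + rad p) * F p := by fun_prop
  calc ∫⁻ p, F p = ∫⁻ x, ∫⁻ y, F (x, y) := by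
        rw [Measure.volume_eq_prod, lintegral_prod _ hF.aemeasurable]
    _ ≤ ∫⁻ x, sobConst * l2 volume (fun y => (1 + rad (x, y)) * F (x, y)) := by
        gcongr with x
        refine (lintegral_le_sobConst (by fun_prop)).trans ?_
        gcongr
        refine l2_mono fun y => ?_
        gcongr
        unfold rad
        gcongr
        exact le_max_right _ _
    _ = sobConst * ∫⁻ x, l2 volume (fun y => (1 + rad (x, y)) * F (x, y)) :=
        lintegral_const_mul _ (measurable_l2_fst hm)
    _ ≤ sobConst * (sobConst * l2 volume (fun p => (1 + rad p) * ((1 + rad p) * F p))) := by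
        gcongr
        exact lintegral_l2_fst_le hm
    _ = _ := by ring

theorem lintegral_rad_pow_le {F : ℝ × ℝ → ℝ≥0∞} (hF : Measurable F) (n : ℕ) :
    ∫⁻ p, rad p ^ n * F p ≤ sobConst ^ 2 * (sn F n + 2 * sn F (n + 1) + sn F (n + 2)) := by
  have hr := measurable_rad
  refine (lintegral_le_l2_weight (by fun_prop)).trans ?_
  gcongr
  unfold sn
  rw [← l2_const_mul _ 2 (by fun_prop)]
  refine le_trans (le_of_eq ?_) ((l2_add_le volume (by fun_prop) (by fun_prop)).trans
    (add_le_add (l2_add_le volume (by fun_prop) (by fun_prop)) le_rfl))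
  congr 1
  ext p
  ring

namespace Rapid

variable {b c : ℝ × ℝ → ℂ}

theorem lintegral_lt_top (hb : Rapid b) (n : ℕ) : ∫⁻ p, rad p ^ n * ‖b p‖ₑ < ⊤ := by
  refine (lintegral_rad_pow_le hb.measurable.enorm n).trans_lt ?_
  refine ENNReal.mul_lt_top (ENNReal.pow_lt_top sobConst_lt_top) ?_
  exact ENNReal.add_lt_top.2 ⟨ENNReal.add_lt_top.2 ⟨hb.sn_lt_top n,
    ENNReal.mul_lt_top (by simp) (hb.sn_lt_top _)⟩, hb.sn_lt_top _⟩

theorem integrable (hb : Rapid b) : Integrable b := by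
  refine ⟨hb.measurable.aestronglyMeasurable, ?_⟩
  simpa [HasFiniteIntegral] using hb.lintegral_lt_top 0

theorem memLp (hb : Rapid b) : MemLp b 2 := by
  refine ⟨hb.measurable.aestronglyMeasurable, ?_⟩
  rw [eLpNorm_eq_l2]
  simpa [sn] using hb.sn_lt_top 0

theorem of_le (hb : Rapid b) (hc : Measurable c) {C : ℝ≥0∞} (hC : C < ⊤) (m : ℕ)
    (h : ∀ p, ‖c p‖ₑ ≤ C * (rad p ^ m * ‖b p‖ₑ)) : Rapid c := by
  have hr := measurable_rad
  have hbm := hb.measurable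
  refine ⟨hc, fun n => lt_of_le_of_lt ?_ (ENNReal.mul_lt_top hC (hb.sn_lt_top (n + m)))⟩
  unfold sn
  rw [← l2_const_mul _ _ (by fun_prop)]
  refine l2_mono fun p => ?_
  calc _ ≤ rad p ^ n * (C * (rad p ^ m * ‖b p‖ₑ)) := by gcongr; exact h p
    _ = _ := by ring

end Rapid

/-- The symbol of `∂_x` applied to `b`. -/
def mulX (b : ℝ × ℝ → ℂ) (p : ℝ × ℝ) : ℂ := 2 * Real.pi * Complex.I * p.1 * b p

/-- The symbol of `∂_v` applied to `b`. -/
def mulV (b : ℝ × ℝ → ℂ) (p : ℝ × ℝ) : ℂ := 2 * Real.pi * Complex.I * p.2 * b p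

theorem enorm_mulX (b : ℝ × ℝ → ℂ) (p : ℝ × ℝ) :
    ‖mulX b p‖ₑ = ENNReal.ofReal (2 * Real.pi * |p.1|) * ‖b p‖ₑ := by
  rw [mulX, enorm_mul, ← ofReal_norm (2 * (Real.pi : ℂ) * Complex.I * p.1)]
  congr 2
  simp [abs_of_pos Real.pi_pos]

theorem enorm_mulV (b : ℝ × ℝ → ℂ) (p : ℝ × ℝ) :
    ‖mulV b p‖ₑ = ENNReal.ofReal (2 * Real.pi * |p.2|) * ‖b p‖ₑ := by
  rw [mulV, enorm_mul, ← ofReal_norm (2 * (Real.pi : ℂ) * Complex.I * p.2)]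
  congr 2
  simp [abs_of_pos Real.pi_pos]

theorem ofReal_fst_le_rad (p : ℝ × ℝ) : ENNReal.ofReal (2 * Real.pi * |p.1|) ≤ rad p := by
  unfold rad
  gcongr
  exact le_max_left _ _

theorem ofReal_snd_le_rad (p : ℝ × ℝ) : ENNReal.ofReal (2 * Real.pi * |p.2|) ≤ rad p := by
  unfold rad
  gcongr
  exact le_max_right _ _

theorem measurable_mulX {b : ℝ × ℝ → ℂ} (hb : Measurable b) : Measurable (mulX b) := by
  unfold mulX
  fun_prop

theorem measurable_mulV {b : ℝ × ℝ → ℂ} (hb : Measurable b) : Measurable (mulV b) := by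
  unfold mulV
  fun_prop

theorem Rapid.mulX {b : ℝ × ℝ → ℂ} (hb : Rapid b) : Rapid (mulX b) :=
  hb.of_le (measurable_mulX hb.measurable) ENNReal.one_lt_top 1 fun p => by
    rw [enorm_mulX, one_mul, pow_one]
    gcongr
    exact ofReal_fst_le_rad p

theorem Rapid.mulV {b : ℝ × ℝ → ℂ} (hb : Rapid b) : Rapid (mulV b) :=
  hb.of_le (measurable_mulV hb.measurable) ENNReal.one_lt_top 1 fun p => by
    rw [enorm_mulV, one_mul, pow_one]
    gcongr
    exact ofReal_snd_le_rad p

theorem Rapid.iterate_mul {b : ℝ × ℝ → ℂ} (hb : Rapid b) (i j : ℕ) :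
    Rapid (ScreenedVP.mulV^[j] (ScreenedVP.mulX^[i] b)) := by
  have h1 : Rapid (ScreenedVP.mulX^[i] b) := by
    induction i with
    | zero => exact hb
    | succ i ih => rw [Function.iterate_succ_apply']; exact ih.mulX
  induction j with
  | zero => exact h1
  | succ j ih => rw [Function.iterate_succ_apply']; exact ih.mulV

theorem iterate_mulX (b : ℝ × ℝ → ℂ) (i : ℕ) (p : ℝ × ℝ) :
    mulX^[i] b p = (2 * Real.pi * Complex.I * p.1) ^ i * b p := by
  induction i with
  | zero => simp
  | succ i ih => rw [Function.iterate_succ_apply', mulX, ih]; ring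

theorem iterate_mulV (b : ℝ × ℝ → ℂ) (j : ℕ) (p : ℝ × ℝ) :
    mulV^[j] b p = (2 * Real.pi * Complex.I * p.2) ^ j * b p := by
  induction j with
  | zero => simp
  | succ i ih => rw [Function.iterate_succ_apply', mulV, ih]; ring

theorem enorm_iterate_mul_eq (b : ℝ × ℝ → ℂ) (i j : ℕ) (p : ℝ × ℝ) :
    ‖mulV^[j] (mulX^[i] b) p‖ₑ = ENNReal.ofReal (2 * Real.pi * |p.1|) ^ i *
      ENNReal.ofReal (2 * Real.pi * |p.2|) ^ j * ‖b p‖ₑ := by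
  have h1 : ∀ i, ‖mulX^[i] b p‖ₑ = ENNReal.ofReal (2 * Real.pi * |p.1|) ^ i * ‖b p‖ₑ := fun i => by
    induction i with
    | zero => simp
    | succ i ih => rw [Function.iterate_succ_apply', enorm_mulX, ih]; ring
  induction j with
  | zero => simp [h1]
  | succ j ih => rw [Function.iterate_succ_apply', enorm_mulV, ih]; ring

theorem enorm_iterate_mul_le (b : ℝ × ℝ → ℂ) (i j : ℕ) (p : ℝ × ℝ) :
    ‖mulV^[j] (mulX^[i] b) p‖ₑ ≤ rad p ^ (i + j) * ‖b p‖ₑ := by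
  rw [enorm_iterate_mul_eq, pow_add]
  gcongr
  · exact ofReal_fst_le_rad p
  · exact ofReal_snd_le_rad p

/-- Differentiation under the integral, dominated by a first moment. `α` is the frequency dual to
the variable that moves and `β` collects the rest of the phase, so that both partial derivatives are
instances. -/
theorem hasDerivAt_integral_ech {b : ℝ × ℝ → ℂ} (hb : Rapid b) {α β : ℝ × ℝ → ℝ}
    (hα : Measurable α) (hβ : Measurable β)
    (hα' : ∀ p, ENNReal.ofReal (2 * Real.pi * |α p|) ≤ rad p) (x : ℝ) :
    HasDerivAt (fun y => ∫ p, ech (α p * y + β p) * b p)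
      (∫ p, ech (α p * x + β p) * (2 * Real.pi * Complex.I * α p * b p)) x := by
  have hbm := hb.measurable
  have hem := measurable_ech
  have hn : ∀ p, ‖2 * Real.pi * Complex.I * α p * b p‖ₑ ≤ rad p ^ 1 * ‖b p‖ₑ := fun p => by
    rw [enorm_mul, pow_one]
    gcongr
    refine le_trans (le_of_eq ?_) (hα' p)
    rw [← ofReal_norm]
    congr 1
    simp [abs_of_pos Real.pi_pos]
  have hi : Integrable fun p => 2 * Real.pi * Complex.I * α p * b p :=
    ⟨by fun_prop, (lintegral_mono hn).trans_lt (hb.lintegral_lt_top 1)⟩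
  refine (hasDerivAt_integral_of_dominated_loc_of_deriv_le
    (F := fun y p => ech (α p * y + β p) * b p)
    (F' := fun y p => ech (α p * y + β p) * (2 * Real.pi * Complex.I * α p * b p))
    (bound := fun p => ‖2 * Real.pi * Complex.I * α p * b p‖) (x₀ := x) univ_mem ?_ ?_ ?_ ?_
    hi.norm ?_).2
  · exact Eventually.of_forall fun y => by fun_prop
  · exact hb.integrable.bdd_mul (c := 1) (hem.comp (by fun_prop)).aestronglyMeasurable
      (Eventually.of_forall fun p => (norm_ech _).le)
  · fun_prop
  · exact Eventually.of_forall fun p y _ => by rw [norm_mul, norm_ech, one_mul]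
  · refine Eventually.of_forall fun p y _ => ?_
    have h1 : HasDerivAt (fun y => α p * y + β p) (α p) y := by
      simpa using ((hasDerivAt_id y).const_mul (α p)).add_const (β p)
    have h2 := ((hasDerivAt_ech (α p * y + β p)).scomp y h1).mul_const (b p)
    refine h2.congr_deriv ?_
    simp only [Complex.real_smul]
    ring

theorem hasDerivAt_syn_fst {b : ℝ × ℝ → ℂ} (hb : Rapid b) (x v : ℝ) :
    HasDerivAt (fun y => syn b (y, v)) (syn (mulX b) (x, v)) x :=
  hasDerivAt_integral_ech hb (α := fun p => p.1) (β := fun p => p.2 * v) (by fun_prop)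
    (by fun_prop) ofReal_fst_le_rad x

theorem hasDerivAt_syn_snd {b : ℝ × ℝ → ℂ} (hb : Rapid b) (x v : ℝ) :
    HasDerivAt (fun w => syn b (x, w)) (syn (mulV b) (x, v)) v := by
  have := hasDerivAt_integral_ech hb (α := fun p => p.2) (β := fun p => p.1 * x) (by fun_prop)
    (by fun_prop) ofReal_snd_le_rad v
  simpa only [syn, mulV, add_comm] using this

theorem contDiff_syn {b : ℝ × ℝ → ℂ} (hb : Rapid b) : ContDiff ℝ ∞ (syn b) := by
  -- The general Fourier integral has phase `-L`, so the minus sign makes it the inverse transform.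
  let L : ℝ × ℝ →L[ℝ] ℝ × ℝ →L[ℝ] ℝ :=
    -((ContinuousLinearMap.mul ℝ ℝ).bilinearComp (ContinuousLinearMap.fst ℝ ℝ ℝ)
        (ContinuousLinearMap.fst ℝ ℝ ℝ) +
      (ContinuousLinearMap.mul ℝ ℝ).bilinearComp (ContinuousLinearMap.snd ℝ ℝ ℝ)
        (ContinuousLinearMap.snd ℝ ℝ ℝ))
  have h : syn b = VectorFourier.fourierIntegral Real.fourierChar volume L.toLinearMap₁₂ b := by
    ext z
    simp only [syn, VectorFourier.fourierIntegral]
    refine integral_congr_ae (Eventually.of_forall fun p => ?_)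
    have hL : -L p z = p.1 * z.1 + p.2 * z.2 := by simp [L]
    have hL' : -(L.toLinearMap₁₂ p) z = p.1 * z.1 + p.2 * z.2 := hL
    simp only [hL', Circle.smul_def, Real.fourierChar_apply, smul_eq_mul, ech]
  rw [h]
  refine VectorFourier.contDiff_fourierIntegral (N := ⊤) L fun n _ => ?_
  have hbm := hb.measurable
  refine ⟨by fun_prop, ?_⟩
  refine lt_of_le_of_lt (lintegral_mono fun p => ?_) (hb.lintegral_lt_top n)
  rw [enorm_mul, enorm_pow, enorm_norm, enorm_norm]
  gcongr
  rw [← ofReal_norm, rad]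
  apply ENNReal.ofReal_le_ofReal
  nlinarith [norm_nonneg p, Real.pi_gt_three]

/-- The real part of the inverse Fourier transform. -/
def rsyn (b : ℝ × ℝ → ℂ) (z : ℝ × ℝ) : ℝ := (syn b z).re

theorem contDiff_rsyn {b : ℝ × ℝ → ℂ} (hb : Rapid b) : ContDiff ℝ ∞ (rsyn b) :=
  Complex.reCLM.contDiff.comp (contDiff_syn hb)

theorem hasDerivAt_rsyn_fst {b : ℝ × ℝ → ℂ} (hb : Rapid b) (x v : ℝ) :
    HasDerivAt (fun y => rsyn b (y, v)) (rsyn (mulX b) (x, v)) x :=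
  (Complex.reCLM.hasFDerivAt.comp_hasDerivAt x (hasDerivAt_syn_fst hb x v))

theorem hasDerivAt_rsyn_snd {b : ℝ × ℝ → ℂ} (hb : Rapid b) (x v : ℝ) :
    HasDerivAt (fun w => rsyn b (x, w)) (rsyn (mulV b) (x, v)) v :=
  (Complex.reCLM.hasFDerivAt.comp_hasDerivAt v (hasDerivAt_syn_snd hb x v))

theorem dx_rsyn {b : ℝ × ℝ → ℂ} (hb : Rapid b) : dx (rsyn b) = rsyn (mulX b) :=
  funext fun p => (hasDerivAt_rsyn_fst hb p.1 p.2).deriv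

theorem dv_rsyn {b : ℝ × ℝ → ℂ} (hb : Rapid b) : dv (rsyn b) = rsyn (mulV b) :=
  funext fun p => (hasDerivAt_rsyn_snd hb p.1 p.2).deriv

theorem iterate_deriv_rsyn {b : ℝ × ℝ → ℂ} (hb : Rapid b) (i j : ℕ) :
    dv^[j] (dx^[i] (rsyn b)) = rsyn (mulV^[j] (mulX^[i] b)) := by
  have h1 : dx^[i] (rsyn b) = rsyn (mulX^[i] b) := by
    induction i with
    | zero => rfl
    | succ i ih =>
      rw [Function.iterate_succ_apply', Function.iterate_succ_apply', ih]
      exact dx_rsyn (hb.iterate_mul i 0)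
  rw [h1]
  induction j with
  | zero => rfl
  | succ j ih =>
    rw [Function.iterate_succ_apply', Function.iterate_succ_apply', ih]
    exact dv_rsyn (hb.iterate_mul i j)

/-! ### Weak derivatives of smooth functions -/

section Weak

variable {f ψ : ℝ × ℝ → ℝ}

theorem dx_eq_fderiv (hf : Differentiable ℝ f) : dx f = fun p => fderiv ℝ f p (1, 0) := by
  ext ⟨x, v⟩
  have h1 : HasDerivAt (fun y : ℝ => (y, v)) ((1, 0) : ℝ × ℝ) x :=
    (hasDerivAt_id x).prodMk (hasDerivAt_const x v)
  exact ((hf (x, v)).hasFDerivAt.comp_hasDerivAt x h1).deriv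

theorem dv_eq_fderiv (hf : Differentiable ℝ f) : dv f = fun p => fderiv ℝ f p (0, 1) := by
  ext ⟨x, v⟩
  have h1 : HasDerivAt (fun w : ℝ => (x, w)) ((0, 1) : ℝ × ℝ) v :=
    (hasDerivAt_const v x).prodMk (hasDerivAt_id v)
  exact ((hf (x, v)).hasFDerivAt.comp_hasDerivAt v h1).deriv

theorem differentiable_of_smooth (hf : ContDiff ℝ ∞ f) : Differentiable ℝ f :=
  hf.differentiable (by simp)

theorem contDiff_dx (hf : ContDiff ℝ ∞ f) : ContDiff ℝ ∞ (dx f) := by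
  rw [dx_eq_fderiv (differentiable_of_smooth hf)]
  exact (hf.fderiv_right (m := ∞) (by simp)).clm_apply contDiff_const

theorem contDiff_dv (hf : ContDiff ℝ ∞ f) : ContDiff ℝ ∞ (dv f) := by
  rw [dv_eq_fderiv (differentiable_of_smooth hf)]
  exact (hf.fderiv_right (m := ∞) (by simp)).clm_apply contDiff_const

theorem contDiff_iterate_dx (hf : ContDiff ℝ ∞ f) (i : ℕ) : ContDiff ℝ ∞ (dx^[i] f) := by
  induction i with
  | zero => exact hf
  | succ i ih => rw [Function.iterate_succ_apply']; exact contDiff_dx ih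

theorem contDiff_iterate_dv (hf : ContDiff ℝ ∞ f) (i : ℕ) : ContDiff ℝ ∞ (dv^[i] f) := by
  induction i with
  | zero => exact hf
  | succ i ih => rw [Function.iterate_succ_apply']; exact contDiff_dv ih

theorem hasCompactSupport_dx (hf : ContDiff ℝ ∞ f) (h : HasCompactSupport f) :
    HasCompactSupport (dx f) := by
  rw [dx_eq_fderiv (differentiable_of_smooth hf)]
  exact h.fderiv_apply ℝ _

theorem hasCompactSupport_dv (hf : ContDiff ℝ ∞ f) (h : HasCompactSupport f) :
    HasCompactSupport (dv f) := by
  rw [dv_eq_fderiv (differentiable_of_smooth hf)]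
  exact h.fderiv_apply ℝ _

theorem hasCompactSupport_iterate_dv (hf : ContDiff ℝ ∞ f) (h : HasCompactSupport f) (j : ℕ) :
    HasCompactSupport (dv^[j] f) := by
  induction j with
  | zero => exact h
  | succ j ih =>
    rw [Function.iterate_succ_apply']
    exact hasCompactSupport_dv (contDiff_iterate_dv hf j) ih

theorem integral_mul_fderiv_eq_neg (hf : ContDiff ℝ ∞ f) (hψ : ContDiff ℝ ∞ ψ)
    (hc : HasCompactSupport ψ) (w : ℝ × ℝ) :
    ∫ p, f p * fderiv ℝ ψ p w = -∫ p, fderiv ℝ f p w * ψ p := by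
  have hf' : Continuous fun p => fderiv ℝ f p w :=
    ((hf.fderiv_right (m := ∞) (by simp)).clm_apply contDiff_const).continuous
  have hψ' : Continuous fun p => fderiv ℝ ψ p w :=
    ((hψ.fderiv_right (m := ∞) (by simp)).clm_apply contDiff_const).continuous
  exact integral_mul_fderiv_eq_neg_fderiv_mul_of_integrable
    ((hf'.mul hψ.continuous).integrable_of_hasCompactSupport hc.mul_left)
    ((hf.continuous.mul hψ').integrable_of_hasCompactSupport (hc.fderiv_apply ℝ w).mul_left)
    ((hf.continuous.mul hψ.continuous).integrable_of_hasCompactSupport hc.mul_left)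
    (fun x _ => differentiable_of_smooth hf x) (fun x _ => differentiable_of_smooth hψ x)

theorem integral_mul_dx (hf : ContDiff ℝ ∞ f) (hψ : ContDiff ℝ ∞ ψ) (hc : HasCompactSupport ψ) :
    ∫ p, f p * dx ψ p = -∫ p, dx f p * ψ p := by
  rw [dx_eq_fderiv (differentiable_of_smooth hf), dx_eq_fderiv (differentiable_of_smooth hψ)]
  exact integral_mul_fderiv_eq_neg hf hψ hc _

theorem integral_mul_dv (hf : ContDiff ℝ ∞ f) (hψ : ContDiff ℝ ∞ ψ) (hc : HasCompactSupport ψ) :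
    ∫ p, f p * dv ψ p = -∫ p, dv f p * ψ p := by
  rw [dv_eq_fderiv (differentiable_of_smooth hf), dv_eq_fderiv (differentiable_of_smooth hψ)]
  exact integral_mul_fderiv_eq_neg hf hψ hc _

theorem isWeakDeriv_of_smooth (hf : ContDiff ℝ ∞ f) (i j : ℕ) :
    IsWeakDeriv i j f (dv^[j] (dx^[i] f)) := by
  refine ⟨hf.continuous.locallyIntegrable,
    (contDiff_iterate_dv (contDiff_iterate_dx hf i) j).continuous.locallyIntegrable, ?_⟩
  have hv : ∀ (j : ℕ) (f : ℝ × ℝ → ℝ), ContDiff ℝ ∞ f → ∀ ψ : ℝ × ℝ → ℝ, ContDiff ℝ ∞ ψ →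
      HasCompactSupport ψ → ∫ p, f p * (dv^[j] ψ) p = (-1) ^ j * ∫ p, (dv^[j] f) p * ψ p := by
    intro j
    induction j with
    | zero => simp
    | succ j ih =>
      intro f hf ψ hψ hc
      rw [Function.iterate_succ_apply', integral_mul_dv hf (contDiff_iterate_dv hψ j)
        (hasCompactSupport_iterate_dv hψ hc j), ih _ (contDiff_dv hf) ψ hψ hc,
        Function.iterate_succ_apply]
      ring
  have hx : ∀ (i : ℕ) (f : ℝ × ℝ → ℝ), ContDiff ℝ ∞ f → ∀ ψ : ℝ × ℝ → ℝ, ContDiff ℝ ∞ ψ →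
      HasCompactSupport ψ → ∫ p, f p * (dx^[i] ψ) p = (-1) ^ i * ∫ p, (dx^[i] f) p * ψ p := by
    intro i
    induction i with
    | zero => simp
    | succ i ih =>
      intro f hf ψ hψ hc
      rw [Function.iterate_succ_apply, ih f hf _ (contDiff_dx hψ) (hasCompactSupport_dx hψ hc),
        integral_mul_dx (contDiff_iterate_dx hf i) hψ hc, Function.iterate_succ_apply']
      ring
  intro ψ hψ hc
  rw [hx i f hf _ (contDiff_iterate_dv hψ j) (hasCompactSupport_iterate_dv hψ hc j),
    hv j _ (contDiff_iterate_dx hf i) ψ hψ hc]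
  ring

theorem derivNorm_le_of_smooth (hf : ContDiff ℝ ∞ f) (i j : ℕ) :
    derivNorm i j f ≤ eLpNorm (dv^[j] (dx^[i] f)) 2 volume :=
  iInf₂_le _ (isWeakDeriv_of_smooth hf i j)

theorem IsWeakDeriv.ae_eq {i j : ℕ} {g : ℝ × ℝ → ℝ} (hf : ContDiff ℝ ∞ f)
    (hg : IsWeakDeriv i j f g) : g =ᵐ[volume] dv^[j] (dx^[i] f) := by
  have h := isWeakDeriv_of_smooth hf i j
  apply ae_eq_of_integral_contDiff_smul_eq hg.locallyIntegrable_deriv h.locallyIntegrable_deriv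
  intro ψ hψ hc
  have h1 := (hg.integral_eq ψ hψ hc).symm.trans (h.integral_eq ψ hψ hc)
  have h2 := mul_left_cancel₀ (pow_ne_zero _ (by norm_num)) h1
  simpa only [smul_eq_mul, mul_comm] using h2

theorem derivNorm_eq_of_smooth (hf : ContDiff ℝ ∞ f) (i j : ℕ) :
    derivNorm i j f = eLpNorm (dv^[j] (dx^[i] f)) 2 volume := by
  refine le_antisymm (derivNorm_le_of_smooth hf i j) (le_iInf₂ fun g hg => ?_)
  rw [eLpNorm_congr_ae (hg.ae_eq hf)]

end Weak

theorem eLpNorm_rsyn_le {b : ℝ × ℝ → ℂ} (hb : Rapid b) :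
    eLpNorm (rsyn b) 2 volume ≤ eLpNorm b 2 volume := by
  rw [← eLpNorm_syn_eq hb.integrable hb.memLp]
  exact eLpNorm_mono fun z => Complex.abs_re_le_norm (syn b z)

theorem derivNorm_rsyn_le {b : ℝ × ℝ → ℂ} (hb : Rapid b) (i j : ℕ) :
    derivNorm i j (rsyn b) ≤ sn (fun p => ‖b p‖ₑ) (i + j) := by
  refine (derivNorm_le_of_smooth (contDiff_rsyn hb) i j).trans ?_
  rw [iterate_deriv_rsyn hb]
  refine (eLpNorm_rsyn_le (hb.iterate_mul i j)).trans ?_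
  rw [eLpNorm_eq_l2]
  exact l2_mono fun p => enorm_iterate_mul_le b i j p

/-- Each of the four energies is at most `gen` of `en`: by Plancherel a derivative costs at most a
factor of the length of the frequency, and the additional derivative for `a = 1` is absorbed by the
weight `1 + rad` in `en`. -/
theorem totalEnergy_rsyn_le {b : ℝ × ℝ → ℂ} (hb : Rapid b) (lam : ℝ) :
    totalEnergy lam (rsyn b) ≤ 4 * gen lam (en fun p => ‖b p‖ₑ) := by
  have h : ∀ n, ∀ a ∈ Finset.range 2, sn (fun p => ‖b p‖ₑ) (n + a) ≤ en (fun p => ‖b p‖ₑ) n :=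
    fun n a ha => by
      have : a = 0 ∨ a = 1 := by
        have := Finset.mem_range.1 ha
        omega
      rcases this with rfl | rfl
      · exact sn_le_en _ n
      · exact sn_succ_le_en _ n
  have hx : ∀ a ∈ Finset.range 2, energyX lam a (rsyn b) ≤ gen lam (en fun p => ‖b p‖ₑ) :=
    fun a ha => gen_mono (u := fun n => derivNorm (n + a) 0 (rsyn b)) fun n =>
      (derivNorm_rsyn_le hb (n + a) 0).trans (h n a ha)
  have hv : ∀ a ∈ Finset.range 2, energyV lam a (rsyn b) ≤ gen lam (en fun p => ‖b p‖ₑ) :=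
    fun a ha => gen_mono (u := fun n => derivNorm 0 (n + a) (rsyn b)) fun n =>
      (derivNorm_rsyn_le hb 0 (n + a)).trans (by rw [zero_add]; exact h n a ha)
  calc totalEnergy lam (rsyn b) ≤ ∑ a ∈ Finset.range 2,
        (gen lam (en fun p => ‖b p‖ₑ) + gen lam (en fun p => ‖b p‖ₑ)) :=
        Finset.sum_le_sum fun a ha => add_le_add (hx a ha) (hv a ha)
    _ = _ := by
        simp only [Finset.sum_const, Finset.card_range, nsmul_eq_mul]
        push_cast
        ring

/-! ### The Fourier transform of the initial value -/

section Cutoff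

variable {f g u : ℝ × ℝ → ℝ}

/-- Cutoffs `χ (c p)` with `c → 0` extend the weak derivative identity from compactly supported to
square integrable test functions: the derivative falling on the cutoff is of size `c`, and the
remaining terms converge dominatedly. Schwartz functions are thereby admitted. -/
theorem integral_mul_fderiv_eq_neg_of_weak (hf : MemLp f 2) (hg : MemLp g 2) (w : ℝ × ℝ)
    (h : ∀ ψ : ℝ × ℝ → ℝ, ContDiff ℝ ∞ ψ → HasCompactSupport ψ →
      ∫ p, f p * fderiv ℝ ψ p w = -∫ p, g p * ψ p)
    (hu : ContDiff ℝ ∞ u) (hu2 : MemLp u 2) (hu2' : MemLp (fun p => fderiv ℝ u p w) 2) :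
    ∫ p, f p * fderiv ℝ u p w = -∫ p, g p * u p := by
  let χ : ContDiffBump (0 : ℝ × ℝ) := ⟨1, 2, one_pos, one_lt_two⟩
  have hχ : ContDiff ℝ ∞ χ := χ.contDiff
  have hχc : HasCompactSupport χ := χ.hasCompactSupport
  have hχ'c : Continuous fun p => fderiv ℝ χ p w :=
    ((hχ.fderiv_right (m := ∞) (by simp)).clm_apply contDiff_const).continuous
  obtain ⟨C, hC⟩ := (hχc.fderiv_apply ℝ w).exists_bound_of_continuous hχ'c
  let c : ℕ → ℝ := fun n => ((n : ℝ) + 1)⁻¹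
  have hc0 : ∀ n, 0 ≤ c n := fun n => by positivity
  have hc1 : ∀ n, c n ≤ 1 := fun n => inv_le_one_of_one_le₀ (by linarith [n.cast_nonneg (α := ℝ)])
  have hclim : Tendsto c atTop (𝓝 0) := tendsto_one_div_add_atTop_nhds_zero_nat.congr fun n => by
    simp [c]
  let X : ℕ → ℝ × ℝ → ℝ := fun n p => χ (c n • p)
  have hX : ∀ n, ContDiff ℝ ∞ (X n) := fun n => hχ.comp (contDiff_id.const_smul (c n))
  have hXc : ∀ n, HasCompactSupport (X n) := fun n => by
    have : c n ≠ 0 := by positivity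
    exact hχc.comp_homeomorph (Homeomorph.smulOfNeZero (c n) this)
  have hX1 : ∀ n p, |X n p| ≤ 1 := fun n p => by
    rw [abs_of_nonneg χ.nonneg]
    exact χ.le_one
  have hX' : ∀ n p, fderiv ℝ (X n) p w = c n * fderiv ℝ χ (c n • p) w := fun n p => by
    have h1 : HasFDerivAt (fun p : ℝ × ℝ => c n • p) (c n • ContinuousLinearMap.id ℝ (ℝ × ℝ)) p :=
      (hasFDerivAt_id p).const_smul (c n)
    have h2 := (((differentiable_of_smooth hχ) (c n • p)).hasFDerivAt.comp p h1).fderiv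
    have h3 : X n = χ ∘ fun p => c n • p := rfl
    rw [h3, h2]
    simp
  have hprod : ∀ n p, fderiv ℝ (fun p => X n p * u p) p w =
      X n p * fderiv ℝ u p w + c n * fderiv ℝ χ (c n • p) w * u p := fun n p => by
    have := fderiv_fun_mul (differentiable_of_smooth (hX n) p) (differentiable_of_smooth hu p)
    rw [this]
    simp only [add_apply, smul_apply, smul_eq_mul, hX']
    ring
  have hXlim : ∀ p, Tendsto (fun n => X n p) atTop (𝓝 1) := fun p => by
    have h0 : Tendsto (fun n => c n • p) atTop (𝓝 0) := by
      simpa using hclim.smul_const p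
    have := (hχ.continuous.tendsto 0).comp h0
    rwa [show χ 0 = 1 from χ.one_of_mem_closedBall (by simp [χ])] at this
  have hfu : Integrable fun p => f p * fderiv ℝ u p w := hf.integrable_mul hu2'
  have hfu' : Integrable fun p => f p * u p := hf.integrable_mul hu2
  have hgu : Integrable fun p => g p * u p := hg.integrable_mul hu2
  have hXm : ∀ n, AEStronglyMeasurable (X n) := fun n => (hX n).continuous.aestronglyMeasurable
  have hχ'm : ∀ n, AEStronglyMeasurable fun p => fderiv ℝ χ (c n • p) w := fun n =>
    (hχ'c.comp (continuous_const_smul (c n))).aestronglyMeasurable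
  have L : Tendsto (fun n => ∫ p, f p * fderiv ℝ (fun p => X n p * u p) p w) atTop
      (𝓝 (∫ p, f p * fderiv ℝ u p w)) := by
    refine tendsto_integral_of_dominated_convergence
      (fun p => ‖f p * fderiv ℝ u p w‖ + C * ‖f p * u p‖) (fun n => ?_)
      (hfu.norm.add (hfu'.norm.const_mul C)) (fun n => Eventually.of_forall fun p => ?_)
      (Eventually.of_forall fun p => ?_)
    · simp only [hprod]
      exact hf.1.mul (((hXm n).mul hu2'.1).add (((hχ'm n).const_mul (c n)).mul hu2.1))
    · rw [hprod]
      calc ‖f p * (X n p * fderiv ℝ u p w + c n * fderiv ℝ χ (c n • p) w * u p)‖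
          = ‖X n p * (f p * fderiv ℝ u p w) + c n * fderiv ℝ χ (c n • p) w * (f p * u p)‖ := by
            congr 1; ring
        _ ≤ ‖X n p‖ * ‖f p * fderiv ℝ u p w‖ +
            ‖c n‖ * ‖fderiv ℝ χ (c n • p) w‖ * ‖f p * u p‖ := by
            refine (norm_add_le _ _).trans ?_
            simp only [norm_mul]
            exact le_rfl
        _ ≤ 1 * ‖f p * fderiv ℝ u p w‖ + 1 * C * ‖f p * u p‖ := by
            gcongr
            · exact hX1 n p
            · rw [Real.norm_of_nonneg (hc0 n)]; exact hc1 n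
            · exact hC _
        _ = _ := by ring
    · simp only [hprod]
      have h1 : Tendsto (fun n => c n * fderiv ℝ χ (c n • p) w) atTop (𝓝 0) := by
        refine squeeze_zero_norm (a := fun n => c n * C) (fun n => ?_) (by simpa using hclim.mul_const C)
        rw [norm_mul, Real.norm_of_nonneg (hc0 n)]
        exact mul_le_mul_of_nonneg_left (hC _) (hc0 n)
      have h2 := (((hXlim p).mul_const (fderiv ℝ u p w)).add (h1.mul_const (u p))).const_mul (f p)
      simpa using h2
  have Rr : Tendsto (fun n => -∫ p, g p * (X n p * u p)) atTop (𝓝 (-∫ p, g p * u p)) := by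
    refine (tendsto_integral_of_dominated_convergence
      (fun p => ‖g p * u p‖) (fun n => ?_)
      hgu.norm (fun n => Eventually.of_forall fun p => ?_)
      (Eventually.of_forall fun p => ?_)).neg
    · exact hg.1.mul ((hXm n).mul hu2.1)
    · rw [mul_left_comm, norm_mul]
      exact mul_le_of_le_one_left (norm_nonneg _) (hX1 n p)
    · simpa using ((hXlim p).mul_const (u p)).const_mul (g p)
  refine tendsto_nhds_unique L (Rr.congr fun n => ?_)
  exact (h (fun p => X n p * u p) ((hX n).mul hu) ((hXc n).mul_right)).symm

end Cutoff

section Transform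

open FourierTransform SchwartzMap LineDeriv

/-- The space `ℝ × ℝ` with its Euclidean structure. -/
abbrev Plane := WithLp 2 (ℝ × ℝ)

theorem memLp_plane {f : ℝ × ℝ → ℝ} (hf : MemLp f 2) :
    MemLp (fun w : Plane => (f w.ofLp : ℂ)) 2 :=
  (hf.comp_measurePreserving (WithLp.volume_preserving_ofLp ℝ ℝ)).ofReal

/-- The Fourier transform on `L²(ℝ × ℝ)`. -/
def fourierL2 (f : ℝ × ℝ → ℝ) (hf : MemLp f 2) (p : ℝ × ℝ) : ℂ :=
  (𝓕 ((memLp_plane hf).toLp (fun w : Plane => (f w.ofLp : ℂ))) : Lp ℂ 2 (volume : Measure Plane))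
    (WithLp.toLp 2 p)

theorem measurable_fourierL2 (f : ℝ × ℝ → ℝ) (hf : MemLp f 2) : Measurable (fourierL2 f hf) :=
  (Lp.stronglyMeasurable _).measurable.comp (WithLp.volume_preserving_toLp ℝ ℝ).measurable

theorem integral_plane (f : Plane → ℝ) : ∫ w, f w = ∫ p : ℝ × ℝ, f (WithLp.toLp 2 p) :=
  ((WithLp.volume_preserving_toLp ℝ ℝ).integral_comp
    (MeasurableEquiv.toLp 2 (ℝ × ℝ)).measurableEmbedding f).symm

theorem ae_plane {P : Plane → Prop} (h : ∀ᵐ w, P w) : ∀ᵐ p : ℝ × ℝ, P (WithLp.toLp 2 p) :=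
  (WithLp.volume_preserving_toLp ℝ ℝ).quasiMeasurePreserving.ae h

theorem eLpNorm_fourierL2 (f : ℝ × ℝ → ℝ) (hf : MemLp f 2) :
    eLpNorm (fourierL2 f hf) 2 volume = eLpNorm f 2 volume := by
  set U : Lp ℂ 2 (volume : Measure Plane) :=
    𝓕 ((memLp_plane hf).toLp (fun w : Plane => (f w.ofLp : ℂ))) with hU
  have h1 : eLpNorm (fourierL2 f hf) 2 volume = eLpNorm U 2 volume :=
    eLpNorm_comp_measurePreserving (Lp.aestronglyMeasurable U) (WithLp.volume_preserving_toLp ℝ ℝ)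
  rw [h1, ← Lp.enorm_def, hU]
  refine ((Lp.fourierTransformₗᵢ Plane ℂ).enorm_map _).trans ?_
  rw [Lp.enorm_toLp]
  have h2 := eLpNorm_comp_ofLp (fun p => (f p : ℂ))
  refine h2.trans (eLpNorm_congr_norm_ae (Eventually.of_forall fun p => ?_))
  simp

theorem syn_fourierL2 (f : ℝ × ℝ → ℝ) (hf : MemLp f 2) (hi : Integrable (fourierL2 f hf)) :
    syn (fourierL2 f hf) =ᵐ[volume] fun p => (f p : ℂ) := by
  set F := (memLp_plane hf).toLp (fun w : Plane => (f w.ofLp : ℂ)) with hF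
  set U : Lp ℂ 2 (volume : Measure Plane) := 𝓕 F with hU
  have hUi : Integrable (U : Plane → ℂ) :=
    ((WithLp.volume_preserving_toLp ℝ ℝ).integrable_comp_emb
      (MeasurableEquiv.toLp 2 (ℝ × ℝ)).measurableEmbedding).1 hi
  have h1 := fourierInv_toLp_ae_eq hUi (Lp.memLp U)
  rw [Lp.toLp_coeFn, hU, fourierInv_fourier_eq] at h1
  have h2 : ∀ᵐ w : Plane, (f w.ofLp : ℂ) = 𝓕⁻ (U : Plane → ℂ) w := by
    filter_upwards [h1, (memLp_plane hf).coeFn_toLp] with w hw hw'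
    rw [← hw', ← hw]
  filter_upwards [ae_plane h2] with p hp
  rw [hp, ← fourierInv_prod_eq]
  rfl

/-- The weak derivative is a derivative of tempered distributions, whose Fourier transform is
multiplication by the symbol; testing identifies the two sides as functions almost everywhere. -/
theorem fourierL2_weak {f g : ℝ × ℝ → ℝ} (hf : MemLp f 2) (hg : MemLp g 2) (w : ℝ × ℝ)
    (h : ∀ ψ : ℝ × ℝ → ℝ, ContDiff ℝ ∞ ψ → HasCompactSupport ψ →
      ∫ p, f p * fderiv ℝ ψ p w = -∫ p, g p * ψ p) :
    fourierL2 g hg =ᵐ[volume]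
      fun p => 2 * Real.pi * Complex.I * (p.1 * w.1 + p.2 * w.2 : ℝ) * fourierL2 f hf p := by
  set F := (memLp_plane hf).toLp (fun w : Plane => (f w.ofLp : ℂ)) with hF
  set G := (memLp_plane hg).toLp (fun w : Plane => (g w.ofLp : ℂ)) with hG
  set m : Plane := WithLp.toLp 2 w with hm
  let ι : (ℝ × ℝ) →L[ℝ] Plane := (WithLp.prodContinuousLinearEquiv 2 ℝ ℝ ℝ).symm
  -- The extended identity moved to the Euclidean plane. It is used for the real and the imaginary
  -- part of a Schwartz function separately.
  have key : ∀ (u : Plane → ℝ), ContDiff ℝ ∞ u → MemLp u 2 → MemLp (fun x => fderiv ℝ u x m) 2 →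
      ∫ x : Plane, f x.ofLp * fderiv ℝ u x m = -∫ x : Plane, g x.ofLp * u x := by
    intro u hu hu2 hu2'
    have hp := WithLp.volume_preserving_toLp ℝ ℝ
    have hd : ∀ p, fderiv ℝ (fun p => u (ι p)) p w = fderiv ℝ u (WithLp.toLp 2 p) m := fun p => by
      have h1 := ((hu.differentiable (by simp)) (ι p)).hasFDerivAt.comp p ι.hasFDerivAt
      have h2 : fderiv ℝ (fun p => u (ι p)) p = (fderiv ℝ u (ι p)).comp ι := h1.fderiv
      rw [h2]
      rfl
    have h3 := integral_mul_fderiv_eq_neg_of_weak hf hg w h (u := fun p => u (ι p))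
      (hu.comp ι.contDiff) (hu2.comp_measurePreserving hp)
      (by simp only [hd]; exact hu2'.comp_measurePreserving hp)
    rw [integral_plane, integral_plane]
    have h3' : ∫ p, f p * fderiv ℝ u (WithLp.toLp 2 p) m = -∫ p, g p * u (ι p) := by
      simpa only [hd] using h3
    exact h3'
  have hT : ∂_{m} (F : 𝓢'(Plane, ℂ)) = (G : 𝓢'(Plane, ℂ)) := by
    ext ψ
    rw [TemperedDistribution.lineDerivOp_apply_apply, Lp.toTemperedDistribution_apply,
      Lp.toTemperedDistribution_apply]
    have hψ : ContDiff ℝ ∞ ψ := ψ.smooth _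
    have hψd : ∀ x, (∂_{m} ψ : 𝓢(Plane, ℂ)) x = fderiv ℝ ψ x m := fun x =>
      SchwartzMap.lineDerivOp_apply_eq_fderiv m ψ x
    have hre : ∀ x, fderiv ℝ (fun x => (ψ x).re) x m = ((∂_{m} ψ : 𝓢(Plane, ℂ)) x).re := fun x => by
      rw [hψd]
      have := (Complex.reCLM.hasFDerivAt.comp x (hψ.differentiable (by simp) x).hasFDerivAt).fderiv
      have h2 : fderiv ℝ (fun x => (ψ x).re) x = Complex.reCLM.comp (fderiv ℝ ψ x) := this
      rw [h2]
      rfl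
    have him : ∀ x, fderiv ℝ (fun x => (ψ x).im) x m = ((∂_{m} ψ : 𝓢(Plane, ℂ)) x).im := fun x => by
      rw [hψd]
      have := (Complex.imCLM.hasFDerivAt.comp x (hψ.differentiable (by simp) x).hasFDerivAt).fderiv
      have h2 : fderiv ℝ (fun x => (ψ x).im) x = Complex.imCLM.comp (fderiv ℝ ψ x) := this
      rw [h2]
      rfl
    have hψ2 : MemLp ψ 2 := ψ.memLp 2
    have hψ2' : MemLp (∂_{m} ψ : 𝓢(Plane, ℂ)) 2 := (∂_{m} ψ : 𝓢(Plane, ℂ)).memLp 2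
    have kre := key (fun x => (ψ x).re) (Complex.reCLM.contDiff.comp hψ) hψ2.re
      (by simp only [hre]; exact hψ2'.re)
    have kim := key (fun x => (ψ x).im) (Complex.imCLM.contDiff.comp hψ) hψ2.im
      (by simp only [him]; exact hψ2'.im)
    simp only [hre] at kre
    simp only [him] at kim
    have i1 : Integrable fun x : Plane => (∂_{m} ψ : 𝓢(Plane, ℂ)) x * (f x.ofLp : ℂ) :=
      hψ2'.integrable_mul (memLp_plane hf)
    have i2 : Integrable fun x : Plane => ψ x * (g x.ofLp : ℂ) :=
      hψ2.integrable_mul (memLp_plane hg)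
    calc ∫ x, (-∂_{m} ψ : 𝓢(Plane, ℂ)) x • F x
        = -∫ x : Plane, (∂_{m} ψ : 𝓢(Plane, ℂ)) x * (f x.ofLp : ℂ) := by
          rw [← integral_neg]
          refine integral_congr_ae ?_
          filter_upwards [(memLp_plane hf).coeFn_toLp] with x hx
          rw [hx]
          simp
      _ = ∫ x : Plane, ψ x * (g x.ofLp : ℂ) := by
          have hr := fun (a : ℂ) (r : ℝ) => Complex.re_mul_ofReal a r
          have hi := fun (a : ℂ) (r : ℝ) => Complex.im_mul_ofReal a r
          apply Complex.ext
          · rw [Complex.neg_re, ← RCLike.re_eq_complex_re, ← integral_re i1, ← integral_re i2]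
            simp only [RCLike.re_eq_complex_re, hr]
            simp only [mul_comm _ (f _), mul_comm _ (g _), kre, neg_neg]
          · rw [Complex.neg_im, ← RCLike.im_eq_complex_im, ← integral_im i1, ← integral_im i2]
            simp only [RCLike.im_eq_complex_im, hi]
            simp only [mul_comm _ (f _), mul_comm _ (g _), kim, neg_neg]
      _ = _ := by
          refine integral_congr_ae ?_
          filter_upwards [(memLp_plane hg).coeFn_toLp] with x hx
          rw [hx, smul_eq_mul]
  have hT2 := congrArg 𝓕 hT
  rw [TemperedDistribution.fourier_lineDerivOp_eq, Lp.fourier_toTemperedDistribution_eq,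
    Lp.fourier_toTemperedDistribution_eq] at hT2
  -- The symbol is unbounded, so the product is only locally integrable; the equality of
  -- distributions is read off by testing against compactly supported functions.
  have h4 : ∀ᵐ x : Plane, (𝓕 G : Lp ℂ 2 (volume : Measure Plane)) x =
      2 * Real.pi * Complex.I * (inner ℝ x m : ℝ) * (𝓕 F : Lp ℂ 2 (volume : Measure Plane)) x := by
    have hlF := (Lp.memLp (𝓕 F : Lp ℂ 2 (volume : Measure Plane))).locallyIntegrable one_le_two
    have hcont : Continuous fun x : Plane => 2 * Real.pi * Complex.I * (inner ℝ x m : ℝ) := by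
      fun_prop
    apply ae_eq_of_integral_contDiff_smul_eq
    · exact (Lp.memLp _).locallyIntegrable one_le_two
    · have := (locallyIntegrableOn_univ.2 hlF).continuousOn_smul isOpen_univ.isLocallyClosed
        hcont.continuousOn
      exact locallyIntegrableOn_univ.1 this
    · intro φ φ_smooth φ_cpt
      have hg₁ : HasCompactSupport (Complex.ofRealCLM ∘ φ) := φ_cpt.comp_left rfl
      have hg₂ : ContDiff ℝ ∞ (Complex.ofRealCLM ∘ φ) := by fun_prop
      set ψ : 𝓢(Plane, ℂ) := hg₁.toSchwartzMap hg₂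
      have hψ : ∀ x, ψ x = (φ x : ℂ) := fun x => rfl
      have h1 := congrArg (fun T => T ψ) hT2
      have htemp : (fun x : Plane => ((inner ℝ x m : ℝ) : ℂ)).HasTemperateGrowth := by fun_prop
      have h5 : ((2 * (Real.pi : ℂ) * Complex.I) • TemperedDistribution.smulLeftCLM ℂ
          (fun x : Plane => ((inner ℝ x m : ℝ) : ℂ))
          ((𝓕 F : Lp ℂ 2 (volume : Measure Plane)) : 𝓢'(Plane, ℂ))) ψ =
          2 * (Real.pi : ℂ) * Complex.I *
            ∫ x, (SchwartzMap.smulLeftCLM ℂ (fun x : Plane => ((inner ℝ x m : ℝ) : ℂ)) ψ) x •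
              (𝓕 F : Lp ℂ 2 (volume : Measure Plane)) x := by
        rw [← Lp.toTemperedDistribution_apply, ← TemperedDistribution.smulLeftCLM_apply_apply]
        rfl
      have h6 := h5.symm.trans h1
      rw [Lp.toTemperedDistribution_apply] at h6
      refine Eq.trans (integral_congr_ae (Eventually.of_forall fun x => ?_))
        (h6.symm.trans ((integral_const_mul _ _).symm.trans
          (integral_congr_ae (Eventually.of_forall fun x => ?_))))
      · simp only [hψ, Complex.real_smul, smul_eq_mul]
      · simp only [SchwartzMap.smulLeftCLM_apply_apply htemp, hψ, Complex.real_smul, smul_eq_mul]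
        ring
  filter_upwards [ae_plane h4] with p hp
  have hin : (inner ℝ (WithLp.toLp 2 p : Plane) m : ℝ) = p.1 * w.1 + p.2 * w.2 := by
    rw [WithLp.prod_inner_apply]
    simp [hm, mul_comm]
  rw [hin] at hp
  exact hp

end Transform

theorem fourierL2_congr {f g : ℝ × ℝ → ℝ} (hf : MemLp f 2) (hg : MemLp g 2)
    (h : f =ᵐ[volume] g) : fourierL2 f hf = fourierL2 g hg := by
  have h1 : (memLp_plane hf).toLp (fun w : Plane => (f w.ofLp : ℂ)) =
      (memLp_plane hg).toLp (fun w : Plane => (g w.ofLp : ℂ)) := by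
    rw [MemLp.toLp_eq_toLp_iff]
    have := (WithLp.volume_preserving_ofLp ℝ ℝ).quasiMeasurePreserving.ae h
    filter_upwards [this] with x hx
    rw [hx]
  unfold fourierL2
  rw [h1]

theorem eLpNorm_weak_chain {X : ℕ → ℝ × ℝ → ℝ} (hX : ∀ n, MemLp (X n) 2) (w : ℝ × ℝ)
    (h : ∀ n, ∀ ψ : ℝ × ℝ → ℝ, ContDiff ℝ ∞ ψ → HasCompactSupport ψ →
      ∫ p, X n p * fderiv ℝ ψ p w = -∫ p, X (n + 1) p * ψ p) (n : ℕ) :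
    eLpNorm (X n) 2 volume = l2 volume fun p =>
      ENNReal.ofReal (2 * Real.pi * |p.1 * w.1 + p.2 * w.2|) ^ n *
        ‖fourierL2 (X 0) (hX 0) p‖ₑ := by
  have key : ∀ n, fourierL2 (X n) (hX n) =ᵐ[volume] fun p =>
      (2 * Real.pi * Complex.I * (p.1 * w.1 + p.2 * w.2 : ℝ)) ^ n * fourierL2 (X 0) (hX 0) p := by
    intro n
    induction n with
    | zero => simp
    | succ n ih =>
      filter_upwards [ih, fourierL2_weak (hX n) (hX (n + 1)) w (h n)] with p h1 h2
      rw [h2, h1]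
      ring
  rw [← eLpNorm_fourierL2 _ (hX n), eLpNorm_congr_ae (key n), eLpNorm_eq_l2]
  congr 1
  ext p
  rw [enorm_mul, enorm_pow]
  congr 2
  rw [← ofReal_norm]
  congr 1
  simp [abs_of_pos Real.pi_pos, -Complex.ofReal_add, -Complex.ofReal_mul]

theorem IsWeakDeriv.unique {i j : ℕ} {f g g' : ℝ × ℝ → ℝ} (hg : IsWeakDeriv i j f g)
    (hg' : IsWeakDeriv i j f g') : g =ᵐ[volume] g' := by
  apply ae_eq_of_integral_contDiff_smul_eq hg.locallyIntegrable_deriv hg'.locallyIntegrable_deriv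
  intro ψ hψ hc
  have h1 := (hg.integral_eq ψ hψ hc).symm.trans (hg'.integral_eq ψ hψ hc)
  have h2 := mul_left_cancel₀ (pow_ne_zero _ (by norm_num)) h1
  simpa only [smul_eq_mul, mul_comm] using h2

/-- Weak derivatives agree almost everywhere, so a finite infimum in `derivNorm` is attained by any
of them. -/
theorem exists_isWeakDeriv {i j : ℕ} {f : ℝ × ℝ → ℝ} (h : derivNorm i j f < ⊤) :
    ∃ g, IsWeakDeriv i j f g ∧ MemLp g 2 ∧ eLpNorm g 2 volume = derivNorm i j f := by
  obtain ⟨g, hg⟩ := iInf_lt_iff.1 h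
  obtain ⟨hw, hg⟩ := iInf_lt_iff.1 hg
  refine ⟨g, hw, ⟨hw.locallyIntegrable_deriv.aestronglyMeasurable, hg⟩, ?_⟩
  refine le_antisymm (le_iInf₂ fun g' hg' => ?_) (iInf₂_le _ hw)
  rw [eLpNorm_congr_ae (hw.unique hg')]

theorem isWeakDeriv_zero_ae_eq {f g : ℝ × ℝ → ℝ} (h : IsWeakDeriv 0 0 f g) : g =ᵐ[volume] f :=
  h.unique ⟨h.locallyIntegrable, h.locallyIntegrable, by simp⟩

theorem weak_chain_dx {f : ℝ × ℝ → ℝ} {X : ℕ → ℝ × ℝ → ℝ} (hX : ∀ n, IsWeakDeriv n 0 f (X n))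
    (n : ℕ) (ψ : ℝ × ℝ → ℝ) (hψ : ContDiff ℝ ∞ ψ) (hc : HasCompactSupport ψ) :
    ∫ p, X n p * fderiv ℝ ψ p (1, 0) = -∫ p, X (n + 1) p * ψ p := by
  have h1 := (hX n).integral_eq (dx ψ) (contDiff_dx hψ) (hasCompactSupport_dx hψ hc)
  have h2 := (hX (n + 1)).integral_eq ψ hψ hc
  simp only [Function.iterate_zero, id_eq, add_zero] at h1 h2
  rw [Function.iterate_succ_apply, h1, dx_eq_fderiv (differentiable_of_smooth hψ), pow_succ,
    mul_assoc] at h2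
  have h3 := mul_left_cancel₀ (pow_ne_zero _ (by norm_num)) h2
  simpa using h3

theorem weak_chain_dv {f : ℝ × ℝ → ℝ} {X : ℕ → ℝ × ℝ → ℝ} (hX : ∀ n, IsWeakDeriv 0 n f (X n))
    (n : ℕ) (ψ : ℝ × ℝ → ℝ) (hψ : ContDiff ℝ ∞ ψ) (hc : HasCompactSupport ψ) :
    ∫ p, X n p * fderiv ℝ ψ p (0, 1) = -∫ p, X (n + 1) p * ψ p := by
  have h1 := (hX n).integral_eq (dv ψ) (contDiff_dv hψ) (hasCompactSupport_dv hψ hc)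
  have h2 := (hX (n + 1)).integral_eq ψ hψ hc
  simp only [Function.iterate_zero, id_eq, zero_add] at h1 h2
  rw [Function.iterate_succ_apply, h1, dv_eq_fderiv (differentiable_of_smooth hψ), pow_succ,
    mul_assoc] at h2
  have h3 := mul_left_cancel₀ (pow_ne_zero _ (by norm_num)) h2
  simpa using h3

/-- The supremum norm of a frequency is `|ξ|` or `|η|`, so a power of it is at most the sum of the
two powers. This is why the length uses the supremum norm: pure derivatives in `x` and in `v`
suffice, mixed ones never enter. -/
theorem sn_fourier_le {f : ℝ × ℝ → ℝ} (hx : ∀ n, derivNorm n 0 f < ⊤)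
    (hv : ∀ n, derivNorm 0 n f < ⊤) : ∃ h : MemLp f 2, ∀ n,
      sn (fun p => ‖fourierL2 f h p‖ₑ) n ≤ derivNorm n 0 f + derivNorm 0 n f := by
  choose X hX hX2 hXn using fun n => exists_isWeakDeriv (hx n)
  choose Y hY hY2 hYn using fun n => exists_isWeakDeriv (hv n)
  have eX := isWeakDeriv_zero_ae_eq (hX 0)
  have eY := isWeakDeriv_zero_ae_eq (hY 0)
  have hf : MemLp f 2 := (memLp_congr_ae eX).1 (hX2 0)
  refine ⟨hf, fun n => ?_⟩
  have h1 := eLpNorm_weak_chain hX2 (1, 0) (weak_chain_dx hX) n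
  have h2 := eLpNorm_weak_chain hY2 (0, 1) (weak_chain_dv hY) n
  rw [hXn, fourierL2_congr _ hf eX] at h1
  rw [hYn, fourierL2_congr _ hf eY] at h2
  rw [h1, h2]
  have hm := measurable_fourierL2 f hf
  refine le_trans (l2_mono fun p => ?_) (l2_add_le volume (by fun_prop) (by fun_prop))
  rw [← add_mul]
  gcongr
  simp only [mul_one, mul_zero, add_zero, zero_add]
  unfold rad
  rcases le_total |p.1| |p.2| with h | h
  · rw [Prod.norm_def, Real.norm_eq_abs, Real.norm_eq_abs, max_eq_right h]
    exact le_add_self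
  · rw [Prod.norm_def, Real.norm_eq_abs, Real.norm_eq_abs, max_eq_left h]
    exact le_self_add

theorem gen_en_fourier_le {f : ℝ × ℝ → ℝ} {F : ℝ × ℝ → ℝ≥0∞} (hF : Measurable F)
    (h : ∀ n, sn F n ≤ derivNorm n 0 f + derivNorm 0 n f) (lam : ℝ) :
    gen lam (en F) ≤ totalEnergy lam f := by
  have h1 : ∀ n, en F n ≤ (derivNorm (n + 0) 0 f + derivNorm 0 (n + 0) f) +
      (derivNorm (n + 1) 0 f + derivNorm 0 (n + 1) f) := fun n =>
    (en_le hF n).trans (add_le_add (h n) (h (n + 1)))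
  have h2 : totalEnergy lam f = gen lam fun n => (derivNorm (n + 0) 0 f + derivNorm 0 (n + 0) f) +
      (derivNorm (n + 1) 0 f + derivNorm 0 (n + 1) f) := by
    simp only [gen_add]
    simp [totalEnergy, Finset.sum_range_succ, energyX, energyV, gen]
  rw [h2]
  exact gen_mono h1

theorem derivNorm_lt_top_of_energy {f : ℝ × ℝ → ℝ} {lam : ℝ} (hl : 0 < lam)
    (h : totalEnergy lam f < ⊤) (n : ℕ) : derivNorm n 0 f < ⊤ ∧ derivNorm 0 n f < ⊤ := by
  have h0 : energyX lam 0 f + energyV lam 0 f < ⊤ := by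
    refine lt_of_le_of_lt ?_ h
    simp [totalEnergy, Finset.sum_range_succ]
  have hpos : ENNReal.ofReal (lam ^ n / (n.factorial : ℝ)) ≠ 0 := by
    rw [ne_eq, ENNReal.ofReal_eq_zero, not_le]
    positivity
  obtain ⟨hx, hv⟩ := ENNReal.add_lt_top.1 h0
  have hx' := (ENNReal.le_tsum n).trans_lt hx
  have hv' := (ENNReal.le_tsum n).trans_lt hv
  constructor
  · by_contra hc
    simp only [add_zero, not_lt_top_iff.1 hc, ENNReal.mul_top hpos, lt_self_iff_false] at hx'
  · by_contra hc
    simp only [add_zero, not_lt_top_iff.1 hc, ENNReal.mul_top hpos, lt_self_iff_false] at hv'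

theorem sn_lt_top_of_gen {F : ℝ × ℝ → ℝ≥0∞} {lam : ℝ} (hl : 0 < lam)
    (h : gen lam (en F) < ⊤) (n : ℕ) : sn F n < ⊤ := by
  have hpos : ENNReal.ofReal (lam ^ n / (n.factorial : ℝ)) ≠ 0 := by
    rw [ne_eq, ENNReal.ofReal_eq_zero, not_le]
    positivity
  have h' := (ENNReal.le_tsum n).trans_lt h
  refine (sn_le_en F n).trans_lt ?_
  by_contra hc
  simp only [not_lt_top_iff.1 hc, ENNReal.mul_top hpos, lt_self_iff_false] at h'

/-- The Fourier transform of the real part of `syn b`. -/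
def herm (b : ℝ × ℝ → ℂ) (p : ℝ × ℝ) : ℂ := (b p + star (b (-p))) / 2

theorem measurable_herm {b : ℝ × ℝ → ℂ} (hb : Measurable b) : Measurable (herm b) := by
  have : Measurable fun p => b (-p) := hb.comp measurable_neg
  unfold herm
  exact (hb.add (continuous_star.measurable.comp this)).div_const 2

theorem hermitian_herm (b : ℝ × ℝ → ℂ) : Hermitian (herm b) := fun p => by
  simp [herm, add_comm, Complex.conj_ofNat]

/-- The triangle inequality, and invariance of the weights under `p ↦ -p`. -/
theorem en_herm_le {b : ℝ × ℝ → ℂ} (hb : Measurable b) (n : ℕ) :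
    en (fun p => ‖herm b p‖ₑ) n ≤ en (fun p => ‖b p‖ₑ) n := by
  have hr := measurable_rad
  have hb' : Measurable fun p => b (-p) := hb.comp measurable_neg
  have hm : Measurable fun p => rad p ^ n * ((1 + rad p) * ‖b p‖ₑ) := by fun_prop
  have h1 : l2 volume (fun p => rad p ^ n * ((1 + rad p) * ‖b (-p)‖ₑ)) =
      l2 volume (fun p => rad p ^ n * ((1 + rad p) * ‖b p‖ₑ)) := by
    have := l2_comp_measurePreserving (Measure.measurePreserving_neg (volume : Measure (ℝ × ℝ))) hm
    simpa only [rad_neg] using this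
  have h2 : en (fun p => ‖herm b p‖ₑ) n ≤
      l2 volume (fun p => 2⁻¹ * (rad p ^ n * ((1 + rad p) * ‖b p‖ₑ)) +
        2⁻¹ * (rad p ^ n * ((1 + rad p) * ‖b (-p)‖ₑ))) := by
    refine l2_mono fun p => ?_
    have h3 : ‖herm b p‖ₑ ≤ 2⁻¹ * (‖b p‖ₑ + ‖b (-p)‖ₑ) := by
      have h2 : ‖(2 : ℂ)⁻¹‖ₑ = 2⁻¹ := by
        rw [enorm_inv (by norm_num), ← ofReal_norm]
        simp
      rw [herm, div_eq_inv_mul, enorm_mul, h2]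
      gcongr
      refine (enorm_add_le _ _).trans ?_
      rw [← ofReal_norm (star (b (-p))), norm_star, ofReal_norm]
    calc _ ≤ rad p ^ n * ((1 + rad p) * (2⁻¹ * (‖b p‖ₑ + ‖b (-p)‖ₑ))) := by gcongr
      _ = _ := by ring
  refine h2.trans ((l2_add_le volume (by fun_prop) (by fun_prop)).trans ?_)
  rw [l2_const_mul _ _ hm, l2_const_mul _ _ (by fun_prop), h1, ← add_mul, ENNReal.inv_two_add_inv_two,
    one_mul]
  exact le_rfl

theorem syn_conj_neg (b : ℝ × ℝ → ℂ) (z : ℝ × ℝ) :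
    syn (fun p => star (b (-p))) z = star (syn b z) := by
  have h1 : star (syn b z) = ∫ p, star (ech (p.1 * z.1 + p.2 * z.2) * b p) :=
    (integral_conj (f := fun p : ℝ × ℝ => ech (p.1 * z.1 + p.2 * z.2) * b p)).symm
  rw [h1, ← integral_neg_eq_self]
  unfold syn
  refine integral_congr_ae (Eventually.of_forall fun p => ?_)
  simp only [star_mul', Prod.fst_neg, Prod.snd_neg]
  congr 1
  have := conj_ech (-p.1 * z.1 + -p.2 * z.2)
  rw [starRingEnd_apply] at this
  rw [this]
  congr 1
  ring

theorem syn_herm {b : ℝ × ℝ → ℂ} (hb : Integrable b) (z : ℝ × ℝ) :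
    syn (herm b) z = (syn b z).re := by
  have hb' : Integrable fun p => star (b (-p)) := by
    have := (Measure.measurePreserving_neg (volume : Measure (ℝ × ℝ))).integrable_comp_of_integrable hb
    exact (Complex.conjCLE : ℂ →L[ℝ] ℂ).integrable_comp this
  have hech : ∀ {c : ℝ × ℝ → ℂ}, Integrable c →
      Integrable fun p : ℝ × ℝ => ech (p.1 * z.1 + p.2 * z.2) * c p := fun hc =>
    hc.bdd_mul (c := 1) (measurable_ech.comp (by fun_prop)).aestronglyMeasurable
      (Eventually.of_forall fun p => (norm_ech _).le)
  have h1 : syn (herm b) z = (syn b z + syn (fun p => star (b (-p))) z) / 2 := by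
    unfold syn
    rw [← integral_add (hech hb) (hech hb'), ← integral_div]
    refine integral_congr_ae (Eventually.of_forall fun p => ?_)
    simp only [herm]
    ring
  rw [h1, syn_conj_neg]
  apply Complex.ext <;> simp

/-- Data of finite analytic energy is the inverse Fourier transform of a rapidly decaying Hermitian
function. -/
theorem exists_transform {R : ℝ} (hR : 0 < R) {f : ℝ × ℝ → ℝ} (h : totalEnergy R f < ⊤) :
    ∃ g : ℝ × ℝ → ℂ, Measurable g ∧ Hermitian g ∧
      gen R (en fun p => ‖g p‖ₑ) ≤ totalEnergy R f ∧ rsyn g =ᵐ[volume] f := by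
  have hd := derivNorm_lt_top_of_energy hR h
  obtain ⟨hf, hs⟩ := sn_fourier_le (fun n => (hd n).1) fun n => (hd n).2
  have hm := measurable_fourierL2 f hf
  have hg := gen_en_fourier_le hm.enorm hs R
  have hrap : Rapid (fourierL2 f hf) := ⟨hm, sn_lt_top_of_gen hR (hg.trans_lt h)⟩
  -- The transform of real data is Hermitian only almost everywhere. Symmetrising makes it so at
  -- every point, and the synthesis becomes the real part of the former one, which is still the
  -- data.
  refine ⟨herm (fourierL2 f hf), measurable_herm hm, hermitian_herm _,
    (gen_mono (en_herm_le hm)).trans hg, ?_⟩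
  filter_upwards [syn_fourierL2 f hf hrap.integrable] with p hp
  rw [rsyn, syn_herm hrap.integrable, hp]
  simp

/-! ### Convergence in `L²` from convergence of norms -/

/-- Fatou's lemma applied to `2|F n|² + 2|f|² - |F n - f|²`, which is nonnegative, with pointwise
limit `4|f|²`; convergence of the norms then leaves no room for the subtracted term. -/
theorem tendsto_lintegral_sub_sq {α : Type*} [MeasurableSpace α] {μ : Measure α}
    {F : ℕ → α → ℂ} {f : α → ℂ} (hF : ∀ n, AEStronglyMeasurable (F n) μ)
    (hf : AEStronglyMeasurable f μ) (hlim : ∀ᵐ x ∂μ, Tendsto (fun n => F n x) atTop (𝓝 (f x)))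
    (hfin : ∫⁻ x, ‖f x‖ₑ ^ 2 ∂μ < ⊤)
    (hnorm : Tendsto (fun n => ∫⁻ x, ‖F n x‖ₑ ^ 2 ∂μ) atTop (𝓝 (∫⁻ x, ‖f x‖ₑ ^ 2 ∂μ))) :
    Tendsto (fun n => ∫⁻ x, ‖F n x - f x‖ₑ ^ 2 ∂μ) atTop (𝓝 0) := by
  set A := ∫⁻ x, ‖f x‖ₑ ^ 2 ∂μ with hA
  set S : ℕ → α → ℝ≥0∞ := fun n x => 2 * ‖F n x‖ₑ ^ 2 + 2 * ‖f x‖ₑ ^ 2 with hS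
  set H : ℕ → α → ℝ≥0∞ := fun n x => S n x - ‖F n x - f x‖ₑ ^ 2 with hH
  have mF : ∀ n, AEMeasurable (fun x => ‖F n x‖ₑ ^ 2) μ := fun n => (hF n).enorm.pow_const 2
  have mf : AEMeasurable (fun x => ‖f x‖ₑ ^ 2) μ := hf.enorm.pow_const 2
  have mD : ∀ n, AEMeasurable (fun x => ‖F n x - f x‖ₑ ^ 2) μ := fun n =>
    ((hF n).sub hf).enorm.pow_const 2
  have mS : ∀ n, AEMeasurable (S n) μ := fun n => ((mF n).const_mul 2).add (mf.const_mul 2)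
  have hle : ∀ n x, ‖F n x - f x‖ₑ ^ 2 ≤ S n x := fun n x => by
    simp only [hS, ← ofReal_norm]
    rw [← ENNReal.ofReal_pow (norm_nonneg _), ← ENNReal.ofReal_pow (norm_nonneg _),
      ← ENNReal.ofReal_pow (norm_nonneg _), ← ENNReal.ofReal_ofNat 2,
      ← ENNReal.ofReal_mul (by norm_num), ← ENNReal.ofReal_mul (by norm_num),
      ← ENNReal.ofReal_add (by positivity) (by positivity)]
    apply ENNReal.ofReal_le_ofReal
    have h := norm_sub_le (F n x) (f x)
    nlinarith [norm_nonneg (F n x - f x), sq_nonneg (‖F n x‖ - ‖f x‖), norm_nonneg (F n x),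
      norm_nonneg (f x)]
  have hSint : ∀ n, ∫⁻ x, S n x ∂μ = 2 * (∫⁻ x, ‖F n x‖ₑ ^ 2 ∂μ) + 2 * A := fun n => by
    rw [hS, lintegral_add_left' ((mF n).const_mul 2), lintegral_const_mul'' _ (mF n),
      lintegral_const_mul'' _ mf]
  have hSlim : Tendsto (fun n => ∫⁻ x, S n x ∂μ) atTop (𝓝 (2 * A + 2 * A)) := by
    simp only [hSint]
    exact (ENNReal.Tendsto.const_mul hnorm (Or.inr (by simp))).add_const _
  have hHlim : ∀ᵐ x ∂μ, Tendsto (fun n => H n x) atTop (𝓝 (2 * ‖f x‖ₑ ^ 2 + 2 * ‖f x‖ₑ ^ 2)) := by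
    filter_upwards [hlim] with x hx
    have h1 : Tendsto (fun n => ‖F n x‖ₑ ^ 2) atTop (𝓝 (‖f x‖ₑ ^ 2)) :=
      ((ENNReal.continuous_pow 2).tendsto _).comp hx.enorm
    have h2 : Tendsto (fun n => S n x) atTop (𝓝 (2 * ‖f x‖ₑ ^ 2 + 2 * ‖f x‖ₑ ^ 2)) :=
      (ENNReal.Tendsto.const_mul h1 (Or.inr (by simp))).add_const _
    have h3 : Tendsto (fun n => ‖F n x - f x‖ₑ ^ 2) atTop (𝓝 0) := by
      have := ((ENNReal.continuous_pow 2).tendsto _).comp (hx.sub_const (f x)).enorm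
      simpa [Function.comp_def] using this
    have h4 := ENNReal.Tendsto.sub h2 h3 (Or.inr (by simp))
    simpa using h4
  have hlimInf : 2 * A + 2 * A ≤ liminf (fun n => ∫⁻ x, H n x ∂μ) atTop := by
    calc 2 * A + 2 * A = ∫⁻ x, liminf (fun n => H n x) atTop ∂μ := by
          rw [hA, ← lintegral_const_mul'' _ mf, ← lintegral_add_left' (mf.const_mul 2)]
          refine lintegral_congr_ae ?_
          filter_upwards [hHlim] with x hx
          exact hx.liminf_eq.symm
      _ ≤ _ := lintegral_liminf_le' fun n => (mS n).sub (mD n)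
  -- Fatou bounds only the lower limit of the integrals. Truncation at the expected value turns this
  -- into convergence, so that the subtraction can be carried to the limit.
  have hmin : Tendsto (fun n => min (∫⁻ x, H n x ∂μ) (2 * A + 2 * A)) atTop
      (𝓝 (2 * A + 2 * A)) := by
    refine tendsto_order.2 ⟨fun a ha => ?_, fun a ha => Eventually.of_forall fun n =>
      (min_le_right _ _).trans_lt ha⟩
    filter_upwards [eventually_lt_of_lt_liminf (ha.trans_le hlimInf)] with n hn
    exact lt_min hn ha
  have hAfin : 2 * A + 2 * A ≠ ⊤ := by
    simp [ENNReal.mul_eq_top, hfin.ne]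
  have hD := ENNReal.Tendsto.sub hSlim hmin (Or.inl hAfin)
  rw [tsub_self] at hD
  refine tendsto_of_tendsto_of_tendsto_of_le_of_le' tendsto_const_nhds hD
    (Eventually.of_forall fun _ => zero_le) ?_
  filter_upwards [hSlim.eventually_lt_const hAfin.lt_top] with n hn
  refine le_trans ?_ (tsub_le_tsub_left (min_le_left _ _) _)
  have h1 : (∫⁻ x, ‖F n x - f x‖ₑ ^ 2 ∂μ) + ∫⁻ x, H n x ∂μ = ∫⁻ x, S n x ∂μ := by
    rw [← lintegral_add_left' (mD n)]
    exact lintegral_congr fun x => add_tsub_cancel_of_le (hle n x)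
  have h2 : ∫⁻ x, H n x ∂μ ≠ ⊤ := ((le_add_self.trans h1.le).trans_lt hn).ne
  exact (ENNReal.eq_sub_of_add_eq h2 h1).le

/-! ### The shear -/

/-- The map `(ξ, η) ↦ (ξ, η + tξ)`. -/
def shearMap (t : ℝ) : ℝ × ℝ ≃ₜ ℝ × ℝ where
  toFun p := (p.1, p.2 + t * p.1)
  invFun p := (p.1, p.2 - t * p.1)
  left_inv p := by simp
  right_inv p := by simp

theorem shearMap_apply (t : ℝ) (p : ℝ × ℝ) : shearMap t p = (p.1, p.2 + t * p.1) := rfl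

theorem measurePreserving_shearMap (t : ℝ) : MeasurePreserving (shearMap t) := by
  have h : MeasurePreserving (fun p : ℝ × ℝ => (id p.1, p.2 + t * p.1))
      ((volume : Measure ℝ).prod volume) (volume.prod volume) :=
    (MeasurePreserving.id volume).skew_product (g := fun x y => y + t * x) (by fun_prop)
      (Eventually.of_forall fun x => (measurePreserving_add_right volume (t * x)).map_eq)
  exact h

/-- Composition with the shear. -/
def shear (t : ℝ) (b : ℝ × ℝ → ℂ) (p : ℝ × ℝ) : ℂ := b (shearMap t p)

theorem measurable_shear (t : ℝ) {b : ℝ × ℝ → ℂ} (hb : Measurable b) : Measurable (shear t b) :=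
  hb.comp (shearMap t).continuous.measurable

/-- A volume preserving change of variables: the shear of frequencies is dual to free transport, so
it recovers the solution from its profile. -/
theorem syn_shear (t : ℝ) (b : ℝ × ℝ → ℂ) (x v : ℝ) :
    syn (shear t b) (x, v) = syn b (x - t * v, v) := by
  unfold syn shear
  rw [← (measurePreserving_shearMap t).integral_comp (shearMap t).measurableEmbedding
    fun p : ℝ × ℝ => ech (p.1 * (x - t * v) + p.2 * v) * b p]
  refine integral_congr_ae (Eventually.of_forall fun p => ?_)
  simp only [shearMap_apply]
  congr 2
  ring

theorem rad_le_shearMap (t : ℝ) (p : ℝ × ℝ) :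
    rad p ≤ (1 + ENNReal.ofReal |t|) * rad (shearMap t p) := by
  unfold rad
  rw [← ENNReal.ofReal_one, ← ENNReal.ofReal_add zero_le_one (abs_nonneg t),
    ← ENNReal.ofReal_mul (by positivity)]
  apply ENNReal.ofReal_le_ofReal
  have h : ‖p‖ ≤ (1 + |t|) * ‖shearMap t p‖ := by
    have h1 : |p.1| ≤ ‖shearMap t p‖ := norm_fst_le (shearMap t p)
    have h2 : |p.2 + t * p.1| ≤ ‖shearMap t p‖ := norm_snd_le (shearMap t p)
    have h3 : |p.2| ≤ |p.2 + t * p.1| + |t| * |p.1| := by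
      have := abs_sub (p.2 + t * p.1) (t * p.1)
      rwa [add_sub_cancel_right, abs_mul] at this
    have ht := abs_nonneg t
    have hn := norm_nonneg (shearMap t p)
    rw [Prod.norm_def]
    refine max_le ?_ ?_
    · rw [Real.norm_eq_abs]
      nlinarith
    · rw [Real.norm_eq_abs]
      nlinarith
  nlinarith [Real.pi_pos]

theorem sn_comp_shearMap_le (t : ℝ) {N : ℝ × ℝ → ℝ≥0∞} (hN : Measurable N) (n : ℕ) :
    sn (fun p => N (shearMap t p)) n ≤ (1 + ENNReal.ofReal |t|) ^ n * sn N n := by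
  have hr := measurable_rad
  have hm : Measurable fun p => rad p ^ n * N p := by fun_prop
  unfold sn
  rw [← l2_comp_measurePreserving (measurePreserving_shearMap t) hm, ← l2_const_mul]
  · refine l2_mono fun p => ?_
    rw [← mul_assoc, ← mul_pow]
    gcongr
    exact rad_le_shearMap t p
  · exact hm.comp (shearMap t).continuous.measurable

theorem Rapid.shear {b : ℝ × ℝ → ℂ} (hb : Rapid b) (t : ℝ) : Rapid (shear t b) := by
  refine ⟨measurable_shear t hb.measurable, fun n => ?_⟩
  refine (sn_comp_shearMap_le t hb.measurable.enorm n).trans_lt ?_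
  refine ENNReal.mul_lt_top (ENNReal.pow_lt_top ?_) (hb.sn_lt_top n)
  simp

theorem mulX_shear (t : ℝ) (b : ℝ × ℝ → ℂ) : mulX (shear t b) = shear t (mulX b) := rfl

/-- For the profile, `∂_v` of the solution is `∂_v - t ∂_x`, while `∂_x` is unchanged. -/
theorem mulV_shear (t : ℝ) (b : ℝ × ℝ → ℂ) : mulV (shear t b) = shear t (linSym t b) := by
  ext p
  simp [mulV, shear, linSym, shearMap_apply]

theorem iterate_mul_shear (t : ℝ) (b : ℝ × ℝ → ℂ) (i j : ℕ) :
    mulV^[j] (mulX^[i] (shear t b)) = shear t ((linSym t)^[j] (mulX^[i] b)) := by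
  have h1 : mulX^[i] (shear t b) = shear t (mulX^[i] b) := by
    induction i with
    | zero => rfl
    | succ i ih => rw [Function.iterate_succ_apply', Function.iterate_succ_apply', ih, mulX_shear]
  rw [h1]
  induction j with
  | zero => rfl
  | succ j ih => rw [Function.iterate_succ_apply', Function.iterate_succ_apply', ih, mulV_shear]

theorem measurable_syn {b : ℝ × ℝ → ℂ} (hb : Measurable b) : Measurable (syn b) := by
  have := measurable_ech
  exact measurable_integral_right volume
    (g := fun x : (ℝ × ℝ) × ℝ × ℝ => ech (x.2.1 * x.1.1 + x.2.2 * x.1.2) * b x.2) (by fun_prop)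

theorem eLpNorm_shear (t : ℝ) {b : ℝ × ℝ → ℂ} (hb : Measurable b) :
    eLpNorm (shear t b) 2 volume = eLpNorm b 2 volume :=
  eLpNorm_comp_measurePreserving hb.aestronglyMeasurable (measurePreserving_shearMap t)

/-! ### Continuous families of rapidly decaying functions -/

/-- A family of functions, with a common rapidly decaying majorant and almost everywhere continuous in
the parameter. -/
structure ContFamily (I : Set ℝ) (c : ℝ → ℝ × ℝ → ℂ) : Prop where
  measurable : ∀ s, Measurable (c s)
  exists_maj : ∃ N : ℝ × ℝ → ℝ≥0∞, Measurable N ∧ (∀ n, sn N n < ⊤) ∧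
    ∀ s ∈ I, ∀ p, ‖c s p‖ₑ ≤ N p
  cont : ∀ᵐ p, ContinuousOn (fun s => c s p) I

namespace ContFamily

variable {I : Set ℝ} {c : ℝ → ℝ × ℝ → ℂ}

theorem rapid (h : ContFamily I c) {s : ℝ} (hs : s ∈ I) : Rapid (c s) := by
  obtain ⟨N, _, hN, hle⟩ := h.exists_maj
  exact ⟨h.measurable s, fun n => (l2_mono fun p => mul_le_mul_right (hle s hs p) _).trans_lt (hN n)⟩

/-- Rapid decay survives multiplication by a symbol of first order, the majorant being multiplied by
the length. Hence all derivatives of the family are again continuous families. -/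
theorem mul_symbol (h : ContFamily I c) {m : ℝ → ℝ × ℝ → ℂ} (hm : ∀ s, Measurable (m s)) {C : ℝ≥0∞}
    (hC : C < ⊤) (hle : ∀ s ∈ I, ∀ p, ‖m s p‖ₑ ≤ C * rad p)
    (hc : ∀ p, Continuous fun s => m s p) : ContFamily I fun s p => m s p * c s p := by
  obtain ⟨N, hNm, hN, hNle⟩ := h.exists_maj
  have hr := measurable_rad
  refine ⟨fun s => (hm s).mul (h.measurable s), ⟨fun p => C * (rad p * N p), by fun_prop,
    fun n => ?_, fun s hs p => ?_⟩, ?_⟩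
  · refine lt_of_le_of_lt (le_of_eq ?_) (ENNReal.mul_lt_top hC (hN (n + 1)))
    unfold sn
    rw [← l2_const_mul _ _ (by fun_prop)]
    congr 1
    ext p
    ring
  · rw [enorm_mul]
    refine le_trans ?_ (mul_assoc C (rad p) (N p)).le
    exact mul_le_mul' (hle s hs p) (hNle s hs p)
  · filter_upwards [h.cont] with p hp
    exact (hc p).continuousOn.mul hp

theorem mulX (h : ContFamily I c) : ContFamily I fun s => mulX (c s) :=
  h.mul_symbol (m := fun _ p => 2 * Real.pi * Complex.I * p.1) (fun _ => by fun_prop)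
    ENNReal.one_lt_top (fun s _ p => by
      rw [one_mul, ← ofReal_norm]
      refine le_trans (le_of_eq ?_) (ofReal_fst_le_rad p)
      congr 1
      simp [abs_of_pos Real.pi_pos]) fun _ => continuous_const

theorem linSym (h : ContFamily I c) {A : ℝ} (hA : ∀ s ∈ I, |s| ≤ A) :
    ContFamily I fun s => linSym s (c s) :=
  h.mul_symbol (m := fun s p => 2 * Real.pi * Complex.I * (p.2 - s * p.1 : ℝ))
    (fun _ => by fun_prop) (C := ENNReal.ofReal (1 + A)) ENNReal.ofReal_lt_top (fun s hs p => by
      have h0 : 0 ≤ A := (abs_nonneg s).trans (hA s hs)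
      rw [enorm_symbol, rad, ← ENNReal.ofReal_mul (by linarith)]
      apply ENNReal.ofReal_le_ofReal
      have h1 : |p.2 - s * p.1| ≤ (1 + A) * ‖p‖ := by
        have h1 : |p.1| ≤ ‖p‖ := norm_fst_le p
        have h2 : |p.2| ≤ ‖p‖ := norm_snd_le p
        calc |p.2 - s * p.1| ≤ |p.2| + |s| * |p.1| := by rw [← abs_mul]; exact abs_sub _ _
          _ ≤ ‖p‖ + A * ‖p‖ := by gcongr; exact hA s hs
          _ = _ := by ring
      nlinarith [Real.pi_pos]) fun p => by fun_prop

theorem iterate (h : ContFamily I c) {A : ℝ} (hA : ∀ s ∈ I, |s| ≤ A) (i j : ℕ) :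
    ContFamily I fun s => (ScreenedVP.linSym s)^[j] (ScreenedVP.mulX^[i] (c s)) := by
  have h1 : ContFamily I fun s => ScreenedVP.mulX^[i] (c s) := by
    induction i with
    | zero => exact h
    | succ i ih => simp only [Function.iterate_succ_apply']; exact ih.mulX
  induction j with
  | zero => exact h1
  | succ j ih => simp only [Function.iterate_succ_apply']; exact ih.linSym hA

/-- Dominated convergence, jointly in time and position; the majorant is integrable because its
moments are square integrable. -/
theorem tendsto_syn (h : ContFamily I c) {t : ℝ} (ht : t ∈ I) (z : ℝ × ℝ) :
    Tendsto (fun x : ℝ × ℝ × ℝ => syn (c x.1) x.2) (𝓝[I] t ×ˢ 𝓝 z) (𝓝 (syn (c t) z)) := by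
  obtain ⟨N, hNm, hN, hNle⟩ := h.exists_maj
  have hNi : ∫⁻ p, N p < ⊤ := by
    refine lt_of_le_of_lt ?_ (ENNReal.mul_lt_top (ENNReal.pow_lt_top sobConst_lt_top (n := 2))
      (ENNReal.add_lt_top.2 ⟨ENNReal.add_lt_top.2 ⟨hN 0,
        ENNReal.mul_lt_top (by simp : (2 : ℝ≥0∞) < ⊤) (hN (0 + 1))⟩, hN (0 + 2)⟩))
    simpa using lintegral_rad_pow_le hNm 0
  have hem := measurable_ech
  have hI : ∀ᶠ x : ℝ × ℝ × ℝ in 𝓝[I] t ×ˢ 𝓝 z, x.1 ∈ I :=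
    tendsto_fst.eventually self_mem_nhdsWithin
  refine tendsto_integral_filter_of_dominated_convergence (fun p => (N p).toReal) ?_ ?_
    (integrable_toReal_of_lintegral_ne_top hNm.aemeasurable hNi.ne) ?_
  · refine Eventually.of_forall fun x => ?_
    have := h.measurable x.1
    exact Measurable.aestronglyMeasurable (by fun_prop)
  · filter_upwards [hI] with x hx
    filter_upwards [ae_lt_top hNm hNi.ne] with p hp
    rw [norm_mul, norm_ech, one_mul, ← toReal_enorm]
    exact ENNReal.toReal_mono hp.ne (hNle _ hx p)
  · filter_upwards [h.cont] with p hp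
    refine Tendsto.mul ?_ ((hp t ht).tendsto.comp tendsto_fst)
    refine (continuous_ech.tendsto _).comp ?_
    have h2 : Tendsto (fun x : ℝ × ℝ × ℝ => x.2) (𝓝[I] t ×ˢ 𝓝 z) (𝓝 z) := tendsto_snd
    exact ((continuous_fst.tendsto z).comp h2).const_mul p.1 |>.add
      (((continuous_snd.tendsto z).comp h2).const_mul p.2)

theorem tendsto_lintegral_sq (h : ContFamily I c) {t : ℝ} (ht : t ∈ I) :
    Tendsto (fun s => ∫⁻ p, ‖c s p‖ₑ ^ 2) (𝓝[I] t) (𝓝 (∫⁻ p, ‖c t p‖ₑ ^ 2)) := by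
  obtain ⟨N, hNm, hN, hNle⟩ := h.exists_maj
  refine tendsto_lintegral_filter_of_dominated_convergence (fun p => N p ^ 2)
    (Eventually.of_forall fun s => (h.measurable s).enorm.pow_const 2) ?_ ?_ ?_
  · filter_upwards [self_mem_nhdsWithin] with s hs
    exact Eventually.of_forall fun p => pow_le_pow_left' (hNle s hs p) 2
  · have h0 : sn N 0 < ⊤ := hN 0
    rw [← l2_sq]
    exact (ENNReal.pow_lt_top (by simpa [sn] using h0)).ne
  · filter_upwards [h.cont] with p hp
    exact ((ENNReal.continuous_pow 2).tendsto _).comp (hp t ht).tendsto.enorm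

theorem tendsto_syn_shear (h : ContFamily I c) {t : ℝ} (ht : t ∈ I) (z : ℝ × ℝ) :
    Tendsto (fun s => syn (shear s (c s)) z) (𝓝[I] t) (𝓝 (syn (shear t (c t)) z)) := by
  obtain ⟨x, v⟩ := z
  have hid : Tendsto (fun s : ℝ => s) (𝓝[I] t) (𝓝 t) := nhdsWithin_le_nhds
  have h2 : Tendsto (fun s : ℝ => (x - s * v, v)) (𝓝[I] t) (𝓝 (x - t * v, v)) :=
    ((hid.mul_const v).const_sub x).prodMk_nhds tendsto_const_nhds
  have h1 : Tendsto (fun s : ℝ => (s, (x - s * v, v))) (𝓝[I] t) (𝓝[I] t ×ˢ 𝓝 (x - t * v, v)) :=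
    tendsto_id.prodMk h2
  have h3 := (h.tendsto_syn ht (x - t * v, v)).comp h1
  rw [syn_shear]
  refine h3.congr fun s => ?_
  rw [syn_shear, Function.comp_apply]

theorem lintegral_sq_syn_shear (h : ContFamily I c) {s : ℝ} (hs : s ∈ I) :
    ∫⁻ z, ‖syn (shear s (c s)) z‖ₑ ^ 2 = ∫⁻ p, ‖c s p‖ₑ ^ 2 := by
  have hr := (h.rapid hs).shear s
  have := eLpNorm_syn_eq hr.integrable hr.memLp
  rw [eLpNorm_shear s (h.measurable s), eLpNorm_eq_l2, eLpNorm_eq_l2] at this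
  rw [← l2_sq, ← l2_sq, this]

/-- In frequency the shear moves the argument of a merely measurable function, so pointwise
convergence fails to be available there. In physical space it holds, and the norms converge by
Plancherel; `tendsto_lintegral_sub_sq` combines the two along sequences. -/
theorem tendsto_eLpNorm_sub (h : ContFamily I c) {t : ℝ} (ht : t ∈ I) :
    Tendsto (fun s => eLpNorm (fun z => syn (shear s (c s)) z - syn (shear t (c t)) z) 2 volume)
      (𝓝[I] t) (𝓝 0) := by
  have hm : ∀ s, AEStronglyMeasurable (syn (shear s (c s))) volume := fun s =>
    (measurable_syn (measurable_shear s (h.measurable s))).aestronglyMeasurable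
  have hfin : ∫⁻ z, ‖syn (shear t (c t)) z‖ₑ ^ 2 < ⊤ := by
    have h2 := (h.rapid ht).memLp.2
    rw [eLpNorm_eq_l2] at h2
    rw [h.lintegral_sq_syn_shear ht, ← l2_sq]
    exact ENNReal.pow_lt_top h2
  have hsq : Tendsto (fun s => ∫⁻ z, ‖syn (shear s (c s)) z - syn (shear t (c t)) z‖ₑ ^ 2)
      (𝓝[I] t) (𝓝 0) := by
    refine tendsto_of_seq_tendsto fun u hu => ?_
    have huI : ∀ᶠ n in atTop, u n ∈ I := hu.eventually self_mem_nhdsWithin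
    have h1 : Tendsto (fun n => ∫⁻ z, ‖syn (shear (u n) (c (u n))) z‖ₑ ^ 2) atTop
        (𝓝 (∫⁻ z, ‖syn (shear t (c t)) z‖ₑ ^ 2)) := by
      rw [h.lintegral_sq_syn_shear ht]
      refine ((h.tendsto_lintegral_sq ht).comp hu).congr' ?_
      filter_upwards [huI] with n hn
      exact (h.lintegral_sq_syn_shear hn).symm
    exact tendsto_lintegral_sub_sq (F := fun n => syn (shear (u n) (c (u n))))
      (fun n => hm (u n)) (hm t)
      (Eventually.of_forall fun z => (h.tendsto_syn_shear ht z).comp hu) hfin h1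
  have h0 := ((ENNReal.continuous_rpow_const (y := 1 / 2)).tendsto 0).comp hsq
  rw [ENNReal.zero_rpow_of_pos (by norm_num)] at h0
  refine h0.congr fun s => ?_
  rw [eLpNorm_eq_l2]
  rfl

end ContFamily

/-! ### The inverse Fourier transform on the line -/

/-- The inverse Fourier transform on `ℝ`. -/
def lineSyn (h : ℝ → ℂ) (x : ℝ) : ℂ := ∫ k : ℝ, ech (k * x) * h k

theorem integrable_ech_mul {α : Type*} [MeasurableSpace α] {μ : Measure α} {h : α → ℂ}
    (hh : Integrable h μ) {θ : α → ℝ} (hθ : Measurable θ) :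
    Integrable (fun a => ech (θ a) * h a) μ :=
  hh.bdd_mul (c := 1) (measurable_ech.comp hθ).aestronglyMeasurable
    (Eventually.of_forall fun _ => (norm_ech _).le)

theorem continuous_lineSyn {h : ℝ → ℂ} (hh : Integrable h) : Continuous (lineSyn h) := by
  refine continuous_of_dominated (bound := fun k => ‖h k‖) (fun x => ?_) (fun x => ?_) hh.norm ?_
  · exact (integrable_ech_mul hh (by fun_prop)).aestronglyMeasurable
  · exact Eventually.of_forall fun k => by rw [norm_mul, norm_ech, one_mul]
  · exact Eventually.of_forall fun k =>
      (continuous_ech.comp (continuous_const.mul continuous_id)).mul continuous_const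

theorem norm_lineSyn_le (h : ℝ → ℂ) (x : ℝ) : ‖lineSyn h x‖ ≤ ∫ k, ‖h k‖ := by
  refine (norm_integral_le_integral_norm _).trans (le_of_eq ?_)
  simp only [norm_mul, norm_ech, one_mul]

theorem hasDerivAt_lineSyn {h : ℝ → ℂ} (hh : Integrable h)
    (hh' : Integrable fun k => 2 * Real.pi * Complex.I * k * h k) (x : ℝ) :
    HasDerivAt (lineSyn h) (lineSyn (fun k => 2 * Real.pi * Complex.I * k * h k) x) x := by
  refine (hasDerivAt_integral_of_dominated_loc_of_deriv_le
    (F := fun y k => ech (k * y) * h k)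
    (F' := fun y k => ech (k * y) * (2 * Real.pi * Complex.I * k * h k))
    (bound := fun k => ‖2 * Real.pi * Complex.I * k * h k‖) (x₀ := x) univ_mem ?_ ?_ ?_ ?_
    hh'.norm ?_).2
  · exact Eventually.of_forall fun y => (integrable_ech_mul hh (by fun_prop)).aestronglyMeasurable
  · exact integrable_ech_mul hh (by fun_prop)
  · exact (integrable_ech_mul hh' (by fun_prop)).aestronglyMeasurable
  · exact Eventually.of_forall fun k y _ => by rw [norm_mul, norm_ech, one_mul]
  · refine Eventually.of_forall fun k y _ => ?_
    have h1 : HasDerivAt (fun y => k * y) k y := by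
      simpa using (hasDerivAt_id y).const_mul k
    have h2 := ((hasDerivAt_ech (k * y)).scomp y h1).mul_const (h k)
    refine h2.congr_deriv ?_
    simp only [Complex.real_smul]
    ring

theorem eLpNorm_lineSyn_eq {h : ℝ → ℂ} (hh : Integrable h) (hh2 : MemLp h 2) :
    eLpNorm (lineSyn h) 2 volume = eLpNorm h 2 volume := by
  rw [← eLpNorm_fourierInv_eq hh hh2]
  congr 1
  ext x
  rw [Real.fourierInv_eq', lineSyn]
  refine integral_congr_ae (Eventually.of_forall fun k => ?_)
  simp only [smul_eq_mul, ech, RCLike.inner_apply, conj_trivial]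
  congr 4
  ring

theorem integral_sq_lineSyn {h : ℝ → ℂ} (hh : Integrable h) (hh2 : MemLp h 2) :
    (Integrable fun x => ‖lineSyn h x‖ ^ 2) ∧ ∫ x, ‖lineSyn h x‖ ^ 2 = ∫ k, ‖h k‖ ^ 2 := by
  have hm : MemLp (lineSyn h) 2 := ⟨(continuous_lineSyn hh).aestronglyMeasurable, by
    rw [eLpNorm_lineSyn_eq hh hh2]; exact hh2.2⟩
  refine ⟨hm.integrable_norm_pow (by norm_num), ?_⟩
  have h1 := eLpNorm_lineSyn_eq hh hh2
  rw [eLpNorm_eq_l2, eLpNorm_eq_l2] at h1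
  have h2 := congrArg (fun a => (a ^ 2).toReal) h1
  simp only [l2_sq] at h2
  have key : ∀ u : ℝ → ℂ, AEStronglyMeasurable u volume →
      ∫ x, ‖u x‖ ^ 2 = (∫⁻ x, ‖u x‖ₑ ^ 2).toReal := fun u hu => by
    have hp : AEStronglyMeasurable (fun x => ‖u x‖ ^ 2) volume := hu.norm.pow 2
    rw [integral_eq_lintegral_of_nonneg_ae (Eventually.of_forall fun x => by positivity) hp]
    congr 1
    refine lintegral_congr fun x => ?_
    rw [ENNReal.ofReal_pow (norm_nonneg _), ofReal_norm]
  rw [key _ hm.1, key _ hh2.1, h2]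

/-! ### The potential -/

/-- The bounded solution of `φ - φ'' = ρ`, where `r` is the Fourier transform of `ρ`. -/
def potential (r : ℝ → ℂ) (x : ℝ) : ℝ :=
  (lineSyn (fun k => (1 + (2 * Real.pi * k : ℝ) ^ 2 : ℝ)⁻¹ * r k) x).re

section Potential

variable {r : ℝ → ℂ}

theorem integrable_bounded_mul (hr : Integrable r) {m : ℝ → ℂ} (hm : Measurable m)
    (hm1 : ∀ k, ‖m k‖ ≤ 1) : Integrable fun k => m k * r k :=
  hr.bdd_mul (c := 1) hm.aestronglyMeasurable (Eventually.of_forall hm1)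

theorem fieldMult_eq (k : ℝ) : fieldMult k =
    2 * Real.pi * Complex.I * k * ((1 + (2 * Real.pi * k : ℝ) ^ 2 : ℝ)⁻¹ : ℝ) := by
  rw [fieldMult]
  push_cast
  rfl

theorem norm_fieldMult_le (k : ℝ) : ‖fieldMult k‖ ≤ 1 := by
  have h := enorm_fieldMult k
  rw [← ofReal_norm, ENNReal.ofReal_eq_ofReal_iff (norm_nonneg _) (by positivity)] at h
  rw [h, div_le_one (by positivity)]
  nlinarith [sq_nonneg (2 * Real.pi * |k| - 1)]

theorem norm_symbol_mul_fieldMult_le (k : ℝ) : ‖2 * Real.pi * Complex.I * k * fieldMult k‖ ≤ 1 := by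
  have h := enorm_fieldMult k
  rw [← ofReal_norm, ENNReal.ofReal_eq_ofReal_iff (norm_nonneg _) (by positivity)] at h
  rw [norm_mul, h]
  have h1 : ‖2 * (Real.pi : ℂ) * Complex.I * k‖ = 2 * Real.pi * |k| := by
    simp [abs_of_pos Real.pi_pos]
  rw [h1, ← mul_div_assoc, div_le_one (by positivity)]
  nlinarith

theorem norm_inv_one_add_le (k : ℝ) : ‖(((1 + (2 * Real.pi * k : ℝ) ^ 2 : ℝ)⁻¹ : ℝ) : ℂ)‖ ≤ 1 := by
  rw [Complex.norm_real, Real.norm_of_nonneg (by positivity)]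
  exact inv_le_one_of_one_le₀ (by nlinarith [sq_nonneg (2 * Real.pi * k)])

theorem integrable_inv_one_add_mul (hr : Integrable r) :
    Integrable fun k : ℝ => (((1 + (2 * Real.pi * k : ℝ) ^ 2 : ℝ)⁻¹ : ℝ) : ℂ) * r k :=
  integrable_bounded_mul hr (by fun_prop) norm_inv_one_add_le

theorem integrable_fieldMult_mul (hr : Integrable r) : Integrable fun k => fieldMult k * r k :=
  integrable_bounded_mul hr measurable_fieldMult norm_fieldMult_le

theorem integrable_symbol_mul_fieldMult_mul (hr : Integrable r) :
    Integrable fun k : ℝ => 2 * Real.pi * Complex.I * k * (fieldMult k * r k) := by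
  have hm := measurable_fieldMult
  have := integrable_bounded_mul hr (m := fun k : ℝ => 2 * Real.pi * Complex.I * k * fieldMult k)
    (by fun_prop) norm_symbol_mul_fieldMult_le
  exact this.congr (Eventually.of_forall fun k => by ring)

theorem hasDerivAt_potential (hr : Integrable r) (x : ℝ) :
    HasDerivAt (potential r) (lineSyn (fun k => fieldMult k * r k) x).re x := by
  have e : (fun k : ℝ => 2 * Real.pi * Complex.I * k *
      ((((1 + (2 * Real.pi * k : ℝ) ^ 2 : ℝ)⁻¹ : ℝ) : ℂ) * r k)) = fun k => fieldMult k * r k := by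
    ext k
    rw [fieldMult_eq]
    ring
  have h := hasDerivAt_lineSyn (integrable_inv_one_add_mul hr)
    (by rw [e]; exact integrable_fieldMult_mul hr) x
  rw [e] at h
  exact Complex.reCLM.hasFDerivAt.comp_hasDerivAt x h

theorem deriv_potential (hr : Integrable r) :
    deriv (potential r) = fun x => (lineSyn (fun k => fieldMult k * r k) x).re :=
  funext fun x => (hasDerivAt_potential hr x).deriv

theorem hasDerivAt_deriv_potential (hr : Integrable r) (x : ℝ) :
    HasDerivAt (deriv (potential r))
      (lineSyn (fun k => 2 * Real.pi * Complex.I * k * (fieldMult k * r k)) x).re x := by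
  rw [deriv_potential hr]
  exact Complex.reCLM.hasFDerivAt.comp_hasDerivAt x (hasDerivAt_lineSyn
    (integrable_fieldMult_mul hr) (integrable_symbol_mul_fieldMult_mul hr) x)

theorem deriv_deriv_potential (hr : Integrable r) : deriv (deriv (potential r)) = fun x =>
    (lineSyn (fun k => 2 * Real.pi * Complex.I * k * (fieldMult k * r k)) x).re :=
  funext fun x => (hasDerivAt_deriv_potential hr x).deriv

theorem contDiff_potential (hr : Integrable r) : ContDiff ℝ 2 (potential r) := by
  have h1 : ContDiff ℝ 1 (deriv (potential r)) := by
    rw [contDiff_one_iff_deriv]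
    refine ⟨fun x => (hasDerivAt_deriv_potential hr x).differentiableAt, ?_⟩
    rw [deriv_deriv_potential hr]
    exact Complex.continuous_re.comp (continuous_lineSyn (integrable_symbol_mul_fieldMult_mul hr))
  rw [show (2 : WithTop ℕ∞) = 1 + 1 from rfl, contDiff_succ_iff_deriv]
  exact ⟨fun x => (hasDerivAt_potential hr x).differentiableAt, by simp, h1⟩

theorem abs_potential_le (r : ℝ → ℂ) : ∃ M : ℝ, ∀ x, |potential r x| ≤ M :=
  ⟨_, fun x => (Complex.abs_re_le_norm _).trans (norm_lineSyn_le _ x)⟩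

/-- On the symbols: `(1 - (2πik)²) / (1 + (2πk)²) = 1`. -/
theorem potential_sub_deriv (hr : Integrable r) (x : ℝ) :
    potential r x - deriv (deriv (potential r)) x = (lineSyn r x).re := by
  rw [deriv_deriv_potential hr, potential]
  simp only
  rw [← Complex.sub_re]
  congr 1
  unfold lineSyn
  rw [← integral_sub (integrable_ech_mul (integrable_inv_one_add_mul hr) (by fun_prop))
    (integrable_ech_mul (integrable_symbol_mul_fieldMult_mul hr) (by fun_prop))]
  refine integral_congr_ae (Eventually.of_forall fun k => ?_)
  simp only
  rw [fieldMult_eq]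
  have h : ((1 + (2 * Real.pi * k : ℝ) ^ 2 : ℝ) : ℂ) *
      ((1 + (2 * Real.pi * k : ℝ) ^ 2 : ℝ)⁻¹ : ℝ) = 1 := by
    rw [← Complex.ofReal_mul, mul_inv_cancel₀ (by positivity), Complex.ofReal_one]
  have h2 : ((1 + (2 * Real.pi * k : ℝ) ^ 2 : ℝ) : ℂ) =
      1 - (2 * Real.pi * Complex.I * k) * (2 * Real.pi * Complex.I * k) := by
    push_cast
    linear_combination (4 * Real.pi ^ 2 * k ^ 2 : ℂ) * Complex.I_sq
  rw [h2] at h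
  generalize (((1 + (2 * Real.pi * k : ℝ) ^ 2 : ℝ)⁻¹ : ℝ) : ℂ) = w at h ⊢
  linear_combination ech (k * x) * r k * h

end Potential

/-! ### The density -/

/-- One weight in `k` makes the correlation integrable, and this weight distributes over the two
factors. It gives absolute convergence to all later exchanges of integrals for the density. -/
theorem lintegral_lineCorr_lt_top {N : ℝ × ℝ → ℝ≥0∞} (hN : Measurable N) (h : ∀ n, sn N n < ⊤)
    (t : ℝ) : ∫⁻ k, lineCorr N N t k < ⊤ := by
  have hr := measurable_rad
  have h0 : l2 volume N < ⊤ := by simpa [sn] using h 0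
  have h1 : l2 volume (fun p => rad p * N p) < ⊤ := by simpa [sn] using h 1
  have hw : ∀ n, l2 volume (fun p => (1 + rad p) * (rad p ^ n * N p)) < ⊤ := fun n => by
    refine lt_of_le_of_lt ((l2_mono fun p => (by ring :
      (1 + rad p) * (rad p ^ n * N p) = rad p ^ n * N p + rad p ^ (n + 1) * N p).le).trans
        (l2_add_le volume (by fun_prop) (by fun_prop))) (ENNReal.add_lt_top.2 ⟨h n, h (n + 1)⟩)
  have hw0 : l2 volume (fun p => (1 + rad p) * N p) < ⊤ := by simpa using hw 0
  have hw1 : l2 volume (fun p => (1 + rad p) * (rad p * N p)) < ⊤ := by simpa using hw 1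
  have hmL : ∀ {F G : ℝ × ℝ → ℝ≥0∞}, Measurable F → Measurable G → Measurable (lineCorr F G t) :=
    fun {F G} hF hG => measurable_lineCorr (α := ℝ) (F := fun _ => F) (G := fun _ => G)
      (t := fun _ => t) (k := fun k => k)
      (by unfold Function.uncurry; fun_prop) (by unfold Function.uncurry; fun_prop)
      measurable_const measurable_id
  have hrN : Measurable fun p => rad p * N p := by fun_prop
  have m0 := hmL hN hN
  have m1 := hmL hrN hN
  have m2 := hmL hN hrN
  refine (lintegral_le_sobConst m0).trans_lt (ENNReal.mul_lt_top sobConst_lt_top ?_)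
  have hle : ∀ k : ℝ, (1 + ENNReal.ofReal (2 * Real.pi * |k|)) * lineCorr N N t k ≤
      lineCorr N N t k + (lineCorr (fun p => rad p * N p) N t k +
        lineCorr N (fun p => rad p * N p) t k) := fun k => by
    rw [add_mul, one_mul]
    gcongr
    refine le_trans ?_ (rad_mul_lineCorr_le hN hN t k)
    gcongr
    exact ofReal_fst_le_rad (k, t * k)
  refine (l2_mono hle).trans_lt ((l2_add_le volume m0 (m1.add m2)).trans_lt
    (ENNReal.add_lt_top.2 ⟨?_, (l2_add_le volume m1 m2).trans_lt (ENNReal.add_lt_top.2 ⟨?_, ?_⟩)⟩))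
  · exact (l2_lineCorr_le hN hN t).trans_lt
      (ENNReal.mul_lt_top sobConst_lt_top (ENNReal.mul_lt_top h0 hw0))
  · exact (l2_lineCorr_le hrN hN t).trans_lt
      (ENNReal.mul_lt_top sobConst_lt_top (ENNReal.mul_lt_top h1 hw0))
  · exact (l2_lineCorr_le hN hrN t).trans_lt
      (ENNReal.mul_lt_top sobConst_lt_top (ENNReal.mul_lt_top h0 hw1))

section Density

variable {b : ℝ × ℝ → ℂ}

theorem Rapid.integrable_corr (hb : Rapid b) (t : ℝ) : Integrable fun x : (ℝ × ℝ) × ℝ =>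
    b (x.1 + (x.2, t * x.2)) * starRingEnd ℂ (b x.1) := by
  have hbm := hb.measurable
  have hc := Complex.continuous_conj.measurable
  refine ⟨by fun_prop, ?_⟩
  have h1 : ∫⁻ x : (ℝ × ℝ) × ℝ, ‖b (x.1 + (x.2, t * x.2)) * starRingEnd ℂ (b x.1)‖ₑ =
      ∫⁻ k, lineCorr (fun p => ‖b p‖ₑ) (fun p => ‖b p‖ₑ) t k := by
    rw [Measure.volume_eq_prod, lintegral_prod_symm _ (by fun_prop)]
    refine lintegral_congr fun k => lintegral_congr fun q => ?_
    rw [enorm_mul, ← ofReal_norm (starRingEnd ℂ (b q)), RCLike.norm_conj, ofReal_norm]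
  rw [HasFiniteIntegral, h1]
  exact lintegral_lineCorr_lt_top hbm.enorm hb.sn_lt_top t

theorem Rapid.integrable_rhoHat (hb : Rapid b) (t : ℝ) : Integrable (rhoHat t b) :=
  (hb.integrable_corr t).integral_prod_right

/-- The shear straightens the line of direction `(1, t)`, so the density of the solution is computed
from the profile along that line. -/
theorem rhoHat_shear (t : ℝ) (b : ℝ × ℝ → ℂ) (k : ℝ) : rhoHat 0 (shear t b) k = rhoHat t b k := by
  unfold rhoHat
  rw [← (measurePreserving_shearMap t).integral_comp (shearMap t).measurableEmbedding
    fun q => b (q + (k, t * k)) * starRingEnd ℂ (b q)]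
  refine integral_congr_ae (Eventually.of_forall fun q => ?_)
  simp only [shear]
  congr 2
  simp only [shearMap_apply]
  ext <;> simp
  ring

/-- The inverse Fourier transform in the first variable. -/
def fstSyn (b : ℝ × ℝ → ℂ) (x η : ℝ) : ℂ := lineSyn (fun ξ => b (ξ, η)) x

theorem syn_eq_lineSyn (hb : Integrable b) (x v : ℝ) :
    Integrable (fstSyn b x) ∧ syn b (x, v) = lineSyn (fstSyn b x) v := by
  have h1 : Integrable fun p : ℝ × ℝ => ech (p.1 * x) * b p := integrable_ech_mul hb (by fun_prop)
  refine ⟨h1.integral_prod_right, ?_⟩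
  have h2 : Integrable fun p : ℝ × ℝ => ech (p.1 * x + p.2 * v) * b p :=
    integrable_ech_mul hb (by fun_prop)
  rw [syn, Measure.volume_eq_prod, integral_prod_symm _ h2]
  unfold lineSyn fstSyn lineSyn
  refine integral_congr_ae (Eventually.of_forall fun η => ?_)
  simp only
  rw [← integral_const_mul]
  refine integral_congr_ae (Eventually.of_forall fun ξ => ?_)
  simp only
  rw [ech_add]
  ring

/-- The transform of a squared modulus is an autocorrelation: expanding the square and exchanging
integrals reduces everything to the absolute convergence in `Rapid.integrable_corr`. The square
integrability on the slice comes out for every `x`, not only almost every. -/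
theorem integral_norm_sq_fstSyn (hb : Rapid b) (x : ℝ) :
    (Integrable fun η => ‖fstSyn b x η‖ ^ 2) ∧
      ((∫ η, ‖fstSyn b x η‖ ^ 2 : ℝ) : ℂ) = lineSyn (rhoHat 0 b) x := by
  have hi := integrable_ech_mul (hb.integrable_corr 0)
    (θ := fun y : (ℝ × ℝ) × ℝ => y.2 * x) (by fun_prop)
  have hH : ∀ q : ℝ × ℝ, ∫ k : ℝ, ech (k * x) * (b (q + (k, 0 * k)) * starRingEnd ℂ (b q)) =
      starRingEnd ℂ (ech (q.1 * x) * b q) * fstSyn b x q.2 := fun q => by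
    rw [fstSyn, lineSyn, ←
      integral_add_left_eq_self (fun ξ => ech (ξ * x) * b (ξ, q.2)) q.1, ← integral_const_mul]
    refine integral_congr_ae (Eventually.of_forall fun k => ?_)
    simp only
    have h1 : q + (k, 0 * k) = (q.1 + k, q.2) := by ext <;> simp
    rw [h1, add_mul q.1 k x, ech_add, map_mul, conj_ech]
    have h2 : ech (-(q.1 * x)) * ech (q.1 * x) = 1 := by
      rw [← ech_add, neg_add_cancel]
      simp [ech]
    linear_combination (-(ech (k * x) * b (q.1 + k, q.2) * starRingEnd ℂ (b q))) * h2
  have hHi : Integrable fun q : ℝ × ℝ =>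
      starRingEnd ℂ (ech (q.1 * x) * b q) * fstSyn b x q.2 :=
    hi.integral_prod_left.congr (Eventually.of_forall hH)
  have hη : ∀ η : ℝ, ∫ ξ : ℝ, starRingEnd ℂ (ech (ξ * x) * b (ξ, η)) * fstSyn b x η =
      ((‖fstSyn b x η‖ ^ 2 : ℝ) : ℂ) := fun η => by
    rw [integral_mul_const, integral_conj]
    change starRingEnd ℂ (fstSyn b x η) * fstSyn b x η = _
    rw [mul_comm, Complex.mul_conj, Complex.normSq_eq_norm_sq]
  have hi2 : Integrable fun η => ((‖fstSyn b x η‖ ^ 2 : ℝ) : ℂ) :=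
    hHi.integral_prod_right.congr (Eventually.of_forall hη)
  refine ⟨hi2.re.congr (Eventually.of_forall fun η => Complex.ofReal_re _), ?_⟩
  calc ((∫ η, ‖fstSyn b x η‖ ^ 2 : ℝ) : ℂ) = ∫ η, ((‖fstSyn b x η‖ ^ 2 : ℝ) : ℂ) :=
        integral_ofReal.symm
    _ = ∫ η, ∫ ξ, starRingEnd ℂ (ech (ξ * x) * b (ξ, η)) * fstSyn b x η := by simp only [hη]
    _ = ∫ q : ℝ × ℝ, starRingEnd ℂ (ech (q.1 * x) * b q) * fstSyn b x q.2 :=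
        (integral_prod_symm _ hHi).symm
    _ = ∫ q : ℝ × ℝ, ∫ k : ℝ, ech (k * x) * (b (q + (k, 0 * k)) * starRingEnd ℂ (b q)) := by
        simp only [hH]
    _ = ∫ k : ℝ, ∫ q : ℝ × ℝ, ech (k * x) * (b (q + (k, 0 * k)) * starRingEnd ℂ (b q)) :=
        integral_integral_swap hi
    _ = _ := by
        unfold lineSyn rhoHat
        simp only [integral_const_mul]

/-- Plancherel in `v` at fixed `x`, followed by the autocorrelation formula. -/
theorem integral_norm_sq_syn (hb : Rapid b) (x : ℝ) :
    (Integrable fun v => ‖syn b (x, v)‖ ^ 2) ∧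
      ((∫ v, ‖syn b (x, v)‖ ^ 2 : ℝ) : ℂ) = lineSyn (rhoHat 0 b) x := by
  have h1 := (syn_eq_lineSyn hb.integrable x 0).1
  have h2 := integral_norm_sq_fstSyn hb x
  have h3 : MemLp (fstSyn b x) 2 := (memLp_two_iff_integrable_sq_norm h1.1).2 h2.1
  have h4 := integral_sq_lineSyn h1 h3
  simp only [fun v => (syn_eq_lineSyn hb.integrable x v).2]
  exact ⟨h4.1, by rw [h4.2, h2.2]⟩


end Density

/-! ### Bounded solutions of the screened Poisson equation -/

section Screened

variable {ψ : ℝ → ℝ}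

/-- Since `1 - ∂²` factors, `exp (x - y) (ψ + ψ')(y)` has derivative `-exp (x - y) (ψ - ψ'')(y)`.
Integrating from `x` to infinity, where the exponential is at most one, gives the bound once the
boundary term vanishes. -/
theorem abs_add_deriv_le (hψ : ContDiff ℝ 2 ψ) {M : ℝ} (hM : ∀ x, |ψ x| ≤ M)
    (hσ : Integrable fun x => ψ x - deriv (deriv ψ) x) (x : ℝ) :
    |ψ x + deriv ψ x| ≤ ∫ y, |ψ y - deriv (deriv ψ) y| := by
  have hψ1 : ContDiff ℝ 1 (deriv ψ) := by
    rw [show (2 : WithTop ℕ∞) = 1 + 1 from rfl, contDiff_succ_iff_deriv] at hψ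
    exact hψ.2.2
  have hd : ∀ y, HasDerivAt ψ (deriv ψ y) y := fun y =>
    (hψ.differentiable (by simp) y).hasDerivAt
  have hd1 : ∀ y, HasDerivAt (deriv ψ) (deriv (deriv ψ) y) y := fun y =>
    (hψ1.differentiable (by simp) y).hasDerivAt
  have hc2 : Continuous (deriv (deriv ψ)) := hψ1.continuous_deriv le_rfl
  set σ : ℝ → ℝ := fun y => ψ y - deriv (deriv ψ) y with hσdef
  have hσc : Continuous σ := hψ.continuous.sub hc2
  have hU : ∀ y, HasDerivAt (fun y => Real.exp (x - y) * (ψ y + deriv ψ y))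
      (-(Real.exp (x - y) * σ y)) y := fun y => by
    have he : HasDerivAt (fun y => Real.exp (x - y)) (-Real.exp (x - y)) y := by
      simpa using ((hasDerivAt_id y).const_sub x).exp
    refine (he.mul ((hd y).add (hd1 y))).congr_deriv ?_
    simp only [hσdef, Pi.add_apply]
    ring
  have hint : ∀ y, x ≤ y → |ψ x + deriv ψ x| ≤
      Real.exp (x - y) * |ψ y + deriv ψ y| + ∫ z, |σ z| := fun y hxy => by
    have hcont : Continuous fun y => -(Real.exp (x - y) * σ y) := by fun_prop
    have h1 := intervalIntegral.integral_eq_sub_of_hasDerivAt (fun y _ => hU y)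
      (hcont.intervalIntegrable x y)
    have h2 : |∫ z in x..y, -(Real.exp (x - z) * σ z)| ≤ ∫ z, |σ z| := by
      rw [intervalIntegral.integral_of_le hxy]
      calc |∫ z in Ioc x y, -(Real.exp (x - z) * σ z)|
          ≤ ∫ z in Ioc x y, |-(Real.exp (x - z) * σ z)| := abs_integral_le_integral_abs
        _ ≤ ∫ z in Ioc x y, |σ z| := by
            refine setIntegral_mono_on ?_ hσ.abs.integrableOn measurableSet_Ioc fun z hz => ?_
            · exact (hcont.abs.integrableOn_Icc).mono_set Ioc_subset_Icc_self
            · rw [abs_neg, abs_mul, abs_of_pos (Real.exp_pos _)]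
              exact mul_le_of_le_one_left (abs_nonneg _)
                (Real.exp_le_one_iff.2 (by linarith [hz.1]))
        _ ≤ ∫ z, |σ z| := setIntegral_le_integral hσ.abs (Eventually.of_forall fun _ => abs_nonneg _)
    rw [h1, sub_self, Real.exp_zero, one_mul] at h2
    have h3 := abs_sub_abs_le_abs_sub (ψ x + deriv ψ x) (Real.exp (x - y) * (ψ y + deriv ψ y))
    rw [abs_sub_comm (ψ x + deriv ψ x), abs_mul, abs_of_pos (Real.exp_pos _)] at h3
    linarith
  -- Boundedness of `ψ` gives no pointwise bound on `ψ'`, but the mean value theorem supplies a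
  -- point in each unit interval where `|ψ'| ≤ 2 M`; the boundary term need vanish only along such a
  -- sequence.
  have hseq : ∀ n : ℕ, ∃ y, x + n ≤ y ∧ |deriv ψ y| ≤ 2 * M := fun n => by
    obtain ⟨c, hc, hc'⟩ := exists_deriv_eq_slope ψ (by linarith : x + n < x + n + 1)
      hψ.continuous.continuousOn (hψ.differentiable (by simp)).differentiableOn
    refine ⟨c, hc.1.le, ?_⟩
    rw [hc', add_sub_cancel_left, div_one]
    refine (abs_sub _ _).trans ?_
    linarith [hM (x + n + 1), hM (x + n)]
  have hlim : Tendsto (fun n : ℕ => Real.exp (-(n : ℝ)) * (3 * M) + ∫ z, |σ z|) atTop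
      (𝓝 (0 * (3 * M) + ∫ z, |σ z|)) := by
    refine Tendsto.add_const _ (Tendsto.mul_const _ ?_)
    exact Real.tendsto_exp_neg_atTop_nhds_zero.comp tendsto_natCast_atTop_atTop
  rw [zero_mul, zero_add] at hlim
  refine ge_of_tendsto' hlim fun n => ?_
  obtain ⟨y, hy, hy'⟩ := hseq n
  refine (hint y (by linarith [n.cast_nonneg (α := ℝ)])).trans ?_
  gcongr
  · linarith
  · exact (abs_add_le _ _).trans (by linarith [hM y])

/-- The estimate for `ψ` and for its reflection bound `ψ + ψ'` and `ψ - ψ'`, hence both `ψ` and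
`ψ'`. -/
theorem abs_le_of_screened (hψ : ContDiff ℝ 2 ψ) {M : ℝ} (hM : ∀ x, |ψ x| ≤ M)
    (hσ : Integrable fun x => ψ x - deriv (deriv ψ) x) (x : ℝ) :
    |ψ x| ≤ ∫ y, |ψ y - deriv (deriv ψ) y| ∧ |deriv ψ x| ≤ ∫ y, |ψ y - deriv (deriv ψ) y| := by
  have h1 := abs_add_deriv_le hψ hM hσ x
  have e1 : deriv (fun y => ψ (-y)) = fun y => -deriv ψ (-y) := funext fun y => deriv_comp_neg ψ y
  have e2 : deriv (deriv fun y => ψ (-y)) = fun y => deriv (deriv ψ) (-y) := by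
    rw [e1]
    ext y
    rw [deriv.fun_neg, deriv_comp_neg (deriv ψ) y, neg_neg]
  have h2 := abs_add_deriv_le (ψ := fun y => ψ (-y)) (hψ.comp contDiff_neg) (fun y => hM (-y))
    (by rw [e2]; exact hσ.comp_neg) (-x)
  rw [e2] at h2
  simp only [e1, neg_neg] at h2
  have h3 := integral_neg_eq_self (fun y => |ψ y - deriv (deriv ψ) y|) volume
  rw [h3] at h2
  have h4 := abs_le.1 h1
  have h5 := abs_le.1 h2
  constructor <;> rw [abs_le] <;> constructor <;> linarith

end Screened

/-! ### The nonlinearity in physical variables -/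

/-- The nonlinearity is a convolution supported on the line of direction `(1, t)`, so its inverse
transform is a product, with the field evaluated at `y + t v`. -/
theorem syn_nl {b : ℝ × ℝ → ℂ} {t : ℝ} (hr : Integrable (rhoHat t b))
    (hl : Integrable (linSym t b)) (y v : ℝ) :
    syn (nl t b) (y, v) =
      lineSyn (fun k => fieldMult k * rhoHat t b k) (y + t * v) * syn (linSym t b) (y, v) := by
  set h : ℝ → ℂ := fun k => fieldMult k * rhoHat t b k with hh
  have hi : Integrable h := integrable_fieldMult_mul hr
  have hmp : MeasurePreserving (fun x : ℝ × ℝ × ℝ => (id x.1, x.2 - (x.1, t * x.1)))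
      ((volume : Measure ℝ).prod volume) (volume.prod volume) :=
    (MeasurePreserving.id volume).skew_product (g := fun k p => p - (k, t * k)) (by fun_prop)
      (Eventually.of_forall fun k => (measurePreserving_sub_right volume (k, t * k)).map_eq)
  have h1 : Integrable (fun x : ℝ × ℝ × ℝ => h x.1 * linSym t b (x.2 - (x.1, t * x.1)))
      (volume.prod volume) := hmp.integrable_comp_of_integrable (hi.mul_prod hl)
  have h2 := integrable_ech_mul h1 (θ := fun x => x.2.1 * y + x.2.2 * v) (by fun_prop)
  have h3 : ∀ k : ℝ, ∫ p : ℝ × ℝ, ech (p.1 * y + p.2 * v) * (h k * linSym t b (p - (k, t * k))) =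
      ech (k * (y + t * v)) * h k * syn (linSym t b) (y, v) := fun k => by
    rw [← integral_add_right_eq_self _ (k, t * k), syn, ← integral_const_mul]
    refine integral_congr_ae (Eventually.of_forall fun p => ?_)
    simp only [add_sub_cancel_right, Prod.fst_add, Prod.snd_add]
    rw [show (p.1 + k) * y + (p.2 + t * k) * v = k * (y + t * v) + (p.1 * y + p.2 * v) by ring,
      ech_add]
    ring
  calc syn (nl t b) (y, v) = ∫ p : ℝ × ℝ, ∫ k : ℝ,
        ech (p.1 * y + p.2 * v) * (h k * linSym t b (p - (k, t * k))) := by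
        unfold syn nl
        simp only [hh, integral_const_mul]
    _ = ∫ k : ℝ, ∫ p : ℝ × ℝ, ech (p.1 * y + p.2 * v) * (h k * linSym t b (p - (k, t * k))) :=
        (integral_integral_swap h2).symm
    _ = _ := by
        simp only [h3]
        rw [integral_mul_const, lineSyn]

/-! ### Solutions of the profile equation in Fourier variables -/

/-- A rapidly decaying solution of the profile equation in Fourier variables. -/
structure Flow (T : ℝ) (g : ℝ × ℝ → ℂ) (f : ℝ → ℝ × ℝ → ℂ) : Prop where
  measurable : Measurable (Function.uncurry f)
  hermitian : ∀ t, Hermitian (f t)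
  exists_maj : ∃ N : ℝ × ℝ → ℝ≥0∞, Measurable N ∧ (∀ n, sn N n < ⊤) ∧
    (∀ s ∈ Icc 0 T, ∀ p, ‖f s p‖ₑ ≤ N p) ∧
    -- The bound on the time integral makes Duhamel's term continuous in time for almost every
    -- frequency and allows exchanging the integrals over time and frequency.
    (∀ p, ∫⁻ s in Ioc 0 T, ‖nl s (f s) p‖ₑ ≤ N p)
  eq : ∀ᵐ p, ∀ t ∈ Icc 0 T, f t p = g p + ∫ s in Ioc 0 t, nl s (f s) p

theorem lintegral_lt_top_of_sn {N : ℝ × ℝ → ℝ≥0∞} (hNm : Measurable N) (hN : ∀ n, sn N n < ⊤) :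
    ∫⁻ p, N p < ⊤ := by
  refine lt_of_le_of_lt ?_ (ENNReal.mul_lt_top (ENNReal.pow_lt_top sobConst_lt_top (n := 2))
    (ENNReal.add_lt_top.2 ⟨ENNReal.add_lt_top.2 ⟨hN 0,
      ENNReal.mul_lt_top (by simp : (2 : ℝ≥0∞) < ⊤) (hN (0 + 1))⟩, hN (0 + 2)⟩))
  simpa using lintegral_rad_pow_le hNm 0

theorem Hermitian.shear {b : ℝ × ℝ → ℂ} (hb : Hermitian b) (t : ℝ) : Hermitian (shear t b) :=
  fun p => by
    have h : shearMap t (-p) = -shearMap t p := by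
      simp only [shearMap_apply]
      ext <;> simp
      ring
    rw [ScreenedVP.shear, h, hb, ScreenedVP.shear]

theorem Hermitian.syn_eq {b : ℝ × ℝ → ℂ} (hb : Hermitian b) (hi : Integrable b) (z : ℝ × ℝ) :
    syn b z = (rsyn b z : ℂ) := by
  have h : herm b = b := by
    ext p
    have h1 : star (b (-p)) = b p := by
      rw [hb p, ← starRingEnd_apply, Complex.conj_conj]
    rw [herm, h1]
    ring
  have := syn_herm hi z
  rwa [h] at this

namespace Flow

variable {T : ℝ} {g : ℝ × ℝ → ℂ} {f : ℝ → ℝ × ℝ → ℂ}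

theorem measurable_at (h : Flow T g f) (t : ℝ) : Measurable (f t) :=
  h.measurable.comp measurable_prodMk_left

theorem contFamily (h : Flow T g f) : ContFamily (Icc 0 T) f := by
  obtain ⟨N, hNm, hN, hle, hnl⟩ := h.exists_maj
  refine ⟨h.measurable_at, ⟨N, hNm, hN, hle⟩, ?_⟩
  filter_upwards [h.eq, ae_lt_top hNm (lintegral_lt_top_of_sn hNm hN).ne] with p hp hNp
  have hm : Measurable fun s => nl s (f s) p :=
    measurable_nl_comp h.measurable measurable_id measurable_const
  have hi : IntegrableOn (fun s => nl s (f s) p) (Icc 0 T) := by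
    rw [integrableOn_Icc_iff_integrableOn_Ioc]
    exact ⟨hm.aestronglyMeasurable, (hnl p).trans_lt hNp⟩
  refine ContinuousOn.congr (f := fun t => g p + ∫ s in Ioc 0 t, nl s (f s) p) ?_ hp
  exact continuousOn_const.add (intervalIntegral.continuousOn_primitive hi)

theorem abs_le (_h : Flow T g f) : ∀ s ∈ Icc 0 T, |s| ≤ T := fun s hs => by
  rw [abs_of_nonneg hs.1]; exact hs.2

theorem rapid (h : Flow T g f) {t : ℝ} (ht : t ∈ Icc 0 T) : Rapid (f t) := h.contFamily.rapid ht

theorem rapid_linSym (h : Flow T g f) {t : ℝ} (ht : t ∈ Icc 0 T) : Rapid (linSym t (f t)) :=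
  (h.contFamily.linSym h.abs_le).rapid ht

/-- The solution of the Vlasov equation built from the profile. -/
def mu (f : ℝ → ℝ × ℝ → ℂ) (t : ℝ) : ℝ × ℝ → ℝ := rsyn (shear t (f t))

/-- The potential built from the profile. -/
def phi (f : ℝ → ℝ × ℝ → ℂ) (t : ℝ) : ℝ → ℝ := potential (rhoHat t (f t))

theorem mu_apply (f : ℝ → ℝ × ℝ → ℂ) (t x v : ℝ) : mu f t (x, v) = rsyn (f t) (x - t * v, v) := by
  rw [mu, rsyn, syn_shear, rsyn]

theorem syn_shear_eq (h : Flow T g f) {t : ℝ} (ht : t ∈ Icc 0 T) (z : ℝ × ℝ) :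
    syn (shear t (f t)) z = (mu f t z : ℂ) :=
  ((h.hermitian t).shear t).syn_eq ((h.rapid ht).shear t).integrable z

theorem dx_mu (h : Flow T g f) {t : ℝ} (ht : t ∈ Icc 0 T) (x v : ℝ) :
    dx (mu f t) (x, v) = rsyn (mulX (f t)) (x - t * v, v) := by
  rw [mu, dx_rsyn ((h.rapid ht).shear t), mulX_shear, rsyn, syn_shear, rsyn]

theorem dv_mu (h : Flow T g f) {t : ℝ} (ht : t ∈ Icc 0 T) (x v : ℝ) :
    dv (mu f t) (x, v) = rsyn (linSym t (f t)) (x - t * v, v) := by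
  rw [mu, dv_rsyn ((h.rapid ht).shear t), mulV_shear, rsyn, syn_shear, rsyn]

theorem density (h : Flow T g f) {t : ℝ} (ht : t ∈ Icc 0 T) (x : ℝ) :
    (Integrable fun v => mu f t (x, v) ^ 2) ∧
      ∫ v, mu f t (x, v) ^ 2 = (lineSyn (rhoHat t (f t)) x).re := by
  have h1 := integral_norm_sq_syn ((h.rapid ht).shear t) x
  have e : ∀ v, ‖syn (shear t (f t)) (x, v)‖ ^ 2 = mu f t (x, v) ^ 2 := fun v => by
    rw [h.syn_shear_eq ht, Complex.norm_real, Real.norm_eq_abs, sq_abs]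
  have e2 : rhoHat 0 (shear t (f t)) = rhoHat t (f t) := funext (rhoHat_shear t (f t))
  simp only [e, e2] at h1
  exact ⟨h1.1, by rw [← h1.2, Complex.ofReal_re]⟩

theorem poisson (h : Flow T g f) {t : ℝ} (ht : t ∈ Icc 0 T) (x : ℝ) :
    phi f t x - deriv (deriv (phi f t)) x = ∫ v, mu f t (x, v) ^ 2 := by
  rw [phi, potential_sub_deriv ((h.rapid ht).integrable_rhoHat t), (h.density ht x).2]

theorem memLp_mu (h : Flow T g f) {t : ℝ} (ht : t ∈ Icc 0 T) : MemLp (mu f t) 2 := by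
  have hr := (h.rapid ht).shear t
  exact ⟨(contDiff_rsyn hr).continuous.aestronglyMeasurable,
    (eLpNorm_rsyn_le hr).trans_lt hr.memLp.2⟩

theorem derivNorm_sub_le (h : Flow T g f) (i j : ℕ) {s t : ℝ} (hs : s ∈ Icc 0 T)
    (ht : t ∈ Icc 0 T) : derivNorm i j (fun p => mu f s p - mu f t p) ≤
      eLpNorm (fun z => syn (shear s ((linSym s)^[j] (mulX^[i] (f s)))) z -
        syn (shear t ((linSym t)^[j] (mulX^[i] (f t)))) z) 2 volume := by
  have hrs := (h.rapid hs).shear s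
  have hrt := (h.rapid ht).shear t
  set b : ℝ × ℝ → ℂ := fun p => shear s (f s) p - shear t (f t) p with hb
  have hsub : ∀ {a c : ℝ × ℝ → ℂ}, Integrable a → Integrable c → ∀ z,
      syn (fun p => a p - c p) z = syn a z - syn c z := fun ha hc z => by
    unfold syn
    rw [← integral_sub (integrable_ech_mul ha (by fun_prop)) (integrable_ech_mul hc (by fun_prop))]
    refine integral_congr_ae (Eventually.of_forall fun p => ?_)
    simp only
    ring
  have hrb : Rapid b := by
    have hr := measurable_rad
    have m1 := hrs.measurable
    have m2 := hrt.measurable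
    refine ⟨m1.sub m2, fun n => ?_⟩
    refine lt_of_le_of_lt (le_trans (l2_mono fun p => ?_)
      (l2_add_le volume (F := fun p => rad p ^ n * ‖shear s (f s) p‖ₑ)
        (G := fun p => rad p ^ n * ‖shear t (f t) p‖ₑ) (by fun_prop) (by fun_prop)))
      (ENNReal.add_lt_top.2 ⟨hrs.sn_lt_top n, hrt.sn_lt_top n⟩)
    rw [← mul_add]
    gcongr
    exact enorm_sub_le
  have e1 : (fun p => mu f s p - mu f t p) = rsyn b := by
    ext z
    rw [rsyn, hsub hrs.integrable hrt.integrable, Complex.sub_re]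
    rfl
  have e2 : mulV^[j] (mulX^[i] b) = fun p => shear s ((linSym s)^[j] (mulX^[i] (f s))) p -
      shear t ((linSym t)^[j] (mulX^[i] (f t))) p := by
    ext p
    rw [← iterate_mul_shear, ← iterate_mul_shear]
    simp only [iterate_mulV, iterate_mulX, hb]
    ring
  have i1 := ((h.contFamily.iterate h.abs_le i j).rapid hs).shear s
  have i2 := ((h.contFamily.iterate h.abs_le i j).rapid ht).shear t
  rw [e1]
  refine (derivNorm_le_of_smooth (contDiff_rsyn hrb) i j).trans ?_
  rw [iterate_deriv_rsyn hrb, e2]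
  refine eLpNorm_mono fun z => ?_
  rw [← hsub i1.integrable i2.integrable]
  exact Complex.abs_re_le_norm _

theorem tendsto_derivNorm_sub (h : Flow T g f) (i j : ℕ) {t : ℝ} (ht : t ∈ Icc 0 T) :
    Tendsto (fun s => derivNorm i j (fun p => mu f s p - mu f t p)) (𝓝[Icc 0 T] t) (𝓝 0) := by
  refine tendsto_of_tendsto_of_tendsto_of_le_of_le' tendsto_const_nhds
    ((h.contFamily.iterate h.abs_le i j).tendsto_eLpNorm_sub ht)
    (Eventually.of_forall fun _ => zero_le) ?_
  filter_upwards [self_mem_nhdsWithin] with s hs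
  exact h.derivNorm_sub_le i j hs ht

theorem tendsto_sobolevNorm_sub (h : Flow T g f) (k : ℕ) {t : ℝ} (ht : t ∈ Icc 0 T) :
    Tendsto (fun s => sobolevNorm k (fun p => mu f s p - mu f t p)) (𝓝[Icc 0 T] t) (𝓝 0) := by
  unfold sobolevNorm
  have := tendsto_finsetSum (Finset.range (k + 1)) fun i _ =>
    tendsto_finsetSum (Finset.range (k + 1 - i)) fun j _ => h.tendsto_derivNorm_sub i j ht
  simpa using this

theorem sobolevNorm_lt_top (h : Flow T g f) (k : ℕ) {t : ℝ} (ht : t ∈ Icc 0 T) :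
    sobolevNorm k (mu f t) < ⊤ := by
  unfold sobolevNorm
  have hr := (h.rapid ht).shear t
  exact ENNReal.sum_lt_top.2 fun i _ => ENNReal.sum_lt_top.2 fun j _ =>
    (derivNorm_rsyn_le hr i j).trans_lt (hr.sn_lt_top _)

end Flow

/-! ### Dependence of the field on the density -/

section FieldDiff

variable {a b : ℝ × ℝ → ℝ}

theorem lintegral_enorm_sq_sub_le (ha : MemLp a 2) (hb : MemLp b 2) :
    ∫⁻ p, ‖a p ^ 2 - b p ^ 2‖ₑ ≤
      eLpNorm (fun p => a p - b p) 2 volume * eLpNorm (fun p => a p + b p) 2 volume := by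
  have h1 : ∫⁻ p, ‖a p ^ 2 - b p ^ 2‖ₑ = ∫⁻ p, ‖a p - b p‖ₑ * ‖a p + b p‖ₑ := by
    refine lintegral_congr fun p => ?_
    rw [← enorm_mul]
    congr 1
    ring
  rw [h1]
  have h2 := ENNReal.lintegral_mul_le_Lp_mul_Lq (μ := (volume : Measure (ℝ × ℝ)))
    Real.HolderConjugate.two_two (ha.1.sub hb.1).enorm (ha.1.add hb.1).enorm
  rw [eLpNorm_eq_l2, eLpNorm_eq_l2]
  simpa [l2] using h2

theorem integral_abs_density_sub_le (ha : MemLp a 2) (hb : MemLp b 2) :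
    (Integrable fun x => (∫ v, a (x, v) ^ 2) - ∫ v, b (x, v) ^ 2) ∧
      ∫ x, |(∫ v, a (x, v) ^ 2) - ∫ v, b (x, v) ^ 2| ≤
        (eLpNorm (fun p => a p - b p) 2 volume *
          eLpNorm (fun p => a p + b p) 2 volume).toReal := by
  have ia : Integrable (fun p => a p ^ 2) ((volume : Measure ℝ).prod volume) := ha.integrable_sq
  have ib : Integrable (fun p => b p ^ 2) ((volume : Measure ℝ).prod volume) := hb.integrable_sq
  have iab := ia.sub ib
  refine ⟨ia.integral_prod_left.sub ib.integral_prod_left, ?_⟩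
  have hfin : eLpNorm (fun p => a p - b p) 2 volume * eLpNorm (fun p => a p + b p) 2 volume ≠ ⊤ :=
    ENNReal.mul_ne_top (ha.sub hb).2.ne (ha.add hb).2.ne
  calc ∫ x, |(∫ v, a (x, v) ^ 2) - ∫ v, b (x, v) ^ 2|
      ≤ ∫ x, ∫ v, |a (x, v) ^ 2 - b (x, v) ^ 2| := by
        refine integral_mono_ae (ia.integral_prod_left.sub ib.integral_prod_left).abs
          iab.abs.integral_prod_left ?_
        filter_upwards [ia.prod_right_ae, ib.prod_right_ae] with x hx hx'
        rw [← integral_sub hx hx']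
        exact abs_integral_le_integral_abs
    _ = ∫ p, |a p ^ 2 - b p ^ 2| := (integral_prod _ iab.abs).symm
    _ = (∫⁻ p, ‖a p ^ 2 - b p ^ 2‖ₑ).toReal := integral_norm_eq_lintegral_enorm iab.1
    _ ≤ _ := ENNReal.toReal_mono hfin (lintegral_enorm_sq_sub_le ha hb)

/-- The difference of two bounded potentials solves the screened equation with the difference of
densities as source, and `a² - b² = (a - b)(a + b)` bounds the latter in `L¹`. Any bounded solution
is allowed, so it serves both the constructed and the arbitrary solutions. -/
theorem abs_potential_sub_le (ha : MemLp a 2) (hb : MemLp b 2) {φ ψ : ℝ → ℝ} (hφ : ContDiff ℝ 2 φ)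
    (hψ : ContDiff ℝ 2 ψ) (hφM : ∃ M : ℝ, ∀ x, |φ x| ≤ M) (hψM : ∃ M : ℝ, ∀ x, |ψ x| ≤ M)
    (hφe : ∀ x, φ x - deriv (deriv φ) x = ∫ v, a (x, v) ^ 2)
    (hψe : ∀ x, ψ x - deriv (deriv ψ) x = ∫ v, b (x, v) ^ 2) (x : ℝ) :
    |φ x - ψ x| ≤ (eLpNorm (fun p => a p - b p) 2 volume *
          eLpNorm (fun p => a p + b p) 2 volume).toReal ∧
    |deriv φ x - deriv ψ x| ≤ (eLpNorm (fun p => a p - b p) 2 volume *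
          eLpNorm (fun p => a p + b p) 2 volume).toReal := by
  obtain ⟨M, hM⟩ := hφM
  obtain ⟨M', hM'⟩ := hψM
  obtain ⟨hi, hle⟩ := integral_abs_density_sub_le ha hb
  have hd : ∀ {u : ℝ → ℝ}, ContDiff ℝ 2 u → Differentiable ℝ u ∧ Differentiable ℝ (deriv u) :=
    fun {u} hu => by
      refine ⟨hu.differentiable (by simp), ?_⟩
      rw [show (2 : WithTop ℕ∞) = 1 + 1 from rfl, contDiff_succ_iff_deriv] at hu
      exact hu.2.2.differentiable (by simp)
  have e1 : deriv (fun x => φ x - ψ x) = fun x => deriv φ x - deriv ψ x :=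
    funext fun x => deriv_fun_sub ((hd hφ).1 x) ((hd hψ).1 x)
  have e2 : deriv (deriv fun x => φ x - ψ x) = fun x => deriv (deriv φ) x - deriv (deriv ψ) x := by
    rw [e1]
    exact funext fun x => deriv_fun_sub ((hd hφ).2 x) ((hd hψ).2 x)
  have e3 : (fun x => φ x - ψ x - deriv (deriv fun x => φ x - ψ x) x) =
      fun x => (∫ v, a (x, v) ^ 2) - ∫ v, b (x, v) ^ 2 := by
    ext x
    rw [← hφe, ← hψe, e2]
    ring
  have h := abs_le_of_screened (ψ := fun x => φ x - ψ x) (hφ.sub hψ) (M := M + M')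
    (fun x => (abs_sub _ _).trans (add_le_add (hM x) (hM' x))) (by rw [e3]; exact hi) x
  have e4 : ∫ y, |φ y - ψ y - deriv (deriv fun x => φ x - ψ x) y| =
      ∫ x, |(∫ v, a (x, v) ^ 2) - ∫ v, b (x, v) ^ 2| :=
    congrArg (fun u : ℝ → ℝ => ∫ y, |u y|) e3
  rw [e4, e1] at h
  exact ⟨h.1.trans hle, h.2.trans hle⟩

end FieldDiff

/-! ### The profile equation and the transport equation in physical variables -/

namespace Flow

variable {T : ℝ} {g : ℝ × ℝ → ℂ} {f : ℝ → ℝ × ℝ → ℂ}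

theorem abs_deriv_phi_sub_le (h : Flow T g f) {s t : ℝ} (hs : s ∈ Icc 0 T) (ht : t ∈ Icc 0 T)
    (x : ℝ) : |deriv (phi f s) x - deriv (phi f t) x| ≤
      (eLpNorm (fun p => mu f s p - mu f t p) 2 volume *
        eLpNorm (fun p => mu f s p + mu f t p) 2 volume).toReal :=
  (abs_potential_sub_le (h.memLp_mu hs) (h.memLp_mu ht)
    (contDiff_potential ((h.rapid hs).integrable_rhoHat s))
    (contDiff_potential ((h.rapid ht).integrable_rhoHat t)) (abs_potential_le _)
    (abs_potential_le _) (h.poisson hs) (h.poisson ht) x).2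

theorem tendsto_eLpNorm_mu_sub (h : Flow T g f) {t : ℝ} (ht : t ∈ Icc 0 T) :
    Tendsto (fun s => eLpNorm (fun p => mu f s p - mu f t p) 2 volume) (𝓝[Icc 0 T] t) (𝓝 0) := by
  refine tendsto_of_tendsto_of_tendsto_of_le_of_le tendsto_const_nhds
    (h.contFamily.tendsto_eLpNorm_sub ht) (fun _ => zero_le) fun s => eLpNorm_mono fun z => ?_
  have : mu f s z - mu f t z = (syn (shear s (f s)) z - syn (shear t (f t)) z).re :=
    (Complex.sub_re _ _).symm
  rw [this]
  exact Complex.abs_re_le_norm _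

theorem exists_eLpNorm_mu_le (h : Flow T g f) :
    ∃ B : ℝ≥0∞, B < ⊤ ∧ ∀ t ∈ Icc 0 T, eLpNorm (mu f t) 2 volume ≤ B := by
  obtain ⟨N, hNm, hN, hle, -⟩ := h.exists_maj
  refine ⟨l2 volume N, by simpa [sn] using hN 0, fun t ht => ?_⟩
  refine (eLpNorm_rsyn_le ((h.rapid ht).shear t)).trans ?_
  rw [eLpNorm_shear t (h.measurable_at t), eLpNorm_eq_l2]
  exact l2_mono (hle t ht)

/-- The change of the field in time is bounded uniformly in position, so continuity in each variable
gives joint continuity. -/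
theorem tendsto_deriv_phi (h : Flow T g f) {t : ℝ} (ht : t ∈ Icc 0 T) (x : ℝ) :
    Tendsto (fun y : ℝ × ℝ => deriv (phi f y.1) y.2) (𝓝[Icc 0 T] t ×ˢ 𝓝 x)
      (𝓝 (deriv (phi f t) x)) := by
  obtain ⟨B, hB, hle⟩ := h.exists_eLpNorm_mu_le
  have h1 : Tendsto (fun y : ℝ × ℝ => deriv (phi f t) y.2) (𝓝[Icc 0 T] t ×ˢ 𝓝 x)
      (𝓝 (deriv (phi f t) x)) := by
    have hc : Continuous (deriv (phi f t)) :=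
      (contDiff_potential ((h.rapid ht).integrable_rhoHat t)).continuous_deriv (by simp)
    exact (hc.tendsto x).comp tendsto_snd
  have h2 : Tendsto (fun y : ℝ × ℝ => deriv (phi f y.1) y.2 - deriv (phi f t) y.2)
      (𝓝[Icc 0 T] t ×ˢ 𝓝 x) (𝓝 0) := by
    have h3 : Tendsto (fun s => (eLpNorm (fun p => mu f s p - mu f t p) 2 volume *
        (B + B)).toReal) (𝓝[Icc 0 T] t) (𝓝 0) := by
      have hBB : B + B ≠ ⊤ := ENNReal.add_ne_top.2 ⟨hB.ne, hB.ne⟩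
      have := ENNReal.Tendsto.mul_const (h.tendsto_eLpNorm_mu_sub ht) (b := B + B) (Or.inr hBB)
      rw [zero_mul] at this
      exact (ENNReal.tendsto_toReal (by simp : (0 : ℝ≥0∞) ≠ ⊤)).comp this
    refine squeeze_zero_norm' ?_ (h3.comp tendsto_fst)
    filter_upwards [tendsto_fst.eventually (self_mem_nhdsWithin (s := Icc 0 T) (a := t))] with y hy
    refine (h.abs_deriv_phi_sub_le hy ht y.2).trans (ENNReal.toReal_mono ?_ ?_)
    · exact ENNReal.mul_ne_top ((h.memLp_mu hy).sub (h.memLp_mu ht)).2.ne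
        (ENNReal.add_ne_top.2 ⟨hB.ne, hB.ne⟩)
    · refine mul_le_mul_right ?_ _
      refine (eLpNorm_add_le (h.memLp_mu hy).1 (h.memLp_mu ht).1 one_le_two).trans ?_
      exact add_le_add (hle _ hy) (hle _ ht)
  simpa using h1.add h2

theorem duhamel_syn (h : Flow T g f) (hg : Integrable g) (z : ℝ × ℝ) :
    IntegrableOn (fun s => syn (nl s (f s)) z) (Ioc 0 T) ∧
      ∀ t ∈ Icc 0 T, syn (f t) z = syn g z + ∫ s in Ioc 0 t, syn (nl s (f s)) z := by
  obtain ⟨N, hNm, hN, -, hnl⟩ := h.exists_maj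
  have hm : Measurable fun x : ℝ × ℝ × ℝ => nl x.1 (f x.1) x.2 :=
    measurable_nl_comp h.measurable measurable_fst measurable_snd
  have hi0 : Integrable (fun x : ℝ × ℝ × ℝ => nl x.1 (f x.1) x.2)
      ((volume.restrict (Ioc 0 T)).prod volume) := by
    refine ⟨hm.aestronglyMeasurable, ?_⟩
    rw [HasFiniteIntegral, lintegral_prod_symm _ hm.enorm.aemeasurable]
    exact (lintegral_mono hnl).trans_lt (lintegral_lt_top_of_sn hNm hN)
  have hi := integrable_ech_mul hi0 (θ := fun x => x.2.1 * z.1 + x.2.2 * z.2) (by fun_prop)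
  refine ⟨hi.integral_prod_left, fun t ht => ?_⟩
  have hsub : Ioc 0 t ⊆ Ioc 0 T := Ioc_subset_Ioc_right ht.2
  have hit : Integrable (fun x : ℝ × ℝ × ℝ =>
      ech (x.2.1 * z.1 + x.2.2 * z.2) * nl x.1 (f x.1) x.2)
      ((volume.restrict (Ioc 0 t)).prod volume) :=
    hi.mono_measure (Measure.prod_mono (Measure.restrict_mono hsub le_rfl) le_rfl)
  have h1 : ∫ s in Ioc 0 t, syn (nl s (f s)) z =
      ∫ p : ℝ × ℝ, ech (p.1 * z.1 + p.2 * z.2) * ∫ s in Ioc 0 t, nl s (f s) p := by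
    unfold syn
    refine (integral_integral_swap hit).trans ?_
    simp only [integral_const_mul]
  have hi2 : Integrable fun p : ℝ × ℝ =>
      ech (p.1 * z.1 + p.2 * z.2) * ∫ s in Ioc 0 t, nl s (f s) p := by
    have := hit.integral_prod_right
    simpa only [integral_const_mul] using this
  rw [h1, syn, syn, ← integral_add (integrable_ech_mul hg (by fun_prop)) hi2]
  refine integral_congr_ae ?_
  filter_upwards [h.eq] with p hp
  rw [hp t ht, mul_add]

/-- The time derivative of the profile. -/
def rate (f : ℝ → ℝ × ℝ → ℂ) (t : ℝ) (z : ℝ × ℝ) : ℝ :=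
  deriv (phi f t) (z.1 + t * z.2) * rsyn (linSym t (f t)) z

theorem re_syn_nl (h : Flow T g f) {t : ℝ} (ht : t ∈ Icc 0 T) (z : ℝ × ℝ) :
    (syn (nl t (f t)) z).re = rate f t z := by
  have hr := (h.rapid ht).integrable_rhoHat t
  have hl := (h.rapid_linSym ht).integrable
  have h1 := syn_nl hr hl z.1 z.2
  rw [((h.hermitian t).linSym t).syn_eq hl] at h1
  rw [rate, phi, deriv_potential hr, ← Complex.re_mul_ofReal]
  exact congrArg Complex.re h1

theorem profile_sub (h : Flow T g f) (hg : Integrable g) (z : ℝ × ℝ) {s t : ℝ}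
    (hs : s ∈ Icc 0 T) (ht : t ∈ Icc 0 T) :
    IntervalIntegrable (fun τ => rate f τ z) volume t s ∧
      rsyn (f s) z - rsyn (f t) z = ∫ τ in t..s, rate f τ z := by
  obtain ⟨hi, heq⟩ := h.duhamel_syn hg z
  have hi' : IntegrableOn (fun τ => rate f τ z) (Ioc 0 T) := by
    refine IntegrableOn.congr_fun (f := fun τ => (syn (nl τ (f τ)) z).re) hi.re
      (fun τ hτ => ?_) measurableSet_Ioc
    exact h.re_syn_nl (Ioc_subset_Icc_self hτ) z
  have hI : ∀ r ∈ Icc 0 T, IntervalIntegrable (fun τ => rate f τ z) volume 0 r := fun r hr => by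
    rw [intervalIntegrable_iff_integrableOn_Ioc_of_le hr.1]
    exact hi'.mono_set (Ioc_subset_Ioc_right hr.2)
  have hre : ∀ r ∈ Icc 0 T, rsyn (f r) z = (syn g z).re + ∫ τ in 0..r, rate f τ z := fun r hr => by
    rw [rsyn, heq r hr, Complex.add_re, intervalIntegral.integral_of_le hr.1]
    congr 1
    have h1 := integral_re (𝕜 := ℂ) (hi.mono_set (Ioc_subset_Ioc_right hr.2) : Integrable _ _)
    refine h1.symm.trans (setIntegral_congr_fun measurableSet_Ioc fun τ hτ => ?_)
    exact h.re_syn_nl ⟨hτ.1.le, hτ.2.trans hr.2⟩ z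
  refine ⟨(hI t ht).symm.trans (hI s hs), ?_⟩
  rw [hre s hs, hre t ht, add_sub_add_left_eq_sub,
    intervalIntegral.integral_interval_sub_left (hI s hs) (hI t ht)]

theorem tendsto_rate (h : Flow T g f) {t : ℝ} (ht : t ∈ Icc 0 T) (z : ℝ × ℝ) :
    Tendsto (fun x : ℝ × ℝ × ℝ => rate f x.1 x.2) (𝓝[Icc 0 T] t ×ˢ 𝓝 z) (𝓝 (rate f t z)) := by
  have h1 : Tendsto (fun x : ℝ × ℝ × ℝ => x.2.1 + x.1 * x.2.2) (𝓝[Icc 0 T] t ×ˢ 𝓝 z)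
      (𝓝 (z.1 + t * z.2)) := by
    have hc : Continuous fun x : ℝ × ℝ × ℝ => x.2.1 + x.1 * x.2.2 := by fun_prop
    have := hc.tendsto (t, z)
    rw [nhds_prod_eq] at this
    exact this.mono_left (Filter.prod_mono_left _ nhdsWithin_le_nhds)
  have h2 := (h.tendsto_deriv_phi ht (z.1 + t * z.2)).comp (tendsto_fst.prodMk h1)
  have h3 := (Complex.continuous_re.tendsto _).comp
    ((h.contFamily.linSym h.abs_le).tendsto_syn ht z)
  exact h2.mul h3

/-- The evaluation point moves with time. The increment is an integral of `rate` at the moved point,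
and joint continuity of `rate` makes its mean converge to the value at the limit point. -/
theorem hasDerivWithinAt_profile (h : Flow T g f) (hg : Integrable g) {t : ℝ} (ht : t ∈ Icc 0 T)
    {ζ : ℝ → ℝ × ℝ} (hζ : ContinuousAt ζ t) :
    HasDerivWithinAt (fun s => rsyn (f s) (ζ s) - rsyn (f t) (ζ s)) (rate f t (ζ t)) (Icc 0 T) t := by
  rw [hasDerivWithinAt_iff_isLittleO, Asymptotics.isLittleO_iff]
  intro ε hε
  have h1 := (Metric.tendsto_nhds.1 (h.tendsto_rate ht (ζ t))) ε hε
  obtain ⟨pa, hpa, pb, hpb, hab⟩ := eventually_prod_iff.1 h1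
  obtain ⟨δ, hδ, hball⟩ := Metric.mem_nhdsWithin_iff.1 hpa
  have h2 : ∀ᶠ s in 𝓝[Icc 0 T] t, pb (ζ s) := (hζ.eventually hpb).filter_mono nhdsWithin_le_nhds
  have h3 : ∀ᶠ s in 𝓝[Icc 0 T] t, s ∈ Metric.ball t δ :=
    mem_nhdsWithin_of_mem_nhds (Metric.ball_mem_nhds t hδ)
  filter_upwards [h2, h3, self_mem_nhdsWithin] with s hs hsδ hsI
  obtain ⟨hi, he⟩ := h.profile_sub hg (ζ s) hsI ht
  have e : rsyn (f s) (ζ s) - rsyn (f t) (ζ s) - (rsyn (f t) (ζ t) - rsyn (f t) (ζ t)) -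
      (s - t) • rate f t (ζ t) = ∫ τ in t..s, (rate f τ (ζ s) - rate f t (ζ t)) := by
    rw [intervalIntegral.integral_sub hi intervalIntegrable_const, ← he,
      intervalIntegral.integral_const]
    ring
  rw [e, Real.norm_eq_abs (s - t)]
  refine intervalIntegral.norm_integral_le_of_norm_le_const fun τ hτ => ?_
  have hτ' : τ ∈ uIcc t s := uIoc_subset_uIcc hτ
  have hτI : τ ∈ Icc 0 T := (uIcc_subset_Icc ht hsI) hτ'
  have hτδ : τ ∈ Metric.ball t δ :=
    (convex_ball t δ).ordConnected.uIcc_subset (Metric.mem_ball_self hδ) hsδ hτ'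
  exact (hab (hball ⟨hτδ, hτI⟩) hs).le

/-- At the moving point `(x - s v, v)` the change of the solution splits into the change of the
profile, which gives the field term, and the motion of the point in the profile frozen at time `t`,
which gives `-v ∂_x`. -/
theorem transport (h : Flow T g f) (hg : Integrable g) {t : ℝ} (ht : t ∈ Icc 0 T) (x v : ℝ) :
    HasDerivWithinAt (fun s => mu f s (x, v))
      (-(v * dx (mu f t) (x, v)) + deriv (phi f t) x * dv (mu f t) (x, v)) (Icc 0 T) t := by
  have h1 := h.hasDerivWithinAt_profile hg ht (ζ := fun s => (x - s * v, v)) (by fun_prop)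
  have hζ : HasDerivAt (fun s => x - s * v) (-v) t := by
    simpa using ((hasDerivAt_id t).mul_const v).const_sub x
  have h2 : HasDerivAt (fun s => rsyn (f t) (x - s * v, v))
      (rsyn (mulX (f t)) (x - t * v, v) * -v) t :=
    (hasDerivAt_rsyn_fst (h.rapid ht) (x - t * v) v).comp (h₂ := fun y => rsyn (f t) (y, v)) t hζ
  have h3 := h1.add h2.hasDerivWithinAt
  have e1 : (fun s => mu f s (x, v)) = fun s =>
      rsyn (f s) (x - s * v, v) - rsyn (f t) (x - s * v, v) + rsyn (f t) (x - s * v, v) := by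
    ext s
    rw [mu_apply, sub_add_cancel]
  rw [e1]
  refine h3.congr_deriv ?_
  rw [h.dx_mu ht, h.dv_mu ht, rate]
  simp only [sub_add_cancel]
  ring

theorem isSolution (h : Flow T g f) (hg : Integrable g) {μ₀ : ℝ × ℝ → ℝ} (hT : 0 ≤ T)
    (h0 : rsyn g =ᵐ[volume] μ₀) : IsSolution T μ₀ (mu f) (phi f) where
  initial := by
    refine EventuallyEq.trans (Eventually.of_forall fun z => ?_) h0
    obtain ⟨x, v⟩ := z
    rw [mu_apply, zero_mul, sub_zero, rsyn, ((h.duhamel_syn hg (x, v)).2 0 ⟨le_rfl, hT⟩), rsyn]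
    simp
  smooth t ht := contDiff_rsyn ((h.rapid ht).shear t)
  mem_sobolev t ht k := h.sobolevNorm_lt_top k ht
  continuous_sobolev t ht k := h.tendsto_sobolevNorm_sub k ht
  transport t ht x v := h.transport hg ht x v
  density_integrable t ht x := (h.density ht x).1
  potential_smooth t ht := contDiff_potential ((h.rapid ht).integrable_rhoHat t)
  potential_bounded t _ := abs_potential_le _
  poisson t ht x := h.poisson ht x

theorem profile_mu (f : ℝ → ℝ × ℝ → ℂ) (t : ℝ) : profile (mu f) t = rsyn (f t) := by
  ext ⟨x, v⟩
  rw [profile, mu_apply, add_sub_cancel_right]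

end Flow

/-- The limit of the Picard iterates is a rapidly decaying solution. -/
theorem flow_sol {T : ℝ} {g : ℝ × ℝ → ℂ} (hg : Measurable g) (hh : Hermitian g)
    (h : ∀ n, sn (majLim (fun p => ‖g p‖ₑ) T) n < ⊤) : Flow T g (sol g) := by
  have hm : Measurable (majLim (fun p => ‖g p‖ₑ) T) :=
    (measurable_majLim hg.enorm).comp measurable_prodMk_left
  have hle : ∀ s ∈ Icc 0 T, ∀ p, ‖sol g s p‖ₑ ≤ majLim (fun p => ‖g p‖ₑ) s p := fun s _ p =>
    enorm_sol_le hg s p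
  -- The majorant increases in time, so its value at `T` serves as the common majorant on `[0, T]`.
  refine ⟨measurable_sol hg, hermitian_sol hg hh, ⟨_, hm, h, fun s hs p =>
    (hle s hs p).trans (majLim_mono_time _ hs.2 p), fun p => ?_⟩, ?_⟩
  · refine le_trans ?_ (le_add_self.trans (duhamelMaj_majLim_le hg.enorm T p))
    refine lintegral_mono fun s => ?_
    have hs : Measurable (sol g s) := (measurable_sol hg).comp measurable_prodMk_left
    exact (dom_nl hs hs (fun p => Dom.refl (enorm_sol_le hg s p)) s p).left
  · filter_upwards [ae_lt_top hm (lintegral_lt_top_of_sn hm h).ne] with p hp t ht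
    exact sol_eq_duhamel hg ((majLim_mono_time _ ht.2 p).trans_lt hp)

/-! ### Regularity of arbitrary solutions -/

theorem integral_sq_eq {α : Type*} [MeasurableSpace α] {μ : Measure α} {w : α → ℝ}
    (hw : MemLp w 2 μ) : ∫ z, w z ^ 2 ∂μ = (eLpNorm w 2 μ).toReal ^ 2 := by
  have hm : AEStronglyMeasurable (fun z => w z ^ 2) μ := hw.1.pow 2
  rw [integral_eq_lintegral_of_nonneg_ae (Eventually.of_forall fun z => sq_nonneg _) hm,
    ← ENNReal.toReal_pow, eLpNorm_eq_l2, l2_sq]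
  congr 1
  refine lintegral_congr fun z => ?_
  rw [← sq_abs, ENNReal.ofReal_pow (abs_nonneg _), ← Real.norm_eq_abs, ofReal_norm]

theorem integral_abs_mul_le {α : Type*} [MeasurableSpace α] {μ : Measure α} {u w : α → ℝ}
    (hu : MemLp u 2 μ) (hw : MemLp w 2 μ) :
    ∫ z, |u z * w z| ∂μ ≤ (eLpNorm u 2 μ).toReal * (eLpNorm w 2 μ).toReal := by
  have h2 := ENNReal.lintegral_mul_le_Lp_mul_Lq μ Real.HolderConjugate.two_two hu.1.enorm hw.1.enorm
  have h3 : ∫⁻ z, ‖u z * w z‖ₑ ∂μ ≤ eLpNorm u 2 μ * eLpNorm w 2 μ := by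
    rw [eLpNorm_eq_l2, eLpNorm_eq_l2]
    simp only [enorm_mul]
    simpa [l2] using h2
  rw [← ENNReal.toReal_mul]
  refine le_trans (le_of_eq ?_) (ENNReal.toReal_mono (ENNReal.mul_ne_top hu.2.ne hw.2.ne) h3)
  exact integral_norm_eq_lintegral_enorm (hu.1.mul hw.1)

theorem dx_sub {f g : ℝ × ℝ → ℝ} (hf : ContDiff ℝ ∞ f) (hg : ContDiff ℝ ∞ g) :
    dx (fun p => f p - g p) = fun p => dx f p - dx g p := by
  have hs : Differentiable ℝ fun p => f p - g p :=
    (differentiable_of_smooth hf).sub (differentiable_of_smooth hg)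
  rw [dx_eq_fderiv hs, dx_eq_fderiv (differentiable_of_smooth hf),
    dx_eq_fderiv (differentiable_of_smooth hg)]
  ext p
  rw [fderiv_fun_sub (differentiable_of_smooth hf p) (differentiable_of_smooth hg p)]
  rfl

theorem dv_sub {f g : ℝ × ℝ → ℝ} (hf : ContDiff ℝ ∞ f) (hg : ContDiff ℝ ∞ g) :
    dv (fun p => f p - g p) = fun p => dv f p - dv g p := by
  have hs : Differentiable ℝ fun p => f p - g p :=
    (differentiable_of_smooth hf).sub (differentiable_of_smooth hg)
  rw [dv_eq_fderiv hs, dv_eq_fderiv (differentiable_of_smooth hf),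
    dv_eq_fderiv (differentiable_of_smooth hg)]
  ext p
  rw [fderiv_fun_sub (differentiable_of_smooth hf p) (differentiable_of_smooth hg p)]
  rfl

theorem hasDerivAt_dx {f : ℝ × ℝ → ℝ} (hf : ContDiff ℝ ∞ f) (x v : ℝ) :
    HasDerivAt (fun y => f (y, v)) (dx f (x, v)) x := by
  have h : Differentiable ℝ fun y => f (y, v) :=
    (differentiable_of_smooth hf).comp (by fun_prop)
  exact (h x).hasDerivAt

theorem hasDerivAt_dv {f : ℝ × ℝ → ℝ} (hf : ContDiff ℝ ∞ f) (x v : ℝ) :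
    HasDerivAt (fun w => f (x, w)) (dv f (x, v)) v := by
  have h : Differentiable ℝ fun w => f (x, w) :=
    (differentiable_of_smooth hf).comp (by fun_prop)
  exact (h v).hasDerivAt

theorem derivNorm_le_sobolevNorm {i j k : ℕ} (h : i + j ≤ k) (f : ℝ × ℝ → ℝ) :
    derivNorm i j f ≤ sobolevNorm k f := by
  unfold sobolevNorm
  refine le_trans ?_ (Finset.single_le_sum (f := fun i =>
    ∑ j ∈ Finset.range (k + 1 - i), derivNorm i j f) (fun _ _ => zero_le)
    (Finset.mem_range.2 (by omega : i < k + 1)))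
  exact Finset.single_le_sum (f := fun j => derivNorm i j f) (fun _ _ => zero_le)
    (Finset.mem_range.2 (by omega))

namespace IsSolution

variable {T : ℝ} {μ₀ : ℝ × ℝ → ℝ} {μ : ℝ → ℝ × ℝ → ℝ} {φ : ℝ → ℝ → ℝ}

theorem memLp (h : IsSolution T μ₀ μ φ) {t : ℝ} (ht : t ∈ Icc 0 T) : MemLp (μ t) 2 := by
  refine ⟨(h.smooth t ht).continuous.aestronglyMeasurable, ?_⟩
  have := derivNorm_eq_of_smooth (h.smooth t ht) 0 0
  simp only [Function.iterate_zero, id_eq] at this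
  rw [← this]
  exact (derivNorm_le_sobolevNorm (k := 0) le_rfl _).trans_lt (h.mem_sobolev t ht 0)

theorem memLp_dx (h : IsSolution T μ₀ μ φ) {t : ℝ} (ht : t ∈ Icc 0 T) : MemLp (dx (μ t)) 2 := by
  refine ⟨(contDiff_dx (h.smooth t ht)).continuous.aestronglyMeasurable, ?_⟩
  have := derivNorm_eq_of_smooth (h.smooth t ht) 1 0
  simp only [Function.iterate_zero, Function.iterate_one, id_eq] at this
  rw [← this]
  exact (derivNorm_le_sobolevNorm (k := 1) le_rfl _).trans_lt (h.mem_sobolev t ht 1)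

theorem memLp_dv (h : IsSolution T μ₀ μ φ) {t : ℝ} (ht : t ∈ Icc 0 T) : MemLp (dv (μ t)) 2 := by
  refine ⟨(contDiff_dv (h.smooth t ht)).continuous.aestronglyMeasurable, ?_⟩
  have := derivNorm_eq_of_smooth (h.smooth t ht) 0 1
  simp only [Function.iterate_zero, Function.iterate_one, id_eq] at this
  rw [← this]
  exact (derivNorm_le_sobolevNorm (k := 1) le_rfl _).trans_lt (h.mem_sobolev t ht 1)

theorem tendsto_eLpNorm_iterate_sub (h : IsSolution T μ₀ μ φ) {t : ℝ} (ht : t ∈ Icc 0 T)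
    (i j : ℕ) : Tendsto (fun s => derivNorm i j (fun p => μ s p - μ t p)) (𝓝[Icc 0 T] t) (𝓝 0) :=
  tendsto_of_tendsto_of_tendsto_of_le_of_le tendsto_const_nhds (h.continuous_sobolev t ht (i + j))
    (fun _ => zero_le) fun _ => derivNorm_le_sobolevNorm le_rfl _

theorem tendsto_eLpNorm_sub (h : IsSolution T μ₀ μ φ) {t : ℝ} (ht : t ∈ Icc 0 T) :
    Tendsto (fun s => eLpNorm (fun p => μ s p - μ t p) 2 volume) (𝓝[Icc 0 T] t) (𝓝 0) := by
  refine (h.tendsto_eLpNorm_iterate_sub ht 0 0).congr' ?_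
  filter_upwards [self_mem_nhdsWithin] with s hs
  exact derivNorm_eq_of_smooth ((h.smooth s hs).sub (h.smooth t ht)) 0 0

/-- Continuity into `L²` gives local bounds, and compactness of `[0, T]` makes them uniform. -/
theorem exists_bound_of_tendsto {u : ℝ → ℝ × ℝ → ℝ} (hu : ∀ t ∈ Icc 0 T, MemLp (u t) 2)
    (hlim : ∀ t ∈ Icc 0 T, Tendsto (fun s => eLpNorm (fun p => u s p - u t p) 2 volume)
      (𝓝[Icc 0 T] t) (𝓝 0)) :
    ∃ B : ℝ, 0 ≤ B ∧ ∀ t ∈ Icc 0 T, eLpNorm (u t) 2 volume ≤ ENNReal.ofReal B := by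
  refine isCompact_Icc.induction_on (s := Icc 0 T)
    (p := fun s => ∃ B : ℝ, 0 ≤ B ∧ ∀ t ∈ s, eLpNorm (u t) 2 volume ≤ ENNReal.ofReal B)
    ⟨0, le_rfl, by simp⟩ ?_ ?_ ?_
  · rintro s s' hss ⟨B, hB, h⟩
    exact ⟨B, hB, fun t ht => h t (hss ht)⟩
  · rintro s s' ⟨B, hB, h⟩ ⟨B', hB', h'⟩
    refine ⟨max B B', hB.trans (le_max_left _ _), fun t ht => ?_⟩
    rcases ht with ht | ht
    · exact (h t ht).trans (ENNReal.ofReal_le_ofReal (le_max_left _ _))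
    · exact (h' t ht).trans (ENNReal.ofReal_le_ofReal (le_max_right _ _))
  · intro t ht
    have h1 := (hlim t ht).eventually_lt_const (zero_lt_one)
    refine ⟨_, (eventually_mem_set.1 ?_ :
      {s | eLpNorm (u s) 2 volume ≤ ENNReal.ofReal ((eLpNorm (u t) 2 volume).toReal + 1)} ∈
        𝓝[Icc 0 T] t), _, by positivity, fun s hs => hs⟩
    filter_upwards [h1, self_mem_nhdsWithin] with s hs hsI
    have e : u s = fun p => u t p + (u s p - u t p) := by ext p; ring
    rw [ENNReal.ofReal_add ENNReal.toReal_nonneg zero_le_one, ENNReal.ofReal_toReal (hu t ht).2.ne,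
      ENNReal.ofReal_one, e]
    refine (eLpNorm_add_le (hu t ht).1 ((hu s hsI).sub (hu t ht)).1 one_le_two).trans ?_
    gcongr
    exact hs.le

theorem exists_bound (h : IsSolution T μ₀ μ φ) : ∃ B : ℝ, 0 ≤ B ∧ ∀ t ∈ Icc 0 T,
    eLpNorm (μ t) 2 volume ≤ ENNReal.ofReal B ∧ eLpNorm (dx (μ t)) 2 volume ≤ ENNReal.ofReal B ∧
      eLpNorm (dv (μ t)) 2 volume ≤ ENNReal.ofReal B := by
  obtain ⟨B₁, hB₁, h₁⟩ := exists_bound_of_tendsto (fun t ht => h.memLp ht)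
    fun t ht => h.tendsto_eLpNorm_sub ht
  obtain ⟨B₂, hB₂, h₂⟩ := exists_bound_of_tendsto (fun t ht => h.memLp_dx ht) fun t ht => by
    refine (h.tendsto_eLpNorm_iterate_sub ht 1 0).congr' ?_
    filter_upwards [self_mem_nhdsWithin] with s hs
    refine (derivNorm_eq_of_smooth ((h.smooth s hs).sub (h.smooth t ht)) 1 0).trans ?_
    exact congrArg (fun u => eLpNorm u 2 volume) (dx_sub (h.smooth s hs) (h.smooth t ht))
  obtain ⟨B₃, hB₃, h₃⟩ := exists_bound_of_tendsto (fun t ht => h.memLp_dv ht) fun t ht => by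
    refine (h.tendsto_eLpNorm_iterate_sub ht 0 1).congr' ?_
    filter_upwards [self_mem_nhdsWithin] with s hs
    refine (derivNorm_eq_of_smooth ((h.smooth s hs).sub (h.smooth t ht)) 0 1).trans ?_
    exact congrArg (fun u => eLpNorm u 2 volume) (dv_sub (h.smooth s hs) (h.smooth t ht))
  refine ⟨B₁ + B₂ + B₃, by positivity, fun t ht => ⟨(h₁ t ht).trans ?_, (h₂ t ht).trans ?_,
    (h₃ t ht).trans ?_⟩⟩ <;> exact ENNReal.ofReal_le_ofReal (by linarith)

theorem abs_deriv_potential_sub_le (h : IsSolution T μ₀ μ φ) {μ₀' : ℝ × ℝ → ℝ}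
    {μ' : ℝ → ℝ × ℝ → ℝ} {φ' : ℝ → ℝ → ℝ} (h' : IsSolution T μ₀' μ' φ') {s t : ℝ}
    (hs : s ∈ Icc 0 T) (ht : t ∈ Icc 0 T) (x : ℝ) :
    |φ s x - φ' t x| ≤ (eLpNorm (fun p => μ s p - μ' t p) 2 volume *
      eLpNorm (fun p => μ s p + μ' t p) 2 volume).toReal ∧
    |deriv (φ s) x - deriv (φ' t) x| ≤ (eLpNorm (fun p => μ s p - μ' t p) 2 volume *
      eLpNorm (fun p => μ s p + μ' t p) 2 volume).toReal :=
  abs_potential_sub_le (h.memLp hs) (h'.memLp ht) (h.potential_smooth s hs)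
    (h'.potential_smooth t ht) (h.potential_bounded s hs) (h'.potential_bounded t ht)
    (h.poisson s hs) (h'.poisson t ht) x

/-- Comparison with the zero density and the zero potential. -/
theorem abs_deriv_potential_le (h : IsSolution T μ₀ μ φ) {t : ℝ} (ht : t ∈ Icc 0 T) {B : ℝ}
    (hB : 0 ≤ B) (hle : eLpNorm (μ t) 2 volume ≤ ENNReal.ofReal B) (x : ℝ) :
    |deriv (φ t) x| ≤ B ^ 2 := by
  have h1 := (abs_potential_sub_le (h.memLp ht) (b := fun _ => 0) MemLp.zero'
    (h.potential_smooth t ht) (ψ := fun _ => 0) contDiff_const (h.potential_bounded t ht)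
    ⟨0, by simp⟩ (h.poisson t ht) (by simp) x).2
  simp only [deriv_const, sub_zero, add_zero] at h1
  refine h1.trans ?_
  rw [ENNReal.toReal_mul, ← sq]
  gcongr
  exact ENNReal.toReal_le_of_le_ofReal hB hle

theorem continuousOn_deriv_potential (h : IsSolution T μ₀ μ φ) (x : ℝ) :
    ContinuousOn (fun t => deriv (φ t) x) (Icc 0 T) := by
  obtain ⟨B, hB, hle⟩ := h.exists_bound
  intro t ht
  rw [ContinuousWithinAt, ← tendsto_sub_nhds_zero_iff]
  have h3 : Tendsto (fun s => (eLpNorm (fun p => μ s p - μ t p) 2 volume *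
      (ENNReal.ofReal B + ENNReal.ofReal B)).toReal) (𝓝[Icc 0 T] t) (𝓝 0) := by
    have := ENNReal.Tendsto.mul_const (h.tendsto_eLpNorm_sub ht)
      (b := ENNReal.ofReal B + ENNReal.ofReal B) (Or.inr (by simp))
    rw [zero_mul] at this
    exact (ENNReal.tendsto_toReal (by simp : (0 : ℝ≥0∞) ≠ ⊤)).comp this
  refine squeeze_zero_norm' ?_ h3
  filter_upwards [self_mem_nhdsWithin] with s hs
  refine (h.abs_deriv_potential_sub_le h hs ht x).2.trans (ENNReal.toReal_mono ?_ ?_)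
  · exact ENNReal.mul_ne_top ((h.memLp hs).sub (h.memLp ht)).2.ne (by simp)
  · refine mul_le_mul_right ?_ _
    refine (eLpNorm_add_le (h.memLp hs).1 (h.memLp ht).1 one_le_two).trans ?_
    exact add_le_add (hle _ hs).1 (hle _ ht).1

section Measurability

variable (hT : 0 ≤ T)

/-- Nothing is known outside `[0, T]`, so time is first projected to the interval; then the function
is continuous in time and continuous in the phase variables, hence jointly measurable. -/
theorem measurable_uncurry_proj (h : IsSolution T μ₀ μ φ) :
    Measurable fun y : ℝ × ℝ × ℝ => μ (projIcc 0 T hT y.1) y.2 := by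
  have hc : ∀ z, ContinuousOn (fun t => μ t z) (Icc 0 T) := fun z t ht =>
    (h.transport t ht z.1 z.2).continuousWithinAt
  refine (stronglyMeasurable_uncurry_of_continuous_of_stronglyMeasurable
    (u := fun t z => μ (projIcc 0 T hT t) z) (fun z => ?_) fun t => ?_).measurable
  · exact (hc z).domRestrict.comp continuous_projIcc
  · exact (h.smooth _ (projIcc 0 T hT t).2).continuous.stronglyMeasurable

theorem tendsto_difference_quotient {u : ℝ → ℝ} {u' x : ℝ} (h : HasDerivAt u u' x) :
    Tendsto (fun n : ℕ => ((n : ℝ) + 1) * (u (x + ((n : ℝ) + 1)⁻¹) - u x)) atTop (𝓝 u') := by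
  have hc : Tendsto (fun n : ℕ => ((n : ℝ) + 1)⁻¹) atTop (𝓝[≠] 0) := by
    refine tendsto_nhdsWithin_iff.2 ⟨?_, Eventually.of_forall fun n => ?_⟩
    · exact tendsto_one_div_add_atTop_nhds_zero_nat.congr fun n => by simp
    · have : (0 : ℝ) < ((n : ℝ) + 1)⁻¹ := by positivity
      exact this.ne'
  refine ((hasDerivAt_iff_tendsto_slope_zero.1 h).comp hc).congr fun n => ?_
  simp

theorem measurable_dx_proj (h : IsSolution T μ₀ μ φ) :
    Measurable fun y : ℝ × ℝ × ℝ => dx (μ (projIcc 0 T hT y.1)) y.2 := by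
  have hm := h.measurable_uncurry_proj hT
  refine measurable_of_tendsto_metrizable (f := fun (n : ℕ) (y : ℝ × ℝ × ℝ) =>
    ((n : ℝ) + 1) * (μ (projIcc 0 T hT y.1) (y.2.1 + ((n : ℝ) + 1)⁻¹, y.2.2) -
      μ (projIcc 0 T hT y.1) y.2)) (fun n => ?_) ?_
  · refine Measurable.const_mul (Measurable.sub ?_ hm) _
    exact hm.comp (by fun_prop :
      Measurable fun y : ℝ × ℝ × ℝ => (y.1, y.2.1 + ((n : ℝ) + 1)⁻¹, y.2.2))
  · rw [tendsto_pi_nhds]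
    rintro ⟨t, x, v⟩
    exact tendsto_difference_quotient (hasDerivAt_dx (h.smooth _ (projIcc 0 T hT t).2) x v)

theorem measurable_dv_proj (h : IsSolution T μ₀ μ φ) :
    Measurable fun y : ℝ × ℝ × ℝ => dv (μ (projIcc 0 T hT y.1)) y.2 := by
  have hm := h.measurable_uncurry_proj hT
  refine measurable_of_tendsto_metrizable (f := fun (n : ℕ) (y : ℝ × ℝ × ℝ) =>
    ((n : ℝ) + 1) * (μ (projIcc 0 T hT y.1) (y.2.1, y.2.2 + ((n : ℝ) + 1)⁻¹) -
      μ (projIcc 0 T hT y.1) y.2)) (fun n => ?_) ?_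
  · refine Measurable.const_mul (Measurable.sub ?_ hm) _
    exact hm.comp (by fun_prop :
      Measurable fun y : ℝ × ℝ × ℝ => (y.1, y.2.1, y.2.2 + ((n : ℝ) + 1)⁻¹))
  · rw [tendsto_pi_nhds]
    rintro ⟨t, x, v⟩
    exact tendsto_difference_quotient (hasDerivAt_dv (h.smooth _ (projIcc 0 T hT t).2) x v)

theorem measurable_deriv_potential_proj (h : IsSolution T μ₀ μ φ) :
    Measurable fun y : ℝ × ℝ => deriv (φ (projIcc 0 T hT y.1)) y.2 := by
  refine (stronglyMeasurable_uncurry_of_continuous_of_stronglyMeasurable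
    (u := fun t x => deriv (φ (projIcc 0 T hT t)) x) (fun x => ?_) fun t => ?_).measurable
  · exact (h.continuousOn_deriv_potential x).domRestrict.comp continuous_projIcc
  · exact ((h.potential_smooth _ (projIcc 0 T hT t).2).continuous_deriv
      (by simp)).stronglyMeasurable

end Measurability

end IsSolution

/-! ### The energy estimate for the difference of two solutions -/

/-- A weight decaying in the velocity. -/
def velWeight (c v : ℝ) : ℝ := (1 + (c * v) ^ 2)⁻¹

section VelWeight

variable {c : ℝ}

theorem velWeight_nonneg (c v : ℝ) : 0 ≤ velWeight c v := by unfold velWeight; positivity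

theorem velWeight_le_one (c v : ℝ) : velWeight c v ≤ 1 :=
  inv_le_one_of_one_le₀ (by nlinarith [sq_nonneg (c * v)])

theorem abs_velWeight_le (c v : ℝ) : |velWeight c v| ≤ 1 := by
  rw [abs_of_nonneg (velWeight_nonneg c v)]
  exact velWeight_le_one c v

/-- The purpose of the weight: membership in Sobolev spaces gives no decay in `v`, so `v w ∂_x w`
need not be integrable without it. -/
theorem abs_velWeight_mul_le (hc : 0 < c) (v : ℝ) : |velWeight c v * v| ≤ c⁻¹ := by
  rw [abs_mul, abs_of_nonneg (velWeight_nonneg c v), velWeight, ← div_eq_inv_mul,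
    div_le_iff₀ (by positivity), ← div_eq_inv_mul, le_div_iff₀ hc]
  have h1 : |c * v| = |v| * c := by rw [abs_mul, abs_of_pos hc, mul_comm]
  rw [← h1, ← sq_abs]
  nlinarith [sq_nonneg (|c * v| - 1)]

theorem continuous_velWeight (c : ℝ) : Continuous (velWeight c) := by
  unfold velWeight
  exact Continuous.inv₀ (by fun_prop) fun v => by positivity

/-- The derivative of the weight. -/
def velWeightDeriv (c v : ℝ) : ℝ := -(2 * c * (c * v)) / (1 + (c * v) ^ 2) ^ 2

theorem hasDerivAt_velWeight (c v : ℝ) : HasDerivAt (velWeight c) (velWeightDeriv c v) v := by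
  have h1 : HasDerivAt (fun v => 1 + (c * v) ^ 2) (2 * c * (c * v)) v := by
    have := (((hasDerivAt_id v).const_mul c).pow 2).const_add 1
    refine this.congr_deriv ?_
    simp
    ring
  exact h1.inv (by positivity)

theorem continuous_velWeightDeriv (c : ℝ) : Continuous (velWeightDeriv c) := by
  unfold velWeightDeriv
  exact Continuous.div (by fun_prop) (by fun_prop) fun v => by positivity

/-- Uniform in `c ≤ 1`, so the term produced by integrating by parts in `v` stays bounded when the
weight is removed. -/
theorem abs_velWeightDeriv_le (hc : 0 < c) (hc1 : c ≤ 1) (v : ℝ) : |velWeightDeriv c v| ≤ 1 := by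
  rw [velWeightDeriv, abs_div, abs_neg, abs_of_pos (by positivity : 0 < (1 + (c * v) ^ 2) ^ 2),
    div_le_one (by positivity), abs_mul, abs_of_pos (by positivity : 0 < 2 * c), ← sq_abs (c * v)]
  generalize |c * v| = y at *
  have h0 : 2 * c * y ≤ 2 * |y| := by
    have : c * y ≤ |y| := (le_abs_self _).trans (by
      rw [abs_mul, abs_of_pos hc]; exact mul_le_of_le_one_left (abs_nonneg _) hc1)
    linarith
  have h1 : y ^ 2 = |y| ^ 2 := (sq_abs y).symm
  rw [h1]
  nlinarith [sq_nonneg (|y| - 1), sq_nonneg (|y| ^ 2)]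

end VelWeight

/-- The time derivative of the weighted square of the difference of two solutions. -/
def energyRate (c : ℝ) (w wx wv h : ℝ × ℝ → ℝ) (F G : ℝ → ℝ) (z : ℝ × ℝ) : ℝ :=
  velWeight c z.2 * (2 * w z * (-(z.2 * wx z) + F z.1 * wv z + G z.1 * h z))

section Energy

variable {c : ℝ} {w h : ℝ × ℝ → ℝ} {F G : ℝ → ℝ} {M m : ℝ}

/-- The weight does not depend on `x`, so free transport contributes a total `x`-derivative; on
almost every line both `w²` and its derivative are integrable, and the integral vanishes. -/
theorem integral_weight_mul_dx (hc : 0 < c) (hw : ContDiff ℝ ∞ w) (hw2 : MemLp w 2)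
    (hwx : MemLp (dx w) 2) :
    (Integrable fun z : ℝ × ℝ => velWeight c z.2 * z.2 * (2 * (w z * dx w z))) ∧
      ∫ z : ℝ × ℝ, velWeight c z.2 * z.2 * (2 * (w z * dx w z)) = 0 := by
  have hi0 : Integrable fun z => w z * dx w z := hw2.integrable_mul hwx
  have hi1 := hi0.const_mul 2
  have hcw := continuous_velWeight c
  have hi : Integrable fun z : ℝ × ℝ => velWeight c z.2 * z.2 * (2 * (w z * dx w z)) :=
    hi1.bdd_mul (c := c⁻¹) (Continuous.aestronglyMeasurable (by fun_prop))
      (Eventually.of_forall fun z => abs_velWeight_mul_le hc z.2)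
  refine ⟨hi, ?_⟩
  have hsq : Integrable fun z => w z ^ 2 := hw2.integrable_sq
  rw [Measure.volume_eq_prod] at hi hsq hi1 ⊢
  rw [integral_prod_symm _ hi]
  refine integral_eq_zero_of_ae ?_
  filter_upwards [hsq.prod_left_ae, hi1.prod_left_ae] with v h1 h2
  rw [integral_const_mul, integral_eq_zero_of_hasDerivAt_of_integrable (fun x => ?_) h2 h1,
    mul_zero, Pi.zero_apply]
  refine ((hasDerivAt_dx hw x v).pow 2).congr_deriv ?_
  simp
  ring

/-- Integration by parts in `v` on almost every line; the field depends on `x` only, so the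
derivative falls on the weight alone. -/
theorem integral_weight_mul_dv (hc : 0 < c) (hc1 : c ≤ 1) (hw : ContDiff ℝ ∞ w) (hw2 : MemLp w 2)
    (hwv : MemLp (dv w) 2) (hF : Continuous F) (hFM : ∀ x, |F x| ≤ M) :
    (Integrable fun z : ℝ × ℝ => velWeight c z.2 * F z.1 * (2 * (w z * dv w z))) ∧
      ∫ z : ℝ × ℝ, velWeight c z.2 * F z.1 * (2 * (w z * dv w z)) ≤
        M * (eLpNorm w 2 volume).toReal ^ 2 := by
  have hi0 : Integrable fun z => w z * dv w z := hw2.integrable_mul hwv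
  have hi1 := hi0.const_mul 2
  have hcw := continuous_velWeight c
  have hcd := continuous_velWeightDeriv c
  have hM : 0 ≤ M := (abs_nonneg _).trans (hFM 0)
  have hi : Integrable fun z : ℝ × ℝ => velWeight c z.2 * F z.1 * (2 * (w z * dv w z)) :=
    hi1.bdd_mul (c := 1 * M) (Continuous.aestronglyMeasurable (by fun_prop))
      (Eventually.of_forall fun z => by
        rw [norm_mul]
        exact mul_le_mul (abs_velWeight_le c z.2) (hFM z.1) (norm_nonneg _) zero_le_one)
  refine ⟨hi, ?_⟩
  have hsq : Integrable fun z => w z ^ 2 := hw2.integrable_sq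
  have hbd : ∀ z : ℝ × ℝ, ‖velWeightDeriv c z.2 * F z.1‖ ≤ M := fun z => by
    rw [norm_mul, ← one_mul M]
    exact mul_le_mul (abs_velWeightDeriv_le hc hc1 z.2) (hFM z.1) (norm_nonneg _) zero_le_one
  have hi2 : Integrable fun z : ℝ × ℝ => velWeightDeriv c z.2 * F z.1 * w z ^ 2 :=
    hsq.bdd_mul (c := M) (Continuous.aestronglyMeasurable (by fun_prop)) (Eventually.of_forall hbd)
  have hi3 : Integrable fun z : ℝ × ℝ => velWeight c z.2 * F z.1 * w z ^ 2 :=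
    hsq.bdd_mul (c := 1 * M) (Continuous.aestronglyMeasurable (by fun_prop))
      (Eventually.of_forall fun z => by
        rw [norm_mul]
        exact mul_le_mul (abs_velWeight_le c z.2) (hFM z.1) (norm_nonneg _) zero_le_one)
  have hs := hi2.add hi
  have h0 : ∫ z : ℝ × ℝ, (velWeightDeriv c z.2 * F z.1 * w z ^ 2 +
      velWeight c z.2 * F z.1 * (2 * (w z * dv w z))) = 0 := by
    rw [Measure.volume_eq_prod] at hs hi3 ⊢
    refine (integral_prod _ hs).trans (integral_eq_zero_of_ae ?_)
    filter_upwards [hs.prod_right_ae, hi3.prod_right_ae] with x h1 h2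
    refine integral_eq_zero_of_hasDerivAt_of_integrable (fun v => ?_) h1 h2
    refine (((hasDerivAt_velWeight c v).mul_const (F x)).mul
      ((hasDerivAt_dv hw x v).pow 2)).congr_deriv ?_
    simp only [Pi.add_apply, Pi.pow_apply, Nat.cast_ofNat, Nat.add_one_sub_one, pow_one]
    ring
  rw [integral_add hi2 hi] at h0
  have h1 : -∫ z : ℝ × ℝ, velWeightDeriv c z.2 * F z.1 * w z ^ 2 ≤
      M * (eLpNorm w 2 volume).toReal ^ 2 := by
    rw [← integral_sq_eq hw2, ← integral_const_mul, ← integral_neg]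
    refine integral_mono hi2.neg (hsq.const_mul M) fun z => ?_
    have := (neg_le_abs _).trans (hbd z)
    change -(velWeightDeriv c z.2 * F z.1 * w z ^ 2) ≤ M * w z ^ 2
    nlinarith [sq_nonneg (w z)]
  linarith

theorem integral_weight_mul_source (hw2 : MemLp w 2) (hh : MemLp h 2) (hG : Continuous G)
    (hGm : ∀ x, |G x| ≤ m) :
    (Integrable fun z : ℝ × ℝ => velWeight c z.2 * G z.1 * (2 * (w z * h z))) ∧
      ∫ z : ℝ × ℝ, velWeight c z.2 * G z.1 * (2 * (w z * h z)) ≤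
        2 * m * ((eLpNorm w 2 volume).toReal * (eLpNorm h 2 volume).toReal) := by
  have hi0 : Integrable fun z => w z * h z := hw2.integrable_mul hh
  have hcw := continuous_velWeight c
  have hm : 0 ≤ m := (abs_nonneg _).trans (hGm 0)
  have hbd : ∀ z : ℝ × ℝ, ‖velWeight c z.2 * G z.1‖ ≤ m := fun z => by
    rw [norm_mul, ← one_mul m]
    exact mul_le_mul (abs_velWeight_le c z.2) (hGm z.1) (norm_nonneg _) zero_le_one
  have hi : Integrable fun z : ℝ × ℝ => velWeight c z.2 * G z.1 * (2 * (w z * h z)) :=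
    (hi0.const_mul 2).bdd_mul (c := m) (Continuous.aestronglyMeasurable (by fun_prop))
      (Eventually.of_forall hbd)
  refine ⟨hi, ?_⟩
  calc _ ≤ ∫ z : ℝ × ℝ, 2 * m * |w z * h z| := by
        refine integral_mono hi (hi0.abs.const_mul _) fun z => ?_
        refine (le_abs_self _).trans ?_
        rw [abs_mul, abs_mul 2, abs_of_pos (two_pos : (0 : ℝ) < 2)]
        have := mul_le_mul_of_nonneg_right (hbd z) (abs_nonneg (w z * h z))
        rw [Real.norm_eq_abs] at this
        change _ ≤ 2 * m * |w z * h z|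
        linarith
    _ = 2 * m * ∫ z, |w z * h z| := integral_const_mul _ _
    _ ≤ _ := by gcongr; exact integral_abs_mul_le hw2 hh

theorem energyRate_eq (c : ℝ) (w wx wv h : ℝ × ℝ → ℝ) (F G : ℝ → ℝ) (z : ℝ × ℝ) :
    energyRate c w wx wv h F G z = -(velWeight c z.2 * z.2 * (2 * (w z * wx z))) +
      velWeight c z.2 * F z.1 * (2 * (w z * wv z)) +
      velWeight c z.2 * G z.1 * (2 * (w z * h z)) := by
  unfold energyRate
  ring

theorem integral_energyRate_le (hc : 0 < c) (hc1 : c ≤ 1) (hw : ContDiff ℝ ∞ w) (hw2 : MemLp w 2)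
    (hwx : MemLp (dx w) 2) (hwv : MemLp (dv w) 2) (hh : MemLp h 2) (hF : Continuous F)
    (hFM : ∀ x, |F x| ≤ M) (hG : Continuous G) (hGm : ∀ x, |G x| ≤ m) :
    ∫ z, energyRate c w (dx w) (dv w) h F G z ≤ M * (eLpNorm w 2 volume).toReal ^ 2 +
      2 * m * ((eLpNorm w 2 volume).toReal * (eLpNorm h 2 volume).toReal) := by
  have h1 := integral_weight_mul_dx hc hw hw2 hwx
  have h2 := integral_weight_mul_dv hc hc1 hw hw2 hwv hF hFM
  have h3 := integral_weight_mul_source (c := c) hw2 hh hG hGm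
  simp only [energyRate_eq]
  have e1 := integral_add (h1.1.neg.add h2.1) h3.1
  have e2 := integral_add h1.1.neg h2.1
  simp only [Pi.add_apply, Pi.neg_apply] at e1 e2
  rw [e1, e2, integral_neg, h1.2]
  linarith [h2.2, h3.2]

/-- This bound degenerates as `c → 0`. It serves only to justify the exchange of integrals at fixed
`c`. -/
theorem lintegral_energyRate_le (hc : 0 < c) {wx wv : ℝ × ℝ → ℝ} (hw2 : MemLp w 2)
    (hwx : MemLp wx 2) (hwv : MemLp wv 2) (hh : MemLp h 2)
    (hFM : ∀ x, |F x| ≤ M) (hGm : ∀ x, |G x| ≤ m) {B : ℝ} (hB : 0 ≤ B)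
    (bw : eLpNorm w 2 volume ≤ ENNReal.ofReal B) (bx : eLpNorm wx 2 volume ≤ ENNReal.ofReal B)
    (bv : eLpNorm wv 2 volume ≤ ENNReal.ofReal B) (bh : eLpNorm h 2 volume ≤ ENNReal.ofReal B) :
    ∫⁻ z, ‖energyRate c w wx wv h F G z‖ₑ ≤ ENNReal.ofReal (2 * (c⁻¹ + M + m) * (B * B)) := by
  have hM : 0 ≤ M := (abs_nonneg _).trans (hFM 0)
  have hm : 0 ≤ m := (abs_nonneg _).trans (hGm 0)
  have i1 : Integrable fun z => |w z * wx z| := (hw2.integrable_mul hwx).abs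
  have i2 : Integrable fun z => |w z * wv z| := (hw2.integrable_mul hwv).abs
  have i3 : Integrable fun z => |w z * h z| := (hw2.integrable_mul hh).abs
  have rw' := ENNReal.toReal_le_of_le_ofReal hB bw
  have rx := ENNReal.toReal_le_of_le_ofReal hB bx
  have rv := ENNReal.toReal_le_of_le_ofReal hB bv
  have rh := ENNReal.toReal_le_of_le_ofReal hB bh
  have hle : ∀ z, |energyRate c w wx wv h F G z| ≤
      2 * c⁻¹ * |w z * wx z| + 2 * M * |w z * wv z| + 2 * m * |w z * h z| := fun z => by
    rw [energyRate_eq]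
    refine (abs_add_three _ _ _).trans ?_
    rw [abs_neg, abs_mul, abs_mul _ (2 * (w z * wv z)), abs_mul _ (2 * (w z * h z)), abs_mul 2,
      abs_mul 2 (w z * wv z), abs_mul 2 (w z * h z), abs_of_pos (two_pos : (0 : ℝ) < 2),
      abs_mul (velWeight c z.2) (F z.1), abs_mul (velWeight c z.2) (G z.1)]
    have e1 := mul_le_mul_of_nonneg_right (abs_velWeight_mul_le hc z.2) (abs_nonneg (w z * wx z))
    have e2 : |velWeight c z.2| * |F z.1| ≤ 1 * M :=
      mul_le_mul (abs_velWeight_le c z.2) (hFM z.1) (abs_nonneg _) zero_le_one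
    have e3 : |velWeight c z.2| * |G z.1| ≤ 1 * m :=
      mul_le_mul (abs_velWeight_le c z.2) (hGm z.1) (abs_nonneg _) zero_le_one
    have e2' := mul_le_mul_of_nonneg_right e2 (abs_nonneg (w z * wv z))
    have e3' := mul_le_mul_of_nonneg_right e3 (abs_nonneg (w z * h z))
    linarith
  have hi := ((i1.const_mul (2 * c⁻¹)).add (i2.const_mul (2 * M))).add (i3.const_mul (2 * m))
  calc ∫⁻ z, ‖energyRate c w wx wv h F G z‖ₑ
      ≤ ∫⁻ z, ENNReal.ofReal
        (2 * c⁻¹ * |w z * wx z| + 2 * M * |w z * wv z| + 2 * m * |w z * h z|) := by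
        refine lintegral_mono fun z => ?_
        rw [Real.enorm_eq_ofReal_abs]
        exact ENNReal.ofReal_le_ofReal (hle z)
    _ = ENNReal.ofReal (∫ z, (2 * c⁻¹ * |w z * wx z| + 2 * M * |w z * wv z| +
        2 * m * |w z * h z|)) :=
        (ofReal_integral_eq_lintegral_ofReal hi (Eventually.of_forall fun z => by
          simp only [Pi.zero_apply, Pi.add_apply]; positivity)).symm
    _ ≤ _ := by
        apply ENNReal.ofReal_le_ofReal
        have e1 := integral_add ((i1.const_mul (2 * c⁻¹)).add (i2.const_mul (2 * M)))
          (i3.const_mul (2 * m))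
        have e2 := integral_add (i1.const_mul (2 * c⁻¹)) (i2.const_mul (2 * M))
        simp only [Pi.add_apply] at e1 e2
        rw [e1, e2, integral_const_mul, integral_const_mul, integral_const_mul]
        have key : ∀ {u : ℝ × ℝ → ℝ}, MemLp u 2 → (eLpNorm u 2 volume).toReal ≤ B →
            ∫ z, |w z * u z| ≤ B * B := fun hu hb =>
          (integral_abs_mul_le hw2 hu).trans (mul_le_mul rw' hb ENNReal.toReal_nonneg hB)
        have k1 := mul_le_mul_of_nonneg_left (key hwx rx) (by positivity : 0 ≤ 2 * c⁻¹)
        have k2 := mul_le_mul_of_nonneg_left (key hwv rv) (by positivity : 0 ≤ 2 * M)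
        have k3 := mul_le_mul_of_nonneg_left (key hh rh) (by positivity : 0 ≤ 2 * m)
        linarith

end Energy

/-- Gronwall is applied to the primitive of `E`, which has zero initial value and derivative at most
`K` times itself; its vanishing forces that of `E`. -/
theorem eq_zero_of_le_integral {T K : ℝ} {E : ℝ → ℝ} (hE : Continuous E) (hE0 : ∀ t, 0 ≤ E t)
    (h : ∀ t ∈ Icc 0 T, E t ≤ K * ∫ s in 0..t, E s) : ∀ t ∈ Icc 0 T, E t = 0 := by
  set H : ℝ → ℝ := fun t => ∫ s in 0..t, E s with hH
  have hd : ∀ t, HasDerivAt H (E t) t := fun t =>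
    intervalIntegral.integral_hasDerivAt_right (hE.intervalIntegrable 0 t)
      (hE.stronglyMeasurableAtFilter _ _) hE.continuousAt
  have hHpos : ∀ t ∈ Icc 0 T, 0 ≤ H t := fun t ht =>
    intervalIntegral.integral_nonneg ht.1 fun s _ => hE0 s
  have hg := norm_le_gronwallBound_of_norm_deriv_right_le (f := H) (f' := E) (δ := 0) (K := K)
    (ε := 0) (a := 0) (b := T) (fun t _ => (hd t).continuousAt.continuousWithinAt)
    (fun t _ => (hd t).hasDerivWithinAt) (by simp [hH]) fun t ht => by
      have ht' : t ∈ Icc 0 T := ⟨ht.1, ht.2.le⟩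
      rw [Real.norm_of_nonneg (hE0 t), Real.norm_of_nonneg (hHpos t ht'), add_zero]
      exact h t ht'
  intro t ht
  have h1 := hg t ht
  rw [gronwallBound_ε0_δ0, norm_le_zero_iff] at h1
  have h2 := h t ht
  change E t ≤ K * H t at h2
  rw [h1, mul_zero] at h2
  exact le_antisymm h2 (hE0 t)

namespace IsSolution

variable {T : ℝ} {μ₀ : ℝ × ℝ → ℝ} {μ μ' : ℝ → ℝ × ℝ → ℝ} {φ φ' : ℝ → ℝ → ℝ}

/-- The energy rate of the difference of two solutions. -/
def diffRate (c : ℝ) (μ μ' : ℝ → ℝ × ℝ → ℝ) (φ φ' : ℝ → ℝ → ℝ) (t : ℝ) : ℝ × ℝ → ℝ :=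
  energyRate c (fun z => μ t z - μ' t z) (fun z => dx (μ t) z - dx (μ' t) z)
    (fun z => dv (μ t) z - dv (μ' t) z) (dv (μ' t)) (deriv (φ t))
    fun x => deriv (φ t) x - deriv (φ' t) x

theorem hasDerivWithinAt_diff (h : IsSolution T μ₀ μ φ) (h' : IsSolution T μ₀ μ' φ') {t : ℝ}
    (ht : t ∈ Icc 0 T) (c : ℝ) (z : ℝ × ℝ) :
    HasDerivWithinAt (fun s => velWeight c z.2 * (μ s z - μ' s z) ^ 2)
      (diffRate c μ μ' φ φ' t z) (Icc 0 T) t := by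
  obtain ⟨x, v⟩ := z
  refine ((((h.transport t ht x v).sub (h'.transport t ht x v)).pow 2).const_mul
    (velWeight c v)).congr_deriv ?_
  simp only [diffRate, energyRate, Pi.sub_apply, Nat.cast_ofNat, Nat.add_one_sub_one, pow_one]
  ring

theorem exists_bound₂ (h : IsSolution T μ₀ μ φ) (h' : IsSolution T μ₀ μ' φ') :
    ∃ B : ℝ, 0 ≤ B ∧ ∀ t ∈ Icc 0 T,
      (eLpNorm (μ t) 2 volume ≤ ENNReal.ofReal B ∧ eLpNorm (dx (μ t)) 2 volume ≤ ENNReal.ofReal B ∧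
        eLpNorm (dv (μ t)) 2 volume ≤ ENNReal.ofReal B) ∧
      (eLpNorm (μ' t) 2 volume ≤ ENNReal.ofReal B ∧
        eLpNorm (dx (μ' t)) 2 volume ≤ ENNReal.ofReal B ∧
        eLpNorm (dv (μ' t)) 2 volume ≤ ENNReal.ofReal B) := by
  obtain ⟨B₁, hB₁, h₁⟩ := h.exists_bound
  obtain ⟨B₂, hB₂, h₂⟩ := h'.exists_bound
  have l₁ := ENNReal.ofReal_le_ofReal (by linarith : B₁ ≤ B₁ + B₂)
  have l₂ := ENNReal.ofReal_le_ofReal (by linarith : B₂ ≤ B₁ + B₂)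
  exact ⟨B₁ + B₂, by positivity, fun t ht =>
    ⟨⟨(h₁ t ht).1.trans l₁, (h₁ t ht).2.1.trans l₁, (h₁ t ht).2.2.trans l₁⟩,
      ⟨(h₂ t ht).1.trans l₂, (h₂ t ht).2.1.trans l₂, (h₂ t ht).2.2.trans l₂⟩⟩⟩

theorem eLpNorm_sub_le_ofReal {u w : ℝ × ℝ → ℝ} (hu : MemLp u 2) (hw : MemLp w 2) {B : ℝ}
    (hB : 0 ≤ B) (bu : eLpNorm u 2 volume ≤ ENNReal.ofReal B)
    (bw : eLpNorm w 2 volume ≤ ENNReal.ofReal B) :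
    eLpNorm (fun z => u z - w z) 2 volume ≤ ENNReal.ofReal (2 * B) := by
  refine (eLpNorm_sub_le hu.1 hw.1 one_le_two).trans ((add_le_add bu bw).trans ?_)
  rw [← ENNReal.ofReal_add hB hB, two_mul]

theorem abs_deriv_potential_sub_le_mul (h : IsSolution T μ₀ μ φ) (h' : IsSolution T μ₀ μ' φ')
    {t : ℝ} (ht : t ∈ Icc 0 T) {B : ℝ} (hB : 0 ≤ B)
    (b : eLpNorm (μ t) 2 volume ≤ ENNReal.ofReal B)
    (b' : eLpNorm (μ' t) 2 volume ≤ ENNReal.ofReal B) (x : ℝ) :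
    |deriv (φ t) x - deriv (φ' t) x| ≤
      (eLpNorm (fun z => μ t z - μ' t z) 2 volume).toReal * (2 * B) := by
  refine (h.abs_deriv_potential_sub_le h' ht ht x).2.trans ?_
  rw [ENNReal.toReal_mul]
  gcongr
  refine ENNReal.toReal_le_of_le_ofReal (by positivity) ?_
  refine (eLpNorm_add_le (h.memLp ht).1 (h'.memLp ht).1 one_le_two).trans
    ((add_le_add b b').trans ?_)
  rw [← ENNReal.ofReal_add hB hB, two_mul]

/-- The constant is `B² + 4 B²`: the field of the first solution is at most `B²`, and the difference
of the fields, at most `2 B` times the norm of the difference, acts on a `v`-derivative of norm at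
most `B`, with a factor 2 from the square. It does not depend on `c`. -/
theorem integral_diffRate_le (h : IsSolution T μ₀ μ φ) (h' : IsSolution T μ₀ μ' φ')
    {t : ℝ} (ht : t ∈ Icc 0 T) {c : ℝ} (hc : 0 < c) (hc1 : c ≤ 1) {B : ℝ} (hB : 0 ≤ B)
    (b : eLpNorm (μ t) 2 volume ≤ ENNReal.ofReal B)
    (b' : eLpNorm (μ' t) 2 volume ≤ ENNReal.ofReal B)
    (bv : eLpNorm (dv (μ' t)) 2 volume ≤ ENNReal.ofReal B) :
    ∫ z, diffRate c μ μ' φ φ' t z ≤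
      5 * B ^ 2 * (eLpNorm (fun z => μ t z - μ' t z) 2 volume).toReal ^ 2 := by
  have hs := h.smooth t ht
  have hs' := h'.smooth t ht
  have ex := dx_sub hs hs'
  have ev := dv_sub hs hs'
  have hc1' := (h.potential_smooth t ht).continuous_deriv (by simp)
  have hc2' := (h'.potential_smooth t ht).continuous_deriv (by simp)
  have key := integral_energyRate_le (w := fun z => μ t z - μ' t z) (h := dv (μ' t))
    (F := deriv (φ t)) (G := fun x => deriv (φ t) x - deriv (φ' t) x) (M := B ^ 2) hc hc1
    (hs.sub hs') ((h.memLp ht).sub (h'.memLp ht))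
    (by rw [ex]; exact (h.memLp_dx ht).sub (h'.memLp_dx ht))
    (by rw [ev]; exact (h.memLp_dv ht).sub (h'.memLp_dv ht)) (h'.memLp_dv ht) hc1'
    (h.abs_deriv_potential_le ht hB b) (hc1'.sub hc2')
    (h.abs_deriv_potential_sub_le_mul h' ht hB b b')
  rw [ex, ev] at key
  refine key.trans ?_
  have hb := ENNReal.toReal_le_of_le_ofReal hB bv
  set n := (eLpNorm (fun z => μ t z - μ' t z) 2 volume).toReal with hn
  have hn0 : 0 ≤ n := ENNReal.toReal_nonneg
  have : n * (eLpNorm (dv (μ' t)) 2 volume).toReal ≤ n * B := by gcongr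
  have h2 := mul_le_mul_of_nonneg_left this (by positivity : 0 ≤ 2 * (n * (2 * B)))
  nlinarith

theorem lintegral_diffRate_le (h : IsSolution T μ₀ μ φ) (h' : IsSolution T μ₀ μ' φ')
    {c : ℝ} (hc : 0 < c) : ∃ C : ℝ≥0∞, C < ⊤ ∧ ∀ t ∈ Icc 0 T,
      ∫⁻ z, ‖diffRate c μ μ' φ φ' t z‖ₑ ≤ C := by
  obtain ⟨B, hB, hb⟩ := h.exists_bound₂ h'
  refine ⟨ENNReal.ofReal (2 * (c⁻¹ + B ^ 2 + 2 * B * (2 * B)) * (2 * B * (2 * B))),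
    ENNReal.ofReal_lt_top, fun t ht => ?_⟩
  obtain ⟨⟨b, bx, bv⟩, b', bx', bv'⟩ := hb t ht
  have hw := eLpNorm_sub_le_ofReal (h.memLp ht) (h'.memLp ht) hB b b'
  refine lintegral_energyRate_le (M := B ^ 2) (m := 2 * B * (2 * B)) hc
    ((h.memLp ht).sub (h'.memLp ht)) ((h.memLp_dx ht).sub (h'.memLp_dx ht))
    ((h.memLp_dv ht).sub (h'.memLp_dv ht)) (h'.memLp_dv ht) (h.abs_deriv_potential_le ht hB b)
    (fun x => ?_) (by positivity : 0 ≤ 2 * B) hw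
    (eLpNorm_sub_le_ofReal (h.memLp_dx ht) (h'.memLp_dx ht) hB bx bx')
    (eLpNorm_sub_le_ofReal (h.memLp_dv ht) (h'.memLp_dv ht) hB bv bv')
    (bv'.trans (ENNReal.ofReal_le_ofReal (by linarith)))
  refine (h.abs_deriv_potential_sub_le_mul h' ht hB b b' x).trans ?_
  gcongr
  exact ENNReal.toReal_le_of_le_ofReal (by positivity) hw

theorem measurable_diffRate_proj (h : IsSolution T μ₀ μ φ) (h' : IsSolution T μ₀ μ' φ')
    (hT : 0 ≤ T) (c : ℝ) :
    Measurable fun y : ℝ × ℝ × ℝ => diffRate c μ μ' φ φ' (projIcc 0 T hT y.1) y.2 := by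
  have hc := (continuous_velWeight c).measurable
  have m1 := h.measurable_uncurry_proj hT
  have m2 := h'.measurable_uncurry_proj hT
  have m3 := h.measurable_dx_proj hT
  have m4 := h'.measurable_dx_proj hT
  have m5 := h.measurable_dv_proj hT
  have m6 := h'.measurable_dv_proj hT
  have m7 := (h.measurable_deriv_potential_proj hT).comp
    (by fun_prop : Measurable fun y : ℝ × ℝ × ℝ => (y.1, y.2.1))
  have m8 := (h'.measurable_deriv_potential_proj hT).comp
    (by fun_prop : Measurable fun y : ℝ × ℝ × ℝ => (y.1, y.2.1))
  have hv : Measurable fun y : ℝ × ℝ × ℝ => y.2.2 := by fun_prop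
  exact (hc.comp hv).mul (((m1.sub m2).const_mul 2).mul
    (((hv.mul (m3.sub m4)).neg.add (m7.mul (m5.sub m6))).add ((m7.sub m8).mul m6)))

/-- The fundamental theorem of calculus is used at almost every phase point separately, where the
equation holds classically and the initial values agree; Fubini then gives the identity for the
integrals. -/
theorem integral_weight_sq_le (h : IsSolution T μ₀ μ φ) (h' : IsSolution T μ₀ μ' φ')
    (hT : 0 ≤ T) {c : ℝ} (hc : 0 < c) {t : ℝ} (ht : t ∈ Icc 0 T) :
    IntegrableOn (fun s => ∫ z, diffRate c μ μ' φ φ' (projIcc 0 T hT s) z) (Ioc 0 t) ∧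
    ∫ z : ℝ × ℝ, velWeight c z.2 * (μ t z - μ' t z) ^ 2 =
      ∫ s in Ioc 0 t, ∫ z, diffRate c μ μ' φ φ' (projIcc 0 T hT s) z := by
  obtain ⟨C, hC, hle⟩ := h.lintegral_diffRate_le h' hc
  have hm := h.measurable_diffRate_proj h' hT c
  have hi : Integrable
      (fun y : ℝ × ℝ × ℝ => diffRate c μ μ' φ φ' (projIcc 0 T hT y.1) y.2)
      ((volume.restrict (Ioc 0 t)).prod volume) := by
    refine ⟨hm.aestronglyMeasurable, ?_⟩
    rw [HasFiniteIntegral, lintegral_prod _ hm.enorm.aemeasurable]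
    refine (lintegral_mono fun s => hle _ (projIcc 0 T hT s).2).trans_lt ?_
    rw [lintegral_const]
    exact ENNReal.mul_lt_top hC (by simp)
  refine ⟨hi.integral_prod_left, ?_⟩
  rw [integral_integral_swap hi]
  refine integral_congr_ae ?_
  filter_upwards [h.initial, h'.initial, hi.prod_left_ae] with z h0 h0' hz
  have hIcc : Icc 0 t ⊆ Icc 0 T := Icc_subset_Icc_right ht.2
  have hd : ∀ s ∈ Icc 0 t, HasDerivWithinAt (fun s => velWeight c z.2 * (μ s z - μ' s z) ^ 2)
      (diffRate c μ μ' φ φ' (projIcc 0 T hT s) z) (Icc 0 T) s := fun s hs => by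
    rw [projIcc_of_mem hT (hIcc hs)]
    exact h.hasDerivWithinAt_diff h' (hIcc hs) c z
  have hftc := intervalIntegral.integral_eq_sub_of_hasDerivAt_of_le ht.1
    (fun s hs => ((hd s hs).continuousWithinAt).mono hIcc)
    (fun s hs => (hd s (Ioo_subset_Icc_self hs)).hasDerivAt
      (Icc_mem_nhds hs.1 (hs.2.trans_le ht.2)))
    ((intervalIntegrable_iff_integrableOn_Ioc_of_le ht.1).2 hz)
  rw [intervalIntegral.integral_of_le ht.1] at hftc
  rw [hftc, h0, h0']
  simp

theorem continuous_diffNorm_proj (h : IsSolution T μ₀ μ φ) (h' : IsSolution T μ₀ μ' φ')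
    (hT : 0 ≤ T) : Continuous fun s => (eLpNorm (fun z => μ (projIcc 0 T hT s) z -
      μ' (projIcc 0 T hT s) z) 2 volume).toReal := by
  have hc : ContinuousOn (fun s => (eLpNorm (fun z => μ s z - μ' s z) 2 volume).toReal)
      (Icc 0 T) := by
    intro t ht
    have hw : ∀ {s}, s ∈ Icc 0 T → MemLp (fun z => μ s z - μ' s z) 2 := fun hs =>
      (h.memLp hs).sub (h'.memLp hs)
    rw [ContinuousWithinAt, ← tendsto_sub_nhds_zero_iff]
    have h3 : Tendsto (fun s => (eLpNorm (fun p => μ s p - μ t p) 2 volume +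
        eLpNorm (fun p => μ' s p - μ' t p) 2 volume).toReal) (𝓝[Icc 0 T] t) (𝓝 0) := by
      have := (h.tendsto_eLpNorm_sub ht).add (h'.tendsto_eLpNorm_sub ht)
      rw [zero_add] at this
      exact (ENNReal.tendsto_toReal (by simp : (0 : ℝ≥0∞) ≠ ⊤)).comp this
    refine squeeze_zero_norm' ?_ h3
    filter_upwards [self_mem_nhdsWithin] with s hs
    have h4 := abs_norm_sub_norm_le ((hw hs).toLp _) ((hw ht).toLp _)
    rw [← MemLp.toLp_sub, Lp.norm_toLp, Lp.norm_toLp, Lp.norm_toLp] at h4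
    have m1 : MemLp (fun p => μ s p - μ t p) 2 := (h.memLp hs).sub (h.memLp ht)
    have m2 : MemLp (fun p => μ' s p - μ' t p) 2 := (h'.memLp hs).sub (h'.memLp ht)
    refine h4.trans (ENNReal.toReal_mono (ENNReal.add_ne_top.2 ⟨m1.2.ne, m2.2.ne⟩) ?_)
    refine le_trans (le_of_eq ?_) (eLpNorm_sub_le m1.1 m2.1 one_le_two)
    congr 1
    ext z
    simp only [Pi.sub_apply]
    ring
  exact hc.domRestrict.comp continuous_projIcc

/-- Solutions are unique. -/
theorem unique (h : IsSolution T μ₀ μ φ) (h' : IsSolution T μ₀ μ' φ') :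
    ∀ t ∈ Icc 0 T, μ t = μ' t ∧ φ t = φ' t := by
  intro t₀ ht₀
  have hT : 0 ≤ T := ht₀.1.trans ht₀.2
  obtain ⟨B, hB, hb⟩ := h.exists_bound₂ h'
  set n : ℝ → ℝ := fun s => (eLpNorm (fun z => μ (projIcc 0 T hT s) z -
      μ' (projIcc 0 T hT s) z) 2 volume).toReal with hn
  have hnc : Continuous n := h.continuous_diffNorm_proj h' hT
  have hE : ∀ t ∈ Icc 0 T, n t ^ 2 ≤ 5 * B ^ 2 * ∫ s in 0..t, n s ^ 2 := by
    intro t ht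
    have hw : MemLp (fun z => μ t z - μ' t z) 2 := (h.memLp ht).sub (h'.memLp ht)
    have hsq : Integrable fun z => (μ t z - μ' t z) ^ 2 := hw.integrable_sq
    have hle : ∀ k : ℕ, ∫ z : ℝ × ℝ, velWeight ((k : ℝ) + 1)⁻¹ z.2 * (μ t z - μ' t z) ^ 2 ≤
        5 * B ^ 2 * ∫ s in 0..t, n s ^ 2 := fun k => by
      have hc : (0 : ℝ) < ((k : ℝ) + 1)⁻¹ := by positivity
      have hc1 : ((k : ℝ) + 1)⁻¹ ≤ 1 :=
        inv_le_one_of_one_le₀ (by linarith [k.cast_nonneg (α := ℝ)])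
      obtain ⟨hi, he⟩ := h.integral_weight_sq_le h' hT hc ht
      rw [he, intervalIntegral.integral_of_le ht.1, ← integral_const_mul]
      refine integral_mono hi ?_ fun s => ?_
      · exact ((hnc.pow 2).integrableOn_Ioc).const_mul _
      · have hs := (projIcc 0 T hT s).2
        obtain ⟨⟨b, bx, bv⟩, b', bx', bv'⟩ := hb _ hs
        exact h.integral_diffRate_le h' hs hc hc1 hB b b' bv'
    -- The weight increases to one as `c → 0`, and the bound just obtained is the same for every
    -- `c`.
    have hlim : Tendsto (fun k : ℕ =>
        ∫ z : ℝ × ℝ, velWeight ((k : ℝ) + 1)⁻¹ z.2 * (μ t z - μ' t z) ^ 2) atTop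
        (𝓝 (∫ z, (μ t z - μ' t z) ^ 2)) := by
      refine tendsto_integral_of_dominated_convergence (fun z => (μ t z - μ' t z) ^ 2)
        (fun k => ?_) hsq (fun k => Eventually.of_forall fun z => ?_)
        (Eventually.of_forall fun z => ?_)
      · have := continuous_velWeight ((k : ℝ) + 1)⁻¹
        exact (Continuous.aestronglyMeasurable (by fun_prop)).mul hsq.1
      · rw [norm_mul, Real.norm_of_nonneg (sq_nonneg (μ t z - μ' t z))]
        exact mul_le_of_le_one_left (sq_nonneg _) (abs_velWeight_le _ _)
      · have h1 : Tendsto (fun k : ℕ => ((k : ℝ) + 1)⁻¹) atTop (𝓝 0) :=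
          tendsto_one_div_add_atTop_nhds_zero_nat.congr fun n => by simp
        have h2 : Continuous fun c => velWeight c z.2 := by
          unfold velWeight
          exact Continuous.inv₀ (by fun_prop) fun v => by positivity
        have h3 := ((h2.tendsto 0).comp h1).mul_const ((μ t z - μ' t z) ^ 2)
        simpa [velWeight] using h3
    have hnt : n t ^ 2 = ∫ z, (μ t z - μ' t z) ^ 2 := by
      rw [integral_sq_eq hw, hn]
      simp only [projIcc_of_mem hT ht]
    rw [hnt]
    exact le_of_tendsto' hlim hle
  have h0 := eq_zero_of_le_integral (hnc.pow 2) (fun s => sq_nonneg (n s)) hE t₀ ht₀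
  have hw : MemLp (fun z => μ t₀ z - μ' t₀ z) 2 := (h.memLp ht₀).sub (h'.memLp ht₀)
  have h1 : eLpNorm (fun z => μ t₀ z - μ' t₀ z) 2 volume = 0 := by
    have h2 : n t₀ = 0 := by simpa using h0
    rw [hn] at h2
    simp only [projIcc_of_mem hT ht₀] at h2
    exact ((ENNReal.toReal_eq_zero_iff _).1 h2).resolve_right hw.2.ne
  constructor
  · have h2 := (eLpNorm_eq_zero_iff hw.1 (by simp)).1 h1
    have h3 : μ t₀ =ᵐ[volume] μ' t₀ := by
      filter_upwards [h2] with z hz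
      exact sub_eq_zero.1 hz
    exact (Continuous.ae_eq_iff_eq volume (h.smooth t₀ ht₀).continuous
      (h'.smooth t₀ ht₀).continuous).1 h3
  -- Equal densities have equal bounded potentials: the bound for the difference is a multiple of
  -- the vanishing norm.
  · ext x
    have h2 := (h.abs_deriv_potential_sub_le h' ht₀ ht₀ x).1
    rw [h1, zero_mul, ENNReal.toReal_zero] at h2
    exact sub_eq_zero.1 (abs_nonpos_iff.1 h2)

end IsSolution

/-! ### Constants -/

/-- The constant in the loss of analyticity radius. -/
def lossConst : ℝ := 64 * (triConst.toReal + 1)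

theorem lossConst_ge : 64 ≤ lossConst := by
  have : 0 ≤ triConst.toReal := ENNReal.toReal_nonneg
  unfold lossConst
  linarith

/-- With `a = lossConst * ε²` the cubic term is `4 · 2 · 8 = 64` times `triConst / lossConst` times
`ε`; this fixes the factor 64. The summand 1 in `lossConst` keeps it positive. -/
theorem small_of_lossConst {ε : ℝ} (hε : 0 < ε) :
    4 * triConst * ENNReal.ofReal (2 / (lossConst * ε ^ 2)) * (2 * ENNReal.ofReal ε) ^ 3 ≤
      ENNReal.ofReal ε := by
  have hL : 0 < lossConst := by linarith [lossConst_ge]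
  have h0 : 0 ≤ triConst.toReal := ENNReal.toReal_nonneg
  rw [← ENNReal.ofReal_toReal triConst_lt_top.ne, ← ENNReal.ofReal_ofNat 4,
    ← ENNReal.ofReal_ofNat 2, ← ENNReal.ofReal_mul (by norm_num), ← ENNReal.ofReal_mul (by positivity),
    ← ENNReal.ofReal_mul (by norm_num), ← ENNReal.ofReal_pow (by positivity),
    ← ENNReal.ofReal_mul (by positivity)]
  apply ENNReal.ofReal_le_ofReal
  have h1 : 4 * triConst.toReal * (2 / (lossConst * ε ^ 2)) * (2 * ε) ^ 3 =
      64 * triConst.toReal / lossConst * ε := by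
    field_simp
    ring
  rw [h1]
  refine mul_le_of_le_one_left hε.le ?_
  rw [div_le_one hL]
  unfold lossConst
  linarith

theorem le_bracket (t : ℝ) : t ≤ bracket t := Real.le_sqrt_of_sq_le (by linarith)

theorem bracket_le {t : ℝ} (ht : 0 ≤ t) : bracket t ≤ 1 + t :=
  Real.sqrt_le_iff.2 ⟨by linarith, by nlinarith⟩

theorem sqrt_one_add_le {t : ℝ} (ht : 0 ≤ t) : √(1 + t) ≤ 1 + √t :=
  Real.sqrt_le_iff.2 ⟨by positivity, by nlinarith [Real.sq_sqrt ht, Real.sqrt_nonneg t]⟩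

/-- By `√(1 + t) - 1 ≤ √t ≤ √⟨t⟩`, the radius of the theorem lies below the one used in the
iteration, and energies increase with the radius. -/
theorem le_radius {R t a : ℝ} (ha : 0 ≤ a) (ht : 0 ≤ t) : R - a * √(bracket t) ≤ radius a R t := by
  have h1 := sqrt_one_add_le ht
  have h2 := Real.sqrt_le_sqrt (le_bracket t)
  unfold radius
  nlinarith

/-- The loss is at most `lossConst ε² (1 + √t)`. The smallness of `ε` relative to `√R` makes the
first part at most `R / 4`, and the choice of the final time does the same for the second. -/
theorem radius_bracket_pos {R ε t : ℝ} (hR : 0 < R) (hε : 0 < ε)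
    (hεR : ε ≤ 1 / (2 * lossConst) * √R) (ht : 0 ≤ t)
    (htT : t ≤ 1 / (16 * lossConst ^ 2) * R ^ 2 / ε ^ 4) :
    0 < R - lossConst * ε ^ 2 * √(bracket t) := by
  have hL := lossConst_ge
  have hL0 : 0 < lossConst := by linarith
  have h1 : √(bracket t) ≤ 1 + √t := (Real.sqrt_le_sqrt (bracket_le ht)).trans (sqrt_one_add_le ht)
  have h2 : √t ≤ R / (4 * lossConst * ε ^ 2) := by
    refine Real.sqrt_le_iff.2 ⟨by positivity, htT.trans (le_of_eq ?_)⟩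
    field_simp
    norm_num
  have h3 : lossConst * ε ^ 2 * √t ≤ R / 4 := by
    calc lossConst * ε ^ 2 * √t ≤ lossConst * ε ^ 2 * (R / (4 * lossConst * ε ^ 2)) := by gcongr
      _ = R / 4 := by field_simp
  have h4 : lossConst * ε ^ 2 ≤ R / 4 := by
    calc lossConst * ε ^ 2 ≤ lossConst * (1 / (2 * lossConst) * √R) ^ 2 := by gcongr
      _ = R / (4 * lossConst) := by
        rw [mul_pow, Real.sq_sqrt hR.le]
        field_simp
        norm_num
      _ ≤ R / 4 := by
        gcongr
        linarith
  have h5 : lossConst * ε ^ 2 * √(bracket t) ≤ lossConst * ε ^ 2 * (1 + √t) := by gcongr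
  linarith

end ScreenedVP

end

/-! ### The main theorem -/

theorem theorem1p2 :
    ∃ C c K ε₀ : ℝ, 0 < C ∧ 0 < c ∧ 0 < K ∧ 0 < ε₀ ∧
      ∀ (R ε : ℝ) (μ₀ : ℝ × ℝ → ℝ), 0 < R → 0 < ε → ε ≤ ε₀ → ε ≤ ε₀ * Real.sqrt R →
        ScreenedVP.totalEnergy R μ₀ ≤ ENNReal.ofReal ε →
        ∃ T : ℝ, c * R ^ 2 / ε ^ 4 ≤ T ∧
          ∃ (μ : ℝ → ℝ × ℝ → ℝ) (φ : ℝ → ℝ → ℝ),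
            ScreenedVP.IsSolution T μ₀ μ φ ∧
            (∀ (μ' : ℝ → ℝ × ℝ → ℝ) (φ' : ℝ → ℝ → ℝ), ScreenedVP.IsSolution T μ₀ μ' φ' →
              ∀ t ∈ Set.Icc 0 T, μ' t = μ t ∧ φ' t = φ t) ∧
            ∀ t ∈ Set.Icc 0 T,
              0 < R - C * ε ^ 2 * Real.sqrt (ScreenedVP.bracket t) ∧
              ScreenedVP.totalEnergy (R - C * ε ^ 2 * Real.sqrt (ScreenedVP.bracket t))
                (ScreenedVP.profile μ t) ≤ ENNReal.ofReal (K * ε) := by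
  have hL := ScreenedVP.lossConst_ge
  have hL0 : 0 < ScreenedVP.lossConst := by linarith
  -- The constants `c` and `ε₀` are those for which `radius_bracket_pos` keeps the radius positive.
  -- `K = 8` is the factor 4 between the physical and the Fourier energy times the factor 2 of the
  -- majorant bound.
  refine ⟨ScreenedVP.lossConst, 1 / (16 * ScreenedVP.lossConst ^ 2), 8,
    1 / (2 * ScreenedVP.lossConst), hL0, by positivity, by norm_num, by positivity, ?_⟩
  intro R ε μ₀ hR hε _ hεR hμ₀
  set T : ℝ := 1 / (16 * ScreenedVP.lossConst ^ 2) * R ^ 2 / ε ^ 4 with hTdef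
  have hT : 0 ≤ T := by positivity
  set a : ℝ := ScreenedVP.lossConst * ε ^ 2 with ha
  have ha0 : 0 < a := by positivity
  obtain ⟨g, hgm, hgh, hge, hg0⟩ := ScreenedVP.exists_transform hR
    (hμ₀.trans_lt ENNReal.ofReal_lt_top)
  have hpos : ∀ t ∈ Set.Icc 0 T, 0 < R - a * Real.sqrt (ScreenedVP.bracket t) := fun t ht =>
    ScreenedVP.radius_bracket_pos hR hε hεR ht.1 ht.2
  have hle : ∀ t ∈ Set.Icc 0 T, R - a * Real.sqrt (ScreenedVP.bracket t) ≤
      ScreenedVP.radius a R t := fun t ht => ScreenedVP.le_radius ha0.le ht.1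
  have hRT : 0 < ScreenedVP.radius a R T :=
    (hpos T ⟨hT, le_rfl⟩).trans_le (hle T ⟨hT, le_rfl⟩)
  have hmaj : ∀ t ∈ Set.Icc 0 T, ScreenedVP.gen (ScreenedVP.radius a R t)
      (ScreenedVP.en (ScreenedVP.majLim (fun p => ‖g p‖ₑ) t)) ≤ 2 * ENNReal.ofReal ε :=
    fun t ht => ScreenedVP.gen_en_majLim_le ha0 hT hRT.le (ScreenedVP.small_of_lossConst hε)
      hgm.enorm (hge.trans hμ₀) ht
  -- Positivity of the radius at the final time makes all moments of the majorant finite at `T`,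
  -- hence at all earlier times.
  have hflow : ScreenedVP.Flow T g (ScreenedVP.sol g) :=
    ScreenedVP.flow_sol hgm hgh (ScreenedVP.sn_lt_top_of_gen hRT
      ((hmaj T ⟨hT, le_rfl⟩).trans_lt (ENNReal.mul_lt_top (by simp) ENNReal.ofReal_lt_top)))
  have hgr : ScreenedVP.Rapid g :=
    ⟨hgm, ScreenedVP.sn_lt_top_of_gen hR ((hge.trans hμ₀).trans_lt ENNReal.ofReal_lt_top)⟩
  have hsol := hflow.isSolution hgr.integrable hT hg0
  refine ⟨T, le_rfl, ScreenedVP.Flow.mu (ScreenedVP.sol g), ScreenedVP.Flow.phi (ScreenedVP.sol g),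
    hsol, fun μ' φ' h' => h'.unique hsol, fun t ht => ⟨hpos t ht, ?_⟩⟩
  rw [ScreenedVP.Flow.profile_mu]
  calc _ ≤ 4 * ScreenedVP.gen (R - a * Real.sqrt (ScreenedVP.bracket t))
        (ScreenedVP.en fun p => ‖ScreenedVP.sol g t p‖ₑ) :=
        ScreenedVP.totalEnergy_rsyn_le (hflow.rapid ht) _
    _ ≤ 4 * ScreenedVP.gen (ScreenedVP.radius a R t)
        (ScreenedVP.en (ScreenedVP.majLim (fun p => ‖g p‖ₑ) t)) := by
        refine mul_le_mul_right ((ScreenedVP.gen_mono fun n => ?_).trans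
          (ScreenedVP.gen_mono_left (hpos t ht).le (hle t ht) _)) _
        exact ScreenedVP.l2_mono fun p => mul_le_mul_right
          (mul_le_mul_right (ScreenedVP.enorm_sol_le hgm t p) _) _
    _ ≤ 4 * (2 * ENNReal.ofReal ε) := mul_le_mul_right (hmaj t ht) _
    _ = ENNReal.ofReal (8 * ε) := by
        rw [← mul_assoc, ENNReal.ofReal_mul (by norm_num)]
        norm_num
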